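/- **Proposition 4.6.** Let $G$ be a complex reductive algebraic group (the complexification of a compact Lie group) with Lie algebra $\mathfrak g$, and let $\mathcal O=\mathbb C[[z]]$. Let $G(\mathcal O)$ be the arc group, i.e. the affine group scheme over $\mathbb C$ with $R$-points $G(R[[z]])$, let $\mathbb C^*$ act on it as the two-fold cover of loop rotation, $t\colon z\mapsto t^2z$, and put $\tilde G_{\mathcal O}=G(\mathcal O)\rtimes\mathbb C^*$. Let $V$ be an algebraic representation of $\tilde G_{\mathcal O}$ (of any dimension). Then $V$ has an injective resolution $0\to V\to I^0\to I^1\to\cdots$ in the category of algebraic representations of $\tilde G_{\mathcal O}$, so that the derived $G(\mathcal O)$-invariants of $V$, $$\mathrm{Hom}^{\mathbb B\mathbb C^*}(\mathcal O_{\mathbb B\tilde G_{\mathcal O}},V)\;:=\;\bigl[(I^0)^{G(\mathcal O)}\to (I^1)^{G(\mathcal O)}\to (I^2)^{G(\mathcal O)}\to\cdots\bigr],$$ a complex of representations of $\mathbb C^*=\tilde G_{\mathcal O}/G(\mathcal O)$, are defined; and for every such resolution there is a morphism of complexes of $\mathbb C^*$-representations $$\bigl[V\otimes \mathrm{Sym}^\bullet((z\mathfrak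 g(\mathcal O))^*[-1])\bigr]^G\;\longrightarrow\;\mathrm{Hom}^{\mathbb B\mathbb C^*}(\mathcal O_{\mathbb B\tilde G_{\mathcal O}},V)$$ which is a quasi-isomorphism. Here $z\mathfrak g(\mathcal O)=z\,\mathfrak g[[z]]$ is the Lie algebra of the kernel of the evaluation $G(\mathcal O)\to G$, $g\mapsto g(0)$; it acts on $V$ by differentiating the action of $G(\mathcal O)$. Its dual $(z\mathfrak g(\mathcal O))^*$ is the continuous dual $\varinjlim_m\,(z\mathfrak g(\mathcal O)/z^{m+1}\mathfrak g(\mathcal O))^*$, and $V\otimes \mathrm{Sym}^n((z\mathfrak g(\mathcal O))^*[-1])=V\otimes\Lambda^n(z\mathfrak g(\mathcal O))^*$, placed in degree $n$, is the space of continuous alternating $n$-forms on $z\mathfrak g(\mathcal O)$ with values in $V$, with the Chevalley–Eilenberg differential $$(d\omega)(x_0,\dots,x_n)=\sum_i(-1)^i\,x_i\cdot\omega(\dots,\hat x_i,\dots)+\sum_{i<j}(-1)^{i+j}\,\omega([x_i,x_j],\dots,\hat x_i,\dots,\hat x_j,\dots).$$ The group $\tilde G_{\mathcal O}$ acts on these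 forms through its action on $V$ and its adjoint action on $z\mathfrak g(\mathcal O)$; $[-]^G$ is the space of invariants of the subgroup $G\subset G(\mathcal O)$ of constant arcs, and $\mathbb C^*$ acts on it as a subgroup of $\tilde G_{\mathcal O}$. -/

import Mathlib

universe v

noncomputable section
namespace ArcRep
open WithConv Coalgebra
open scoped TensorProduct

section ChevalleyEilenberg

open AlternatingMap

variable {L M : Type*} [LieRing L] [LieAlgebra ℂ L] [AddCommGroup M] [Module ℂ M]

/-- The derivation extension of `f : End L` to cochains:
`v ↦ ∑ k, ω (v₁, …, f v_k, …, v_n)`. -/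
def altDer {n : ℕ} (f : Module.End ℂ L) (ω : L [⋀^Fin n]→ₗ[ℂ] M) : L [⋀^Fin n]→ₗ[ℂ] M where
  toMultilinearMap :=
    ∑ k, ω.toMultilinearMap.compLinearMap (fun j => if j = k then f else LinearMap.id)
  map_eq_zero_of_eq' := by
    intro v i j hv hij
    have key : ∀ k, (ω.toMultilinearMap.compLinearMap
        (fun j => if j = k then f else LinearMap.id)) v = ω (Function.update v k (f (v k))) := by
      intro k
      simp only [MultilinearMap.compLinearMap_apply, coe_multilinearMap]
      congr 1
      ext l
      by_cases h : l = k
      · subst h; simp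
      · simp [h]
    simp only [MultilinearMap.toFun_eq_coe, sum_apply]
    rw [Fintype.sum_eq_add i j hij]
    · rw [key, key, ← hv]
      have := ω.map_swap (Function.update v i (f (v i))) hij
      rw [show Function.update v j (f (v i)) =
        Function.update v i (f (v i)) ∘ Equiv.swap i j from ?_, this]
      · simp
      · ext l
        by_cases h1 : l = i
        · subst h1; simp [Function.update_of_ne hij, Function.update_of_ne hij.symm, hv]
        · by_cases h2 : l = j
          · subst h2; simp
          · simp [h1, h2, Equiv.swap_apply_of_ne_of_ne]
    · rintro k ⟨h1, h2⟩
      rw [key]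
      exact ω.map_eq_zero_of_eq _ (by simp [Function.update_of_ne h1.symm,
        Function.update_of_ne h2.symm, hv]) hij

lemma altDer_apply {n : ℕ} (f : Module.End ℂ L) (ω : L [⋀^Fin n]→ₗ[ℂ] M) (v : Fin n → L) :
    altDer f ω v = ∑ k, ω (Function.update v k (f (v k))) := by
  change (∑ k, ω.toMultilinearMap.compLinearMap (fun j => if j = k then f else LinearMap.id)) v = _
  rw [sum_apply]
  refine Finset.sum_congr rfl fun k _ => ?_
  simp only [MultilinearMap.compLinearMap_apply, coe_multilinearMap]
  congr 1
  ext l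
  by_cases h : l = k
  · subst h; simp
  · simp [h]

lemma altDer_curryLeft {n : ℕ} (f : Module.End ℂ L) (ω : L [⋀^Fin (n + 1)]→ₗ[ℂ] M) (x : L) :
    (altDer f ω).curryLeft x = ω.curryLeft (f x) + altDer f (ω.curryLeft x) := by
  ext v
  simp only [curryLeft_apply_apply, altDer_apply, AlternatingMap.add_apply, Fin.sum_univ_succ]
  congr 1
  · congr 1
    ext l
    refine Fin.cases ?_ (fun l => ?_) l <;> simp [Matrix.vecCons]
  · refine Finset.sum_congr rfl fun k _ => ?_
    simp [Matrix.vecCons]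

lemma curryLeft_ext {n : ℕ} {ω η : L [⋀^Fin (n + 1)]→ₗ[ℂ] M}
    (h : ∀ x, ω.curryLeft x = η.curryLeft x) : ω = η := by
  ext v
  have hv : v = Matrix.vecCons (v 0) (Matrix.vecTail v) := by
    ext l; refine Fin.cases ?_ (fun l => ?_) l <;> simp [Matrix.vecTail]
  rw [hv, ← curryLeft_apply_apply, h, curryLeft_apply_apply]

lemma altDer_add {n : ℕ} (f : Module.End ℂ L) (ω η : L [⋀^Fin n]→ₗ[ℂ] M) :
    altDer f (ω + η) = altDer f ω + altDer f η := by
  ext v; simp [altDer_apply, Finset.sum_add_distrib]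

lemma altDer_sub {n : ℕ} (f : Module.End ℂ L) (ω η : L [⋀^Fin n]→ₗ[ℂ] M) :
    altDer f (ω - η) = altDer f ω - altDer f η := by
  ext v; simp [altDer_apply, Finset.sum_sub_distrib]

lemma altDer_comm {n : ℕ} (f g : Module.End ℂ L) (ω : L [⋀^Fin n]→ₗ[ℂ] M) :
    altDer f (altDer g ω) - altDer g (altDer f ω) = - altDer (f * g - g * f) ω := by
  induction n with
  | zero => ext v; simp [altDer_apply]
  | succ n ih =>
    refine curryLeft_ext fun z => ?_
    have e : ∀ ω η : L [⋀^Fin (n + 1)]→ₗ[ℂ] M,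
        (ω - η).curryLeft z = ω.curryLeft z - η.curryLeft z := fun _ _ => rfl
    have e' : ∀ ω : L [⋀^Fin (n + 1)]→ₗ[ℂ] M, (-ω).curryLeft z = -ω.curryLeft z := fun _ => rfl
    have h := ih (ω.curryLeft z)
    rw [e, e']
    simp only [altDer_curryLeft, altDer_add, LinearMap.sub_apply,
      Module.End.mul_apply, map_sub] at h ⊢
    rw [neg_add, ← h]
    abel

variable [LieRingModule L M] [LieModule ℂ L M]

/-- The action on values: `v ↦ x · ω v`. -/
def valAct {n : ℕ} (x : L) (ω : L [⋀^Fin n]→ₗ[ℂ] M) : L [⋀^Fin n]→ₗ[ℂ] M :=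
  (LieModule.toEnd ℂ L M x).compAlternatingMap ω


lemma valAct_apply {n : ℕ} (x : L) (ω : L [⋀^Fin n]→ₗ[ℂ] M) (v : Fin n → L) :
    valAct x ω v = ⁅x, ω v⁆ := rfl

/-- Cartan's Lie derivative. -/
def lieDer {n : ℕ} (x : L) (ω : L [⋀^Fin n]→ₗ[ℂ] M) : L [⋀^Fin n]→ₗ[ℂ] M :=
  valAct x ω - altDer (LieAlgebra.ad ℂ L x) ω

/-- Auxiliary, used only to prove that the Chevalley-Eilenberg formula below is alternating: the
form whose alternating sum is the differential (each bracket term occurs twice in that sum,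
whence the `1/2`). -/
def ceAuxForm {n : ℕ} (ω : L [⋀^Fin n]→ₗ[ℂ] M) : L →ₗ[ℂ] L [⋀^Fin n]→ₗ[ℂ] M where
  toFun x := valAct x ω - (1 / 2 : ℂ) • altDer (LieAlgebra.ad ℂ L x) ω
  map_add' x y := by
    ext v
    simp only [AlternatingMap.sub_apply, AlternatingMap.add_apply, AlternatingMap.smul_apply,
      valAct_apply, altDer_apply, map_add, LinearMap.add_apply, add_lie,
      AlternatingMap.map_update_add, Finset.sum_add_distrib, smul_add]
    abel
  map_smul' c x := by
    ext v
    simp only [AlternatingMap.sub_apply, AlternatingMap.smul_apply,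
      valAct_apply, altDer_apply, map_smul, LinearMap.smul_apply, smul_lie,
      AlternatingMap.map_update_smul, ← Finset.smul_sum, smul_sub, RingHom.id_apply]
    rw [smul_comm]

/-- Auxiliary form of the differential; it agrees with `ceD`. -/
def ceAux {n : ℕ} (ω : L [⋀^Fin n]→ₗ[ℂ] M) : L [⋀^Fin (n + 1)]→ₗ[ℂ] M :=
  alternatizeUncurryFin (ceAuxForm ω)

lemma ceAux_apply {n : ℕ} (ω : L [⋀^Fin n]→ₗ[ℂ] M) (v : Fin (n + 1) → L) :
    ceAux ω v = ∑ i : Fin (n + 1), (-1 : ℤ) ^ (i : ℕ) • ceAuxForm ω (v i) (i.removeNth v) := by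
  rw [ceAux, alternatizeUncurryFin_apply]

lemma ceAux_curryLeft {n : ℕ} (ω : L [⋀^Fin (n + 1)]→ₗ[ℂ] M) (x : L) :
    (ceAux ω).curryLeft x = lieDer x ω - ceAux (ω.curryLeft x) := by
  ext v
  rw [curryLeft_apply_apply, ceAux_apply, Fin.sum_univ_succ, AlternatingMap.sub_apply, ceAux_apply]
  have h0 : altDer (LieAlgebra.ad ℂ L x) ω v = - ∑ i : Fin (n + 1), (-1 : ℤ) ^ (i : ℕ) •
      ω (Matrix.vecCons ⁅v i, x⁆ (i.removeNth v)) := by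
    rw [altDer_apply, ← Finset.sum_neg_distrib]
    refine Finset.sum_congr rfl fun i _ => ?_
    have := AlternatingMap.neg_one_pow_smul_map_insertNth ω i ⁅v i, x⁆ (i.removeNth v)
    rw [LieAlgebra.ad_apply, ← this, Fin.insertNth_removeNth, ← lie_skew x (v i), ← neg_one_smul ℂ,
      AlternatingMap.map_update_smul, smul_smul, ← mul_pow]
    simp
  have h1 : ∀ i : Fin (n + 1), ceAuxForm ω (v i) (Fin.removeNth i.succ (Matrix.vecCons x v)) =
      ceAuxForm (ω.curryLeft x) (v i) (i.removeNth v)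
        - (1 / 2 : ℂ) • ω (Matrix.vecCons ⁅v i, x⁆ (i.removeNth v)) := by
    intro i
    have hv : Fin.removeNth i.succ (Matrix.vecCons x v) = Matrix.vecCons x (i.removeNth v) := by
      ext l
      refine Fin.cases ?_ (fun l => ?_) l <;> simp [Matrix.vecCons, Fin.removeNth]
    have := congrArg (fun f => f (i.removeNth v))
      (altDer_curryLeft (LieAlgebra.ad ℂ L (v i)) ω x)
    simp only [curryLeft_apply_apply, AlternatingMap.add_apply] at this
    rw [hv]
    simp only [ceAuxForm, LinearMap.coe_mk, AddHom.coe_mk, AlternatingMap.sub_apply,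
      AlternatingMap.smul_apply, valAct_apply, this, curryLeft_apply_apply, smul_add,
      LieAlgebra.ad_apply]
    abel
  simp only [Fin.val_succ, pow_succ, mul_neg_one, neg_smul, Finset.sum_neg_distrib,
    Fin.val_zero, pow_zero, one_smul, Matrix.cons_val_succ, Matrix.cons_val_zero, h1, smul_sub,
    Finset.sum_sub_distrib]
  have h2 : Fin.removeNth 0 (Matrix.vecCons x v) = v := by ext l; simp [Fin.removeNth]
  have h3 : ∑ i : Fin (n + 1), (-1 : ℤ) ^ (i : ℕ) • (1 / 2 : ℂ) •
      ω (Matrix.vecCons ⁅v i, x⁆ (i.removeNth v)) =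
      - ((1 / 2 : ℂ) • altDer (LieAlgebra.ad ℂ L x) ω v) := by
    rw [h0, smul_neg, neg_neg, Finset.smul_sum]
    exact Finset.sum_congr rfl fun i _ => smul_comm _ _ _
  rw [h3, h2]
  simp only [ceAuxForm, LinearMap.coe_mk, AddHom.coe_mk, AlternatingMap.sub_apply,
      AlternatingMap.smul_apply, lieDer]
  have : altDer (LieAlgebra.ad ℂ L x) ω v = (1/2 : ℂ) • altDer (LieAlgebra.ad ℂ L x) ω v
    + (1/2 : ℂ) • altDer (LieAlgebra.ad ℂ L x) ω v := by
    rw [← add_smul]; norm_num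
  conv_rhs => rw [this]
  abel

lemma ceAux_zero_apply (ω : L [⋀^Fin 0]→ₗ[ℂ] M) (v : Fin 1 → L) :
    ceAux ω v = ⁅v 0, ω ![]⁆ := by
  rw [ceAux_apply]
  simp only [Nat.reduceAdd, Finset.univ_unique, Fin.default_eq_zero, Fin.isValue, ceAuxForm,
    LinearMap.coe_mk, AddHom.coe_mk, AlternatingMap.sub_apply, AlternatingMap.smul_apply,
    valAct_apply, altDer_apply, Finset.univ_eq_empty, Finset.sum_empty, smul_zero, sub_zero,
    Finset.sum_singleton, Fin.val_zero, pow_zero, one_smul]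
  exact congrArg (fun t => ⁅v 0, ω t⁆) (Subsingleton.elim _ _)

/-- The right hand side of the Chevalley-Eilenberg formula, see `ceD`. -/
def ceFormula {n : ℕ} (ω : L [⋀^Fin n]→ₗ[ℂ] M) (v : Fin (n + 1) → L) : M :=
  ∑ i : Fin (n + 1), (-1 : ℤ) ^ (i : ℕ) • (⁅v i, ω (i.removeNth v)⁆ -
    ∑ k : Fin n with i ≤ k.castSucc,
      ω (Function.update (i.removeNth v) k ⁅v i, i.removeNth v k⁆))

lemma ceFormula_eq {n : ℕ} (ω : L [⋀^Fin n]→ₗ[ℂ] M) (v : Fin (n + 1) → L) :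
    ceFormula ω v = ceAux ω v := by
  induction n with
  | zero =>
    rw [ceAux_zero_apply]
    simp only [ceFormula, Nat.reduceAdd, Finset.univ_unique, Fin.default_eq_zero, Fin.isValue,
      Finset.univ_eq_empty, Finset.filter_empty, Finset.sum_empty, sub_zero,
      Finset.sum_singleton, Fin.val_zero, pow_zero, one_smul]
    exact congrArg (fun t => ⁅v 0, ω t⁆) (Subsingleton.elim _ _)
  | succ n ih =>
    obtain ⟨x, w, rfl⟩ : ∃ x w, v = Matrix.vecCons x w := ⟨v 0, Matrix.vecTail v, by
      ext l; refine Fin.cases ?_ (fun l => ?_) l <;> simp [Matrix.vecTail]⟩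
    rw [← curryLeft_apply_apply, ceAux_curryLeft, AlternatingMap.sub_apply, ← ih]
    rw [ceFormula, Fin.sum_univ_succ, ceFormula, sub_eq_add_neg (lieDer x ω w), ← Finset.sum_neg_distrib]
    congr 1
    · have h2 : Fin.removeNth 0 (Matrix.vecCons x w) = w := by ext l; simp [Fin.removeNth]
      simp [h2, lieDer, valAct_apply, altDer_apply]
    · refine Finset.sum_congr rfl fun i _ => ?_
      have hv : Fin.removeNth i.succ (Matrix.vecCons x w) = Matrix.vecCons x (i.removeNth w) := by
        ext l
        refine Fin.cases ?_ (fun l => ?_) l <;> simp [Matrix.vecCons, Fin.removeNth]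
      rw [hv, Fin.val_succ, pow_succ, mul_neg_one, neg_smul]
      congr 3
      rw [Finset.sum_filter, Finset.sum_filter, Fin.sum_univ_succ]
      simp only [Matrix.cons_val_succ, curryLeft_apply_apply]
      rw [if_neg (by simp), zero_add]
      refine Finset.sum_congr rfl fun k _ => ?_
      simp only [Fin.le_def, Fin.val_succ, Fin.val_castSucc, add_le_add_iff_right]
      congr 2
      simp [Matrix.vecCons]

variable (L M) in
/-- The Chevalley-Eilenberg differential on alternating cochains of `L` with values in `M`,
`(dω)(v₀, …, vₙ) = ∑ᵢ (-1)ⁱ (vᵢ · ω(…, v̂ᵢ, …) - ∑_{k > i} ω(…, v̂ᵢ, …, [vᵢ, v_k], …))`,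
where `[vᵢ, v_k]` stands in the place of `v_k`.  Moving it to the first place gives the usual
terms `(-1)^{i+k} ω([vᵢ, v_k], …, v̂ᵢ, …, v̂_k, …)`. -/
def ceD (n : ℕ) : (L [⋀^Fin n]→ₗ[ℂ] M) →ₗ[ℂ] (L [⋀^Fin (n + 1)]→ₗ[ℂ] M) where
  toFun ω :=
    { toFun := fun v => ∑ i : Fin (n + 1), (-1 : ℤ) ^ (i : ℕ) • (⁅v i, ω (i.removeNth v)⁆ -
        ∑ k : Fin n with i ≤ k.castSucc,
          ω (Function.update (i.removeNth v) k ⁅v i, i.removeNth v k⁆))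
      map_update_add' := fun v i x y => by
        have h := ceFormula_eq ω
        simp only [ceFormula] at h
        rw [h, h, h]
        convert (ceAux ω).map_update_add v i x y
      map_update_smul' := fun v i c x => by
        have h := ceFormula_eq ω
        simp only [ceFormula] at h
        rw [h, h]
        convert (ceAux ω).map_update_smul v i c x
      map_eq_zero_of_eq' := fun v i j hv hij => by
        have h := ceFormula_eq ω v
        simp only [ceFormula] at h
        exact h.trans ((ceAux ω).map_eq_zero_of_eq v hv hij) }
  map_add' ω η := by
    ext v
    simp only [coe_mk, MultilinearMap.coe_mk, AlternatingMap.add_apply, lie_add,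
      Finset.sum_add_distrib]
    rw [← Finset.sum_add_distrib]
    refine Finset.sum_congr rfl fun i _ => ?_
    rw [← smul_add]
    congr 1
    abel
  map_smul' c ω := by
    ext v
    simp only [coe_mk, MultilinearMap.coe_mk, AlternatingMap.smul_apply, lie_smul,
      ← Finset.smul_sum, ← smul_sub, RingHom.id_apply, smul_comm _ c]

lemma ceD_apply {n : ℕ} (ω : L [⋀^Fin n]→ₗ[ℂ] M) (v : Fin (n + 1) → L) :
    ceD L M n ω v = ∑ i : Fin (n + 1), (-1 : ℤ) ^ (i : ℕ) • (⁅v i, ω (i.removeNth v)⁆ -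
        ∑ k : Fin n with i ≤ k.castSucc,
          ω (Function.update (i.removeNth v) k ⁅v i, i.removeNth v k⁆)) := rfl

lemma ceD_eq_ceAux {n : ℕ} (ω : L [⋀^Fin n]→ₗ[ℂ] M) : ceD L M n ω = ceAux ω := by
  ext v
  exact ceFormula_eq ω v

lemma ceD_curryLeft {n : ℕ} (ω : L [⋀^Fin (n + 1)]→ₗ[ℂ] M) (x : L) :
    (ceD L M (n + 1) ω).curryLeft x = lieDer x ω - ceD L M n (ω.curryLeft x) := by
  rw [ceD_eq_ceAux, ceD_eq_ceAux, ceAux_curryLeft]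

lemma ceD_zero_curryLeft (ω : L [⋀^Fin 0]→ₗ[ℂ] M) (x : L) :
    (ceD L M 0 ω).curryLeft x = lieDer x ω := by
  ext v
  rw [ceD_eq_ceAux, curryLeft_apply_apply, ceAux_zero_apply]
  simp only [lieDer, AlternatingMap.sub_apply, valAct_apply, altDer_apply, Finset.univ_eq_empty,
    Finset.sum_empty, sub_zero, Matrix.cons_val_zero]
  exact congrArg (fun t => ⁅x, ω t⁆) (Subsingleton.elim _ _)

lemma lieDer_sub {n : ℕ} (x : L) (ω η : L [⋀^Fin n]→ₗ[ℂ] M) :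
    lieDer x (ω - η) = lieDer x ω - lieDer x η := by
  ext v
  simp only [lieDer, altDer_sub, AlternatingMap.sub_apply, valAct_apply, lie_sub]
  abel

lemma altDer_valAct {n : ℕ} (f : Module.End ℂ L) (x : L) (ω : L [⋀^Fin n]→ₗ[ℂ] M) :
    altDer f (valAct x ω) = valAct x (altDer f ω) := by
  ext v; simp [altDer_apply, valAct_apply, lie_sum]

lemma lieDer_comm {n : ℕ} (x y : L) (ω : L [⋀^Fin n]→ₗ[ℂ] M) :
    lieDer x (lieDer y ω) - lieDer y (lieDer x ω) = lieDer ⁅x, y⁆ ω := by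
  have h := altDer_comm (LieAlgebra.ad ℂ L x) (LieAlgebra.ad ℂ L y) ω
  have e : LieAlgebra.ad ℂ L x * LieAlgebra.ad ℂ L y - LieAlgebra.ad ℂ L y * LieAlgebra.ad ℂ L x =
      LieAlgebra.ad ℂ L ⁅x, y⁆ := by
    ext z; simp
  rw [e] at h
  have hs : ∀ (z : L) (a b : L [⋀^Fin n]→ₗ[ℂ] M),
      valAct z (a - b) = valAct z a - valAct z b := by
    intro z a b; ext v; simp [valAct_apply]
  have h2 : valAct x (valAct y ω) - valAct y (valAct x ω) = valAct ⁅x, y⁆ ω := by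
    ext v; simp [valAct_apply]
  simp only [lieDer, altDer_sub, altDer_valAct, hs]
  rw [sub_eq_add_neg (valAct ⁅x, y⁆ ω), ← h, ← h2]
  abel

lemma lieDer_curryLeft {n : ℕ} (x y : L) (ω : L [⋀^Fin (n + 1)]→ₗ[ℂ] M) :
    (lieDer x ω).curryLeft y = lieDer x (ω.curryLeft y) - ω.curryLeft ⁅x, y⁆ := by
  have e : (lieDer x ω).curryLeft y =
    (valAct x ω).curryLeft y - (altDer (LieAlgebra.ad ℂ L x) ω).curryLeft y := rfl
  have e' : (valAct x ω).curryLeft y = valAct x (ω.curryLeft y) := rfl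
  rw [e, e', altDer_curryLeft, LieAlgebra.ad_apply, lieDer]
  abel

lemma ceD_lieDer {n : ℕ} (x : L) (ω : L [⋀^Fin n]→ₗ[ℂ] M) :
    ceD L M n (lieDer x ω) = lieDer x (ceD L M n ω) := by
  induction n with
  | zero =>
    refine curryLeft_ext fun y => ?_
    rw [lieDer_curryLeft, ceD_zero_curryLeft, ceD_zero_curryLeft, ceD_zero_curryLeft,
      ← lieDer_comm x y]
    abel
  | succ n ih =>
    refine curryLeft_ext fun y => ?_
    rw [lieDer_curryLeft, ceD_curryLeft, ceD_curryLeft, ceD_curryLeft, lieDer_curryLeft,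
      map_sub, lieDer_sub, ih, ← lieDer_comm x y]
    abel

/-- The Chevalley-Eilenberg differential squares to zero. -/
lemma ceD_ceD {n : ℕ} (ω : L [⋀^Fin n]→ₗ[ℂ] M) : ceD L M (n + 1) (ceD L M n ω) = 0 := by
  induction n with
  | zero =>
    refine curryLeft_ext fun y => ?_
    rw [ceD_curryLeft, ceD_zero_curryLeft, ceD_lieDer, sub_self]
    rfl
  | succ n ih =>
    refine curryLeft_ext fun y => ?_
    rw [ceD_curryLeft, ceD_curryLeft, map_sub, ih, ceD_lieDer, sub_zero, sub_self]
    rfl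

lemma ceD_equivariant {n : ℕ} (ψ : L →ₗ[ℂ] L) (τ : M →ₗ[ℂ] M)
    (hψ : ∀ x y, ψ ⁅x, y⁆ = ⁅ψ x, ψ y⁆) (hτ : ∀ x m, τ ⁅ψ x, m⁆ = ⁅x, τ m⁆)
    (ω : L [⋀^Fin n]→ₗ[ℂ] M) :
    ceD L M n (τ.compAlternatingMap (ω.compLinearMap ψ)) =
      τ.compAlternatingMap ((ceD L M n ω).compLinearMap ψ) := by
  ext v
  simp only [LinearMap.compAlternatingMap_apply, AlternatingMap.compLinearMap_apply, ceD_apply,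
    map_sum, map_zsmul, map_sub]
  refine Finset.sum_congr rfl fun i _ => ?_
  congr 2
  · exact (hτ _ _).symm
  · refine Finset.sum_congr rfl fun k _ => ?_
    congr 2
    ext l
    by_cases h : l = k
    · subst h; simp [hψ, Fin.removeNth]
    · simp [h, Fin.removeNth]

end ChevalleyEilenberg


section Groups

variable (A : Type) [CommRing A] [HopfAlgebra ℂ A]

/-- The group `G(S)` of `S`-points of the affine algebraic group `G = Spec A` over `ℂ`: the
algebra homomorphisms `A → S` with the convolution product. -/
abbrev Points (S : Type) [CommRing S] [Algebra ℂ S] : Type := WithConv (A →ₐ[ℂ] S)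

/-- The group structure on `G(S)`: convolution, inverse given by the antipode. -/
instance pointsGroup (S : Type) [CommRing S] [Algebra ℂ S] : Group (Points A S) where
  inv f := toConv (f.ofConv.comp (HopfAlgebra.antipodeAlgHom ℂ A))
  inv_mul_cancel f := by
    apply WithConv.ext
    apply AlgHom.toLinearMap_injective
    have h := LinearMap.algHom_comp_convMul_distrib f.ofConv
      (toConv (HopfAlgebra.antipode ℂ (A := A))) (toConv LinearMap.id)
    rw [LinearMap.antipode_mul_id] at h
    refine Eq.trans h.symm ?_
    ext
    simp

variable {A} in
/-- Functoriality of `S ↦ G(S)`. -/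
def Points.map {S T : Type} [CommRing S] [Algebra ℂ S] [CommRing T] [Algebra ℂ T]
    (f : S →ₐ[ℂ] T) : Points A S →* Points A T where
  toFun g := toConv (f.comp g.ofConv)
  map_one' := by
    apply WithConv.ext; ext a
    simp
  map_mul' g h := by
    apply WithConv.ext
    exact AlgHom.comp_convMul_distrib f g h

/-- The arc group `G(𝒪)`, `𝒪 = ℂ[[z]]`, as a group functor: its `R`-points are `G(R[[z]])`. -/
abbrev Arc (R : Type) [CommRing R] [Algebra ℂ R] : Type := Points A (PowerSeries R)

/-- The substitution `z ↦ r z` on `R[[z]]`. -/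
def rescaleHom {R : Type} [CommRing R] [Algebra ℂ R] (r : R) :
    PowerSeries R →ₐ[ℂ] PowerSeries R :=
  { PowerSeries.rescale r with
    commutes' := fun c => by
      ext n
      simp [PowerSeries.algebraMap_apply, PowerSeries.coeff_C]
      split_ifs with h <;> simp [h] }

/-- Loop rotation through the two-fold cover: `t` acts by `z ↦ t² z`. -/
def loopRot (R : Type) [CommRing R] [Algebra ℂ R] : Rˣ →* MulAut (Arc A R) where
  toFun t := MulEquiv.ofBijective (Points.map (rescaleHom ((t : R) ^ 2))) (by
    refine Function.bijective_iff_has_inverse.2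
      ⟨Points.map (rescaleHom (((t⁻¹ : Rˣ) : R) ^ 2)), fun g => ?_, fun g => ?_⟩ <;>
    · apply WithConv.ext; ext a n
      simp [Points.map, rescaleHom, ← mul_assoc, ← mul_pow])
  map_one' := by
    ext g : 1
    apply WithConv.ext; ext a n
    simp [Points.map, rescaleHom]
  map_mul' s t := by
    ext g : 1
    apply WithConv.ext; ext a n
    simp [Points.map, rescaleHom, mul_pow, mul_assoc]

/-- The group functor `G̃_𝒪 = G(𝒪) ⋊ ℂ^*`, where `ℂ^*` is the two-fold cover of the group of loop
rotations; its value at `R` is `G(R[[z]]) ⋊ Rˣ`. -/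
abbrev ExtArc (R : Type) [CommRing R] [Algebra ℂ R] : Type := Arc A R ⋊[loopRot A R] Rˣ

variable {A} in
/-- Functoriality of `R ↦ G̃_𝒪(R)`. -/
def ExtArc.map {R S : Type} [CommRing R] [Algebra ℂ R] [CommRing S] [Algebra ℂ S]
    (f : R →ₐ[ℂ] S) : ExtArc A R →* ExtArc A S :=
  SemidirectProduct.map (Points.map (PowerSeries.mapAlgHom f)) (Units.map (f : R →* S)) (by
    intro t
    ext g : 1
    apply WithConv.ext; ext a n
    simp [Points.map, rescaleHom, loopRot, PowerSeries.mapAlgHom_apply])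

end Groups

section LieAlgebra

variable (A : Type) [CommRing A] [HopfAlgebra ℂ A]

/-- The convolution algebra of `ℂ`-linear maps `A → R[[z]]`, which contains both `G(R[[z]])` and
the Lie algebra `𝔤[[z]]` (for `R = ℂ`). -/
abbrev Conv (R : Type) [CommRing R] [Algebra ℂ R] : Type := WithConv (A →ₗ[ℂ] PowerSeries R)

/-- The commutator bracket `[x, y] = x * y - y * x` for the convolution product. -/
instance convLieRing (R : Type) [CommRing R] [Algebra ℂ R] : LieRing (Conv A R) :=
  LieRing.ofAssociativeRing

instance convLieAlgebra (R : Type) [CommRing R] [Algebra ℂ R] : LieAlgebra ℂ (Conv A R) :=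
  LieAlgebra.ofAssociativeAlgebra

variable {A} in
lemma conv_leibniz {R : Type} [CommRing R] [Algebra ℂ R] {x y : Conv A R}
    (hx : ∀ a b, x (a * b) = counit (R := ℂ) a • x b + counit (R := ℂ) b • x a)
    (hy : ∀ a b, y (a * b) = counit (R := ℂ) a • y b + counit (R := ℂ) b • y a) (a b : A) :
    (x * y) (a * b) = counit (R := ℂ) a • (x * y) b + counit (R := ℂ) b • (x * y) a
      + x a * y b + y a * x b := by
  have h1 : ∀ x : Conv A R, ∀ a, LinearMap.mul' ℂ _ (TensorProduct.map x.ofConv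
      (1 : Conv A R).ofConv (comul a)) = x a := fun x a => by
    rw [← LinearMap.convMul_apply, mul_one]
  have h2 : ∀ x : Conv A R, ∀ a, LinearMap.mul' ℂ _ (TensorProduct.map
      (1 : Conv A R).ofConv x.ofConv (comul a)) = x a := fun x a => by
    rw [← LinearMap.convMul_apply, one_mul]
  have key : ∀ p q : A ⊗[ℂ] A, LinearMap.mul' ℂ _ (TensorProduct.map x.ofConv y.ofConv (p * q)) =
      LinearMap.mul' ℂ _ (TensorProduct.map (1 : Conv A R).ofConv (1 : Conv A R).ofConv p) *
        LinearMap.mul' ℂ _ (TensorProduct.map x.ofConv y.ofConv q) +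
      LinearMap.mul' ℂ _ (TensorProduct.map (1 : Conv A R).ofConv (1 : Conv A R).ofConv q) *
        LinearMap.mul' ℂ _ (TensorProduct.map x.ofConv y.ofConv p) +
      LinearMap.mul' ℂ _ (TensorProduct.map x.ofConv (1 : Conv A R).ofConv p) *
        LinearMap.mul' ℂ _ (TensorProduct.map (1 : Conv A R).ofConv y.ofConv q) +
      LinearMap.mul' ℂ _ (TensorProduct.map (1 : Conv A R).ofConv y.ofConv p) *
        LinearMap.mul' ℂ _ (TensorProduct.map x.ofConv (1 : Conv A R).ofConv q) := by
    intro p q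
    induction p with
    | zero => simp
    | add p p' hp hp' => simp only [add_mul, map_add, hp, hp']; ring
    | tmul a b =>
      induction q with
      | zero => simp
      | add q q' hq hq' => simp only [mul_add, map_add, hq, hq']; ring
      | tmul c d =>
        simp only [Algebra.TensorProduct.tmul_mul_tmul, TensorProduct.map_tmul,
          LinearMap.mul'_apply, hx, hy, LinearMap.convOne_apply, Algebra.smul_def]
        ring
  have h3 := key (comul a) (comul b)
  rw [← Bialgebra.comul_mul, ← LinearMap.convMul_apply, ← LinearMap.convMul_apply,
    ← LinearMap.convMul_apply, ← LinearMap.convMul_apply, ← LinearMap.convMul_apply, h1, h1,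
    h2, h2, mul_one, LinearMap.convOne_apply, LinearMap.convOne_apply] at h3
  rw [h3, Algebra.smul_def, Algebra.smul_def]

/-- The Lie algebra `z𝔤(𝒪)`: since `𝔤` is the space of `ℂ`-valued derivations of `A` at the unit of
`G`, the Lie algebra `𝔤(𝒪) = 𝔤[[z]]` is the space of derivations `A → ℂ[[z]]` at the unit, with the
convolution commutator as bracket; `z𝔤(𝒪)` consists of those with vanishing constant term. -/
def zgO : LieSubalgebra ℂ (Conv A ℂ) where
  carrier := {x | (∀ a b, x (a * b) = counit (R := ℂ) a • x b + counit (R := ℂ) b • x a) ∧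
    ∀ a, PowerSeries.coeff 0 (x a) = 0}
  zero_mem' := by simp
  add_mem' := by
    rintro x y ⟨hx, hx0⟩ ⟨hy, hy0⟩
    refine ⟨fun a b => ?_, fun a => ?_⟩
    · change x (a * b) + y (a * b) = counit (R := ℂ) a • (x b + y b) + counit (R := ℂ) b • (x a + y a)
      rw [hx, hy, smul_add, smul_add]; abel
    · change PowerSeries.coeff 0 (x a + y a) = 0
      rw [map_add, hx0, hy0, add_zero]
  smul_mem' := by
    rintro c x ⟨hx, hx0⟩
    refine ⟨fun a b => ?_, fun a => ?_⟩
    · change c • x (a * b) = counit (R := ℂ) a • c • x b + counit (R := ℂ) b • c • x a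
      rw [hx, smul_add, smul_comm c, smul_comm c]
    · change PowerSeries.coeff 0 (c • x a) = 0
      rw [map_smul, hx0, smul_zero]
  lie_mem' := by
    rintro x y ⟨hx, hx0⟩ ⟨hy, hy0⟩
    refine ⟨fun a b => ?_, fun a => ?_⟩
    · change (x * y) (a * b) - (y * x) (a * b) = counit (R := ℂ) a • ((x * y) b - (y * x) b)
        + counit (R := ℂ) b • ((x * y) a - (y * x) a)
      rw [conv_leibniz hx hy, conv_leibniz hy hx, smul_sub, smul_sub]
      ring
    · change PowerSeries.coeff 0 ((x * y) a - (y * x) a) = 0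
      have h : ∀ x y : Conv A ℂ, (∀ a, PowerSeries.coeff 0 (x a) = 0) →
          PowerSeries.coeff 0 ((x * y) a) = 0 := by
        intro x y hx
        rw [(ℛ ℂ a).convMul_apply, map_sum]
        exact Finset.sum_eq_zero fun i _ => by
          simp only [PowerSeries.coeff_zero_eq_constantCoeff] at hx ⊢; simp [hx]
      rw [map_sub, h x y hx0, h y x hy0, sub_zero]

variable {A}

/-- Postcomposition with `φ : R[[z]] → S[[z]]` on convolution algebras. -/
def convMap {R S : Type} [CommRing R] [Algebra ℂ R] [CommRing S] [Algebra ℂ S]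
    (φ : PowerSeries R →ₐ[ℂ] PowerSeries S) : Conv A R →ₐ[ℂ] Conv A S where
  toFun x := toConv (φ.toLinearMap ∘ₗ x.ofConv)
  map_one' := by
    apply WithConv.ext; ext a : 1
    simp
  map_mul' x y := by
    apply WithConv.ext
    exact LinearMap.algHom_comp_convMul_distrib φ x y
  map_zero' := by
    apply WithConv.ext; ext a : 1
    simp
  map_add' x y := by
    apply WithConv.ext; ext a : 1
    simp
  commutes' c := by
    apply WithConv.ext; ext a : 1
    simp

lemma convMap_apply {R S : Type} [CommRing R] [Algebra ℂ R] [CommRing S] [Algebra ℂ S]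
    (φ : PowerSeries R →ₐ[ℂ] PowerSeries S) (x : Conv A R) (a : A) :
    (convMap φ x) a = φ (x a) := rfl

/-- A point of the arc group as an element of the convolution algebra. -/
def lin {R : Type} [CommRing R] [Algebra ℂ R] : Arc A R →* Conv A R where
  toFun g := toConv g.ofConv.toLinearMap
  map_one' := rfl
  map_mul' _ _ := rfl

lemma lin_apply {R : Type} [CommRing R] [Algebra ℂ R] (g : Arc A R) (a : A) :
    (lin g) a = g a := rfl

lemma lin_injective {R : Type} [CommRing R] [Algebra ℂ R] :
    Function.Injective (lin : Arc A R → Conv A R) := fun g h e => by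
  apply WithConv.ext
  apply AlgHom.toLinearMap_injective
  exact congrArg WithConv.ofConv e

lemma lin_map {R S : Type} [CommRing R] [Algebra ℂ R] [CommRing S] [Algebra ℂ S]
    (φ : PowerSeries R →ₐ[ℂ] PowerSeries S) (g : Arc A R) :
    lin (Points.map φ g) = convMap φ (lin g) := rfl

/-- Base change `ℂ[[z]] → R[[z]]`. -/
def psBase (R : Type) [CommRing R] [Algebra ℂ R] : PowerSeries ℂ →ₐ[ℂ] PowerSeries R :=
  PowerSeries.mapAlgHom (Algebra.ofId ℂ R)

lemma coeff_psBase (R : Type) [CommRing R] [Algebra ℂ R] (n : ℕ) (f : PowerSeries ℂ) :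
    PowerSeries.coeff n (psBase R f) = algebraMap ℂ R (PowerSeries.coeff n f) := by
  simp [psBase, PowerSeries.mapAlgHom_apply]

lemma mem_zgO {x : Conv A ℂ} : x ∈ zgO A ↔
    (∀ a b, x (a * b) = counit (R := ℂ) a • x b + counit (R := ℂ) b • x a) ∧
    ∀ a, PowerSeries.coeff 0 (x a) = 0 := Iff.rfl

/-- The point `1 + e x` of `G(R[[z]])`, for `x` in `z𝔤(𝒪)` and `e` in `R` with `e² = 0`. -/
def tang {R : Type} [CommRing R] [Algebra ℂ R] (e : R) (he : e * e = 0) (x : zgO A) :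
    Arc A R :=
  toConv (AlgHom.ofLinearMap (1 + e • convMap (psBase R) (x : Conv A ℂ)).ofConv
    (by
      have h : (x : Conv A ℂ) 1 = 0 := by
        have := x.2.1 1 1
        simpa using this
      change (1 : Conv A R) 1 + e • psBase R ((x : Conv A ℂ) 1) = 1
      rw [h, map_zero, smul_zero, add_zero, LinearMap.convOne_apply]
      simp)
    (by
      intro a b
      change (1 : Conv A R) (a * b) + e • psBase R ((x : Conv A ℂ) (a * b)) =
        ((1 : Conv A R) a + e • psBase R ((x : Conv A ℂ) a)) *
        ((1 : Conv A R) b + e • psBase R ((x : Conv A ℂ) b))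
      simp only [LinearMap.convOne_apply, x.2.1, Bialgebra.counit_mul, map_mul, map_add,
        smul_add, mul_add, add_mul, Algebra.smul_mul_assoc, Algebra.mul_smul_comm, smul_smul, he,
        zero_smul, add_zero, Algebra.smul_def (R := ℂ), AlgHom.commutes]
      rw [mul_comm (algebraMap ℂ (PowerSeries R) (counit b)) (psBase R _)]
      abel))

lemma lin_tang {R : Type} [CommRing R] [Algebra ℂ R] (e : R) (he : e * e = 0) (x : zgO A) :
    lin (tang e he x) = 1 + e • convMap (psBase R) (x : Conv A ℂ) := rfl

lemma tang_zero {R : Type} [CommRing R] [Algebra ℂ R] (x : zgO A) :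
    tang (0 : R) (zero_mul 0) x = 1 := by
  apply lin_injective
  rw [lin_tang, zero_smul, add_zero, map_one]

lemma map_tang {R S : Type} [CommRing R] [Algebra ℂ R] [CommRing S] [Algebra ℂ S]
    (f : R →ₐ[ℂ] S) (e : R) (he : e * e = 0) (x : zgO A) :
    Points.map (PowerSeries.mapAlgHom f) (tang e he x) =
      tang (f e) (by rw [← map_mul, he, map_zero]) x := by
  apply lin_injective
  rw [lin_map, lin_tang, lin_tang, map_add, map_one]
  congr 1
  apply WithConv.ext; ext a n
  simp [convMap, PowerSeries.mapAlgHom_apply, coeff_psBase]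

lemma tang_mul_tang {R : Type} [CommRing R] [Algebra ℂ R] (e : R) (he : e * e = 0)
    (x y : zgO A) : tang e he x * tang e he y = tang e he (x + y) := by
  apply lin_injective
  have hb : ((x + y : zgO A) : Conv A ℂ) = (x : Conv A ℂ) + y := rfl
  simp only [map_mul, lin_tang, mul_add, add_mul, one_mul, mul_one, smul_mul_assoc, mul_smul_comm,
    smul_smul, he, zero_smul, add_zero, hb, map_add, smul_add]
  abel

lemma tang_smul {R : Type} [CommRing R] [Algebra ℂ R] (e : R) (he : e * e = 0) (c : ℂ)
    (x : zgO A) : tang e he (c • x) = tang (c • e) (by simp [he]) x := by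
  apply lin_injective
  have hb : ((c • x : zgO A) : Conv A ℂ) = c • (x : Conv A ℂ) := rfl
  simp only [lin_tang, hb, map_smul]
  congr 1
  apply WithConv.ext; ext a n
  simp

lemma tang_comm_aux {R B : Type} [CommRing R] [Ring B] [Algebra R B] (e e' : R) (he : e * e = 0)
    (he' : e' * e' = 0) (X Y : B) : (1 + e • X) * (1 + e' • Y) =
      (1 + (e * e') • (X * Y - Y * X)) * ((1 + e' • Y) * (1 + e • X)) := by
  have h1 : ((e * e') • (X * Y - Y * X)) * (e' • Y) = 0 := by
    rw [smul_mul_smul_comm, mul_assoc, he', mul_zero, zero_smul]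
  have h2 : ((e * e') • (X * Y - Y * X)) * (e • X) = 0 := by
    rw [smul_mul_smul_comm, mul_right_comm, he, zero_mul, zero_smul]
  have h3 : (e * e') • (X * Y - Y * X) = (e • X) * (e' • Y) - (e' • Y) * (e • X) := by
    rw [smul_mul_smul_comm, smul_mul_smul_comm, mul_comm e' e, smul_sub]
  calc (1 + e • X) * (1 + e' • Y)
      = (1 + e' • Y) * (1 + e • X) + ((e • X) * (e' • Y) - (e' • Y) * (e • X)) := by
        generalize e • X = P
        generalize e' • Y = Q
        noncomm_ring
    _ = (1 + e' • Y) * (1 + e • X) + (e * e') • (X * Y - Y * X)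
        + ((e * e') • (X * Y - Y * X)) * (e' • Y) * (1 + e • X)
        + ((e * e') • (X * Y - Y * X)) * (e • X) := by rw [h1, h2, h3]; simp
    _ = _ := by
      generalize (e * e') • (X * Y - Y * X) = C
      generalize e • X = P
      generalize e' • Y = Q
      noncomm_ring

lemma tang_comm {R : Type} [CommRing R] [Algebra ℂ R] (e e' : R) (he : e * e = 0)
    (he' : e' * e' = 0) (x y : zgO A) :
    tang e he x * tang e' he' y =
      tang (e * e') (by rw [mul_mul_mul_comm, he, zero_mul]) ⁅x, y⁆ *
        (tang e' he' y * tang e he x) := by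
  apply lin_injective
  have hb : ((⁅x, y⁆ : zgO A) : Conv A ℂ) = (x : Conv A ℂ) * y - (y : Conv A ℂ) * x := rfl
  simp only [map_mul, lin_tang, hb, map_sub]
  exact tang_comm_aux e e' he he' _ _

/-! ### The adjoint action -/

/-- Elements all of whose values vanish modulo `z^{m+1}`. -/
def ConvVanish {R : Type} [CommRing R] [Algebra ℂ R] (m : ℕ) (x : Conv A R) : Prop :=
  ∀ a, ∀ k ≤ m, PowerSeries.coeff k (x a) = 0

lemma ConvVanish.mul {R : Type} [CommRing R] [Algebra ℂ R] {m : ℕ} {x y : Conv A R}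
    (h : ConvVanish m x ∨ ConvVanish m y) : ConvVanish m (x * y) := by
  intro a k hk
  rw [(ℛ ℂ a).convMul_apply, map_sum]
  refine Finset.sum_eq_zero fun i _ => ?_
  rw [PowerSeries.coeff_mul]
  refine Finset.sum_eq_zero fun p hp => ?_
  have hp' := Finset.HasAntidiagonal.mem_antidiagonal.1 hp
  rcases h with h | h
  · rw [h _ _ (by omega), zero_mul]
  · rw [h _ _ (by omega), mul_zero]

/-- The adjoint action of `h = (g, t)` on the convolution algebra: rotate by `t`, then conjugate
by `g`. -/
def adConv (h : ExtArc A ℂ) (x : Conv A ℂ) : Conv A ℂ :=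
  lin h.left * convMap (rescaleHom ((h.right : ℂ) ^ 2)) x * lin h.left⁻¹

/-- The image in `G̃_𝒪(R)` of a complex point. -/
abbrev extBase (R : Type) [CommRing R] [Algebra ℂ R] : ExtArc A ℂ →* ExtArc A R :=
  ExtArc.map (Algebra.ofId ℂ R)

lemma convMap_psBase_rescale (R : Type) [CommRing R] [Algebra ℂ R] (t : ℂ) (x : Conv A ℂ) :
    convMap (psBase R) (convMap (rescaleHom t) x) =
      convMap (rescaleHom (algebraMap ℂ R t)) (convMap (psBase R) x) := by
  apply WithConv.ext; ext a n
  simp [convMap, coeff_psBase, rescaleHom]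

lemma convMap_rescale_smul (R : Type) [CommRing R] [Algebra ℂ R] (t e : R) (x : Conv A R) :
    convMap (rescaleHom t) (e • x) = e • convMap (rescaleHom t) x := by
  apply WithConv.ext; ext a n
  simp [convMap, rescaleHom]
  ring

/-- The left component of `h · (1 + e x) · h⁻¹` computed in the convolution algebra. -/
lemma conj_tang {R : Type} [CommRing R] [Algebra ℂ R] (e : R) (he : e * e = 0) (x : zgO A)
    (h : ExtArc A ℂ) :
    lin (extBase R h * SemidirectProduct.inl (tang e he x) * (extBase R h)⁻¹).left =
      1 + e • convMap (psBase R) (adConv h x) := by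
  have h1 : (extBase R h * SemidirectProduct.inl (tang e he x) * (extBase R h)⁻¹).left =
      Points.map (psBase R) h.left * Points.map (rescaleHom (algebraMap ℂ R (h.right : ℂ) ^ 2))
        (tang e he x) * (Points.map (psBase R) h.left)⁻¹ := by
    simp only [SemidirectProduct.mul_left, SemidirectProduct.mul_right,
      SemidirectProduct.inv_left, SemidirectProduct.right_inl, SemidirectProduct.left_inl, mul_one,
      MulAut.inv_def, map_inv, MulEquiv.apply_symm_apply]
    rfl
  rw [h1, ← map_inv, map_mul, map_mul, lin_map, lin_map, lin_map, lin_tang, map_add, map_one,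
    convMap_rescale_smul, mul_add, add_mul, mul_one, ← map_mul, ← map_mul, mul_inv_cancel, map_one,
    map_one, mul_smul_comm, smul_mul_assoc, adConv, map_mul, map_mul, convMap_psBase_rescale,
    map_pow]

lemma leibniz_of_point {y : Conv A ℂ} {p : Arc A (DualNumber ℂ)}
    (hp : lin p = 1 + (DualNumber.eps : DualNumber ℂ) • convMap (psBase _) y) (a b : A) :
    y (a * b) = counit (R := ℂ) a • y b + counit (R := ℂ) b • y a := by
  have h : ∀ a, p a = algebraMap ℂ _ (counit (R := ℂ) a) +
      (DualNumber.eps : DualNumber ℂ) • psBase _ (y a) := fun a => by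
    rw [← lin_apply, hp]; rfl
  have h2 : p (a * b) = p a * p b := map_mul p.ofConv a b
  have inj : ∀ f g : PowerSeries ℂ, (DualNumber.eps : DualNumber ℂ) • psBase (DualNumber ℂ) f =
      (DualNumber.eps : DualNumber ℂ) • psBase (DualNumber ℂ) g → f = g := by
    intro f g hfg
    ext n
    have := congrArg (fun f => TrivSqZeroExt.snd (PowerSeries.coeff n f)) hfg
    simpa [PowerSeries.coeff_smul, coeff_psBase, TrivSqZeroExt.algebraMap_eq_inl] using this
  apply inj
  have h3 : (DualNumber.eps : DualNumber ℂ) • psBase (DualNumber ℂ) (y (a * b)) =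
      p a * p b - algebraMap ℂ _ (counit (R := ℂ) (a * b)) := by
    rw [← h2, h, add_sub_cancel_left]
  rw [h3, h, h, map_add, map_smul, map_smul]
  simp only [Bialgebra.counit_mul, map_mul, mul_add, add_mul, Algebra.smul_mul_assoc,
    Algebra.mul_smul_comm, smul_smul, DualNumber.eps_mul_eps, zero_smul, add_zero, smul_add,
    Algebra.smul_def (R := ℂ)]
  rw [mul_comm (psBase (DualNumber ℂ) (y a)) (algebraMap ℂ (PowerSeries (DualNumber ℂ)) _)]
  abel

lemma convVanish_adConv {m : ℕ} (h : ExtArc A ℂ) {x : Conv A ℂ} (hx : ConvVanish m x) :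
    ConvVanish m (adConv h x) := by
  refine ConvVanish.mul (Or.inl (ConvVanish.mul (Or.inr fun a k hk => ?_)))
  rw [convMap_apply]
  simp [rescaleHom, hx a k hk]

lemma convVanish_zero {x : Conv A ℂ} : ConvVanish 0 x ↔ ∀ a, PowerSeries.coeff 0 (x a) = 0 := by
  simp [ConvVanish]

lemma adConv_mem (h : ExtArc A ℂ) (x : zgO A) : adConv h (x : Conv A ℂ) ∈ zgO A := by
  refine ⟨leibniz_of_point (conj_tang DualNumber.eps DualNumber.eps_mul_eps x h), ?_⟩
  exact convVanish_zero.1 (convVanish_adConv h (convVanish_zero.2 x.2.2))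

lemma adConv_mul (h : ExtArc A ℂ) (x y : Conv A ℂ) :
    adConv h (x * y) = adConv h x * adConv h y := by
  have : lin h.left⁻¹ * lin h.left = (1 : Conv A ℂ) := by
    rw [← map_mul, inv_mul_cancel, map_one]
  simp only [adConv, map_mul]
  calc _ = lin h.left * convMap (rescaleHom ((h.right : ℂ) ^ 2)) x * 1 *
        convMap (rescaleHom ((h.right : ℂ) ^ 2)) y * lin h.left⁻¹ := by
        rw [mul_one]; simp only [mul_assoc]
    _ = _ := by rw [← this]; simp only [mul_assoc]

/-- The adjoint representation of `G̃_𝒪(ℂ)` on `z𝔤(𝒪)`. -/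
def Ad (A : Type) [CommRing A] [HopfAlgebra ℂ A] : Representation ℂ (ExtArc A ℂ) (zgO A) where
  toFun h :=
    { toFun := fun x => ⟨adConv h x, adConv_mem h x⟩
      map_add' := fun x y => Subtype.ext (by
        change adConv h ((x : Conv A ℂ) + y) = adConv h x + adConv h y
        simp only [adConv, map_add, mul_add, add_mul])
      map_smul' := fun c x => Subtype.ext (by
        change adConv h (c • (x : Conv A ℂ)) = c • adConv h x
        simp only [adConv, map_smul, mul_smul_comm, smul_mul_assoc]) }
  map_one' := by
    ext x : 1
    apply Subtype.ext
    change adConv 1 (x : Conv A ℂ) = x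
    have : convMap (rescaleHom (((1 : ℂˣ) : ℂ) ^ 2)) (x : Conv A ℂ) = x := by
      apply WithConv.ext; ext a n
      simp [convMap, rescaleHom]
    simp only [adConv, SemidirectProduct.one_left, SemidirectProduct.one_right, inv_one, map_one,
      mul_one, one_mul]
    exact this
  map_mul' g h := by
    ext x : 1
    apply Subtype.ext
    change adConv (g * h) (x : Conv A ℂ) = adConv g (adConv h x)
    have h1 : convMap (rescaleHom (((g.right * h.right : ℂˣ) : ℂ) ^ 2)) (x : Conv A ℂ) =
        convMap (rescaleHom ((g.right : ℂ) ^ 2)) (convMap (rescaleHom ((h.right : ℂ) ^ 2)) x) := by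
      apply WithConv.ext; ext a n
      simp [convMap, rescaleHom, mul_pow, mul_assoc]
    have h2 : ∀ k : Arc A ℂ, lin (loopRot A ℂ g.right k) =
      convMap (rescaleHom ((g.right : ℂ) ^ 2)) (lin k) := fun k => rfl
    simp only [adConv, SemidirectProduct.mul_left, SemidirectProduct.mul_right, h1, mul_inv_rev,
      map_mul, ← map_inv, h2, mul_assoc]

lemma Ad_lie (h : ExtArc A ℂ) (x y : zgO A) : Ad A h ⁅x, y⁆ = ⁅Ad A h x, Ad A h y⁆ := by
  apply Subtype.ext
  change adConv h ((x : Conv A ℂ) * y - (y : Conv A ℂ) * x) =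
    adConv h x * adConv h y - adConv h y * adConv h x
  rw [← adConv_mul, ← adConv_mul]
  simp only [adConv, map_sub, mul_sub, sub_mul]

lemma conj_tang' {R : Type} [CommRing R] [Algebra ℂ R] (e : R) (he : e * e = 0) (x : zgO A)
    (h : ExtArc A ℂ) :
    extBase R h * SemidirectProduct.inl (tang e he x) =
      SemidirectProduct.inl (tang e he (Ad A h x)) * extBase R h := by
  rw [← mul_inv_eq_iff_eq_mul]
  ext : 1
  · apply lin_injective
    rw [conj_tang]
    rfl
  · simp

end LieAlgebra

section Representations

/-- An algebraic representation of `G̃_𝒪`: a complex vector space `V`, of any dimension, with an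
action of the group functor `G̃_𝒪` on the functor `R ↦ R ⊗ V`, that is, an `R`-linear action of
`G̃_𝒪(R)` on `R ⊗ V` for every commutative `ℂ`-algebra `R`, natural in `R`. -/
structure ExtArcRep (A : Type) [CommRing A] [HopfAlgebra ℂ A] : Type (v + 1) where
  /-- The underlying vector space. -/
  V : Type v
  [addCommGroup : AddCommGroup V]
  [module : Module ℂ V]
  act (R : Type) [CommRing R] [Algebra ℂ R] : ExtArc A R →* Module.End R (R ⊗[ℂ] V)
  act_map {R S : Type} [CommRing R] [Algebra ℂ R] [CommRing S] [Algebra ℂ S] (f : R →ₐ[ℂ] S)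
    (h : ExtArc A R) (w : R ⊗[ℂ] V) :
    f.toLinearMap.rTensor V (act R h w) =
      act S (ExtArc.map f h) (f.toLinearMap.rTensor V w)

attribute [instance] ExtArcRep.addCommGroup ExtArcRep.module

variable {A : Type} [CommRing A] [HopfAlgebra ℂ A]

namespace ExtArcRep

variable (X : ExtArcRep.{v} A)

/-- The representation of the group of complex points `G̃_𝒪(ℂ)`. -/
def pointRep : Representation ℂ (ExtArc A ℂ) X.V where
  toFun h := (TensorProduct.lid ℂ X.V).toLinearMap ∘ₗ X.act ℂ h ∘ₗ
    (TensorProduct.lid ℂ X.V).symm.toLinearMap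
  map_one' := by ext v; simp
  map_mul' g h := by ext v; simp

lemma act_extBase (R : Type) [CommRing R] [Algebra ℂ R] (h : ExtArc A ℂ) (v : X.V) :
    X.act R (extBase R h) (1 ⊗ₜ v) = 1 ⊗ₜ X.pointRep h v := by
  have h1 := X.act_map (Algebra.ofId ℂ R) h (1 ⊗ₜ v)
  have h2 : X.act ℂ h (1 ⊗ₜ v) = 1 ⊗ₜ X.pointRep h v := by
    apply (TensorProduct.lid ℂ X.V).injective
    simp [pointRep]
  rw [h2] at h1
  simpa using h1.symm

/-- The `ε`-component of an element of `ℂ[ε] ⊗ V`. -/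
def epsPart (V : Type v) [AddCommGroup V] [Module ℂ V] : (DualNumber ℂ) ⊗[ℂ] V →ₗ[ℂ] V :=
  (TensorProduct.lid ℂ V).toLinearMap ∘ₗ (TrivSqZeroExt.sndHom ℂ ℂ).rTensor V

/-- The differentiated action of `z𝔤(𝒪)` on `V`: `x · v` is the `ε`-component of `(1 + ε x) v`. -/
def lieAct (x : zgO A) (v : X.V) : X.V :=
  epsPart X.V (X.act (DualNumber ℂ)
    (SemidirectProduct.inl (tang DualNumber.eps DualNumber.eps_mul_eps x)) (1 ⊗ₜ v))

lemma dual_decomp (V : Type v) [AddCommGroup V] [Module ℂ V] (w : (DualNumber ℂ) ⊗[ℂ] V) :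
    w = 1 ⊗ₜ (TensorProduct.lid ℂ V ((TrivSqZeroExt.fstHom ℂ ℂ ℂ).toLinearMap.rTensor V w)) +
      DualNumber.eps ⊗ₜ epsPart V w := by
  induction w with
  | zero => simp
  | add a b ha hb =>
    simp only [map_add, TensorProduct.tmul_add]
    rw [add_add_add_comm, ← ha, ← hb]
  | tmul r v =>
    simp only [epsPart, LinearMap.rTensor_tmul, TensorProduct.lid_tmul, LinearMap.comp_apply,
      LinearEquiv.coe_coe, TensorProduct.tmul_smul, TensorProduct.smul_tmul', ← TensorProduct.add_tmul]
    congr 1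
    ext <;> simp

lemma extMap_inl {R S : Type} [CommRing R] [Algebra ℂ R] [CommRing S] [Algebra ℂ S]
    (f : R →ₐ[ℂ] S) (g : Arc A R) : ExtArc.map f (SemidirectProduct.inl g) =
      SemidirectProduct.inl (Points.map (PowerSeries.mapAlgHom f) g) := by
  ext : 1 <;> simp [ExtArc.map]

lemma act_tang {R : Type} [CommRing R] [Algebra ℂ R] (e : R) (he : e * e = 0) (x : zgO A)
    (v : X.V) : X.act R (SemidirectProduct.inl (tang e he x)) (1 ⊗ₜ v) =
      1 ⊗ₜ v + e ⊗ₜ X.lieAct x v := by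
  have h1 : X.act (DualNumber ℂ) (SemidirectProduct.inl
      (tang DualNumber.eps DualNumber.eps_mul_eps x)) (1 ⊗ₜ v) =
      1 ⊗ₜ v + DualNumber.eps ⊗ₜ X.lieAct x v := by
    rw [dual_decomp X.V (X.act _ _ _), X.act_map, extMap_inl, map_tang]
    have h0 : (TrivSqZeroExt.fstHom ℂ ℂ ℂ) (DualNumber.eps : DualNumber ℂ) = 0 := by simp
    simp only [h0, tang_zero, map_one]
    simp [lieAct]
  let f : DualNumber ℂ →ₐ[ℂ] R := DualNumber.lift
    ⟨(Algebra.ofId ℂ R, e), he, fun a => Commute.all _ _⟩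
  have hf : f DualNumber.eps = e := by simp [f]
  have h2 := X.act_map f (SemidirectProduct.inl
      (tang DualNumber.eps DualNumber.eps_mul_eps x)) (1 ⊗ₜ v)
  rw [extMap_inl, map_tang, h1] at h2
  simp only [map_add, LinearMap.rTensor_tmul, AlgHom.toLinearMap_apply, map_one, hf] at h2
  exact h2.symm

lemma act_tang_tmul {R : Type} [CommRing R] [Algebra ℂ R] (e : R) (he : e * e = 0) (x : zgO A)
    (r : R) (v : X.V) : X.act R (SemidirectProduct.inl (tang e he x)) (r ⊗ₜ v) =
      r ⊗ₜ v + (r * e) ⊗ₜ X.lieAct x v := by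
  have : (r ⊗ₜ v : R ⊗[ℂ] X.V) = r • (1 ⊗ₜ v) := by simp [TensorProduct.smul_tmul']
  rw [this, map_smul, act_tang, smul_add]
  simp [TensorProduct.smul_tmul']

lemma epsPart_one (V : Type v) [AddCommGroup V] [Module ℂ V] (v : V) :
    epsPart V (1 ⊗ₜ v) = 0 := by simp [epsPart]

lemma epsPart_eps (V : Type v) [AddCommGroup V] [Module ℂ V] (v : V) :
    epsPart V (DualNumber.eps ⊗ₜ v) = v := by simp [epsPart]

lemma lieAct_add_left (x y : zgO A) (v : X.V) :
    X.lieAct (x + y) v = X.lieAct x v + X.lieAct y v := by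
  have h := X.act_tang (R := DualNumber ℂ) DualNumber.eps DualNumber.eps_mul_eps (x + y) v
  rw [← tang_mul_tang, map_mul, map_mul, Module.End.mul_apply, act_tang, map_add, act_tang,
    act_tang_tmul, DualNumber.eps_mul_eps, TensorProduct.zero_tmul, add_zero] at h
  have h' := congrArg (epsPart X.V) h
  simp only [map_add, epsPart_one, epsPart_eps, zero_add] at h'
  exact h'.symm

lemma lieAct_smul_left (c : ℂ) (x : zgO A) (v : X.V) :
    X.lieAct (c • x) v = c • X.lieAct x v := by
  have h := X.act_tang (R := DualNumber ℂ) DualNumber.eps DualNumber.eps_mul_eps (c • x) v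
  rw [tang_smul, act_tang] at h
  have h' := congrArg (epsPart X.V) h
  rw [map_add, map_add, ← TensorProduct.smul_tmul', map_smul] at h'
  simpa only [epsPart_one, epsPart_eps, zero_add] using h'.symm

lemma lieAct_lie (x y : zgO A) (v : X.V) :
    X.lieAct ⁅x, y⁆ v = X.lieAct x (X.lieAct y v) - X.lieAct y (X.lieAct x v) := by
  let e : DualNumber (DualNumber ℂ) := TrivSqZeroExt.inl DualNumber.eps
  let e' : DualNumber (DualNumber ℂ) := DualNumber.eps
  have he : e * e = 0 := by ext <;> simp [e]
  have he' : e' * e' = 0 := DualNumber.eps_mul_eps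
  have h := congrArg (fun g => X.act _ (SemidirectProduct.inl g) (1 ⊗ₜ v))
    (tang_comm e e' he he' x y)
  simp only [map_mul, Module.End.mul_apply, act_tang_tmul, map_add, one_mul] at h
  let π : DualNumber (DualNumber ℂ) →ₗ[ℂ] ℂ :=
    (TrivSqZeroExt.sndHom ℂ ℂ) ∘ₗ (TrivSqZeroExt.sndHom (DualNumber ℂ) (DualNumber ℂ)).restrictScalars ℂ
  have h' := congrArg (fun w => TensorProduct.lid ℂ X.V (π.rTensor X.V w)) h
  simp only [map_add, LinearMap.rTensor_tmul, TensorProduct.lid_tmul] at h'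
  simp [π, e, e'] at h'
  rw [h']
  abel

instance : LieRingModule (zgO A) X.V where
  bracket := X.lieAct
  add_lie := X.lieAct_add_left
  lie_add x v w := by
    simp only [lieAct, TensorProduct.tmul_add, map_add]
  leibniz_lie x y v := by
    change X.lieAct x (X.lieAct y v) = X.lieAct ⁅x, y⁆ v + X.lieAct y (X.lieAct x v)
    rw [lieAct_lie, sub_add_cancel]

instance : LieModule ℂ (zgO A) X.V where
  smul_lie := X.lieAct_smul_left
  lie_smul c x v := by
    change X.lieAct x (c • v) = c • X.lieAct x v
    have h : (1 ⊗ₜ (c • v) : (DualNumber ℂ) ⊗[ℂ] X.V) =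
        (algebraMap ℂ (DualNumber ℂ) c) • (1 ⊗ₜ v) := by
      rw [TensorProduct.smul_tmul', TensorProduct.tmul_smul, TensorProduct.smul_tmul',
        algebraMap_smul]
    simp only [lieAct]
    rw [h, map_smul, algebraMap_smul, map_smul]

lemma lie_def (x : zgO A) (v : X.V) : ⁅x, v⁆ = X.lieAct x v := rfl

lemma pointRep_lie (h : ExtArc A ℂ) (x : zgO A) (v : X.V) :
    X.pointRep h ⁅x, v⁆ = ⁅Ad A h x, X.pointRep h v⁆ := by
  have h1 := congrArg (fun g => X.act (DualNumber ℂ) g (1 ⊗ₜ v))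
    (conj_tang' DualNumber.eps DualNumber.eps_mul_eps x h)
  simp only [map_mul, Module.End.mul_apply, act_tang, act_extBase, map_add] at h1
  have h2 : (DualNumber.eps ⊗ₜ X.lieAct x v : (DualNumber ℂ) ⊗[ℂ] X.V) =
      (DualNumber.eps : DualNumber ℂ) • (1 ⊗ₜ X.lieAct x v) := by
    simp [TensorProduct.smul_tmul']
  rw [h2, map_smul, act_extBase, TensorProduct.smul_tmul', smul_eq_mul, mul_one] at h1
  have h3 := congrArg (epsPart X.V) h1
  simp only [map_add, epsPart_one, epsPart_eps, zero_add] at h3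
  exact h3

end ExtArcRep

/-- The embedding `G(ℂ) → G̃_𝒪(ℂ)` as constant arcs. -/
def constArc (A : Type) [CommRing A] [HopfAlgebra ℂ A] : Points A ℂ →* ExtArc A ℂ :=
  SemidirectProduct.inl.comp (Points.map (Algebra.ofId ℂ (PowerSeries ℂ)))

lemma inr_mul_constArc (t : ℂˣ) (g : Points A ℂ) :
    (SemidirectProduct.inr t : ExtArc A ℂ) * constArc A g =
      constArc A g * SemidirectProduct.inr t := by
  have : loopRot A ℂ t (Points.map (Algebra.ofId ℂ (PowerSeries ℂ)) g) =
      Points.map (Algebra.ofId ℂ (PowerSeries ℂ)) g := by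
    apply WithConv.ext; ext a : 1
    exact (rescaleHom ((t : ℂ) ^ 2)).commutes (g a)
  ext : 1 <;> simp [constArc, this]

variable (X : ExtArcRep.{v} A)

open AlternatingMap in
/-- The action of `G̃_𝒪(ℂ)` on cochains: `(h ω)(x₁, …) = h (ω (Ad h⁻¹ x₁, …))`. -/
def cochainRep (n : ℕ) : Representation ℂ (ExtArc A ℂ) (zgO A [⋀^Fin n]→ₗ[ℂ] X.V) where
  toFun h :=
    { toFun := fun ω => (X.pointRep h).compAlternatingMap (ω.compLinearMap (Ad A h⁻¹))
      map_add' := fun ω η => by ext v; simp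
      map_smul' := fun c ω => by ext v; simp }
  map_one' := by
    ext ω v
    simp
  map_mul' g h := by
    ext ω v
    simp

lemma cochainRep_apply (n : ℕ) (h : ExtArc A ℂ) (ω : zgO A [⋀^Fin n]→ₗ[ℂ] X.V)
    (v : Fin n → zgO A) :
    cochainRep X n h ω v = X.pointRep h (ω (fun i => Ad A h⁻¹ (v i))) := rfl

lemma ceD_cochainRep (n : ℕ) (h : ExtArc A ℂ) (ω : zgO A [⋀^Fin n]→ₗ[ℂ] X.V) :
    ceD (zgO A) X.V n (cochainRep X n h ω) = cochainRep X (n + 1) h (ceD (zgO A) X.V n ω) := by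
  refine ceD_equivariant (Ad A h⁻¹) (X.pointRep h) (Ad_lie _) (fun x m => ?_) ω
  rw [X.pointRep_lie, ← Module.End.mul_apply, ← map_mul, mul_inv_cancel, map_one]
  rfl

/-- `ω` is inflated from an alternating form on `z𝔤(𝒪)/z^{m+1}𝔤(𝒪)` with values in the vectors
killed by `z^{m+1}𝔤(𝒪)`.  The union over `m` of these cochains is the direct limit of the cochain
spaces of the finite-dimensional quotients `z𝔤(𝒪)/z^{m+1}𝔤(𝒪)`; as each vector of an algebraic
representation is killed by `z^{m+1}𝔤(𝒪)` for some `m`, it is `V ⊗ Λⁿ((z𝔤(𝒪))^*)`, where `^*` is the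
continuous dual, the union of the dual spaces of these quotients. -/
def IsLevel {n : ℕ} (m : ℕ) (ω : zgO A [⋀^Fin n]→ₗ[ℂ] X.V) : Prop :=
  (∀ v, (∃ i, ConvVanish m (v i : Conv A ℂ)) → ω v = 0) ∧
    ∀ y : zgO A, ConvVanish m (y : Conv A ℂ) → ∀ v, ⁅y, ω v⁆ = 0

lemma ConvVanish.mono {m m' : ℕ} (h : m ≤ m') {x : Conv A ℂ} (hx : ConvVanish m' x) :
    ConvVanish m x := fun a k hk => hx a k (hk.trans h)

lemma ConvVanish.lie {m : ℕ} {x y : zgO A}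
    (h : ConvVanish m (x : Conv A ℂ) ∨ ConvVanish m (y : Conv A ℂ)) :
    ConvVanish m ((⁅x, y⁆ : zgO A) : Conv A ℂ) := by
  intro a k hk
  change PowerSeries.coeff k (((x : Conv A ℂ) * y) a - ((y : Conv A ℂ) * x) a) = 0
  rw [map_sub, ConvVanish.mul h a k hk, ConvVanish.mul h.symm a k hk, sub_zero]

variable {X}

lemma IsLevel.mono {n m m' : ℕ} (h : m ≤ m') {ω : zgO A [⋀^Fin n]→ₗ[ℂ] X.V}
    (hω : IsLevel X m ω) : IsLevel X m' ω :=
  ⟨fun v ⟨i, hi⟩ => hω.1 v ⟨i, hi.mono h⟩, fun y hy v => hω.2 y (hy.mono h) v⟩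

lemma IsLevel.add {n m : ℕ} {ω η : zgO A [⋀^Fin n]→ₗ[ℂ] X.V}
    (hω : IsLevel X m ω) (hη : IsLevel X m η) : IsLevel X m (ω + η) :=
  ⟨fun v hv => by rw [AlternatingMap.add_apply, hω.1 v hv, hη.1 v hv, add_zero],
    fun y hy v => by rw [AlternatingMap.add_apply, lie_add, hω.2 y hy, hη.2 y hy, add_zero]⟩

lemma IsLevel.smul {n m : ℕ} (c : ℂ) {ω : zgO A [⋀^Fin n]→ₗ[ℂ] X.V}
    (hω : IsLevel X m ω) : IsLevel X m (c • ω) :=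
  ⟨fun v hv => by rw [AlternatingMap.smul_apply, hω.1 v hv, smul_zero],
    fun y hy v => by rw [AlternatingMap.smul_apply, lie_smul, hω.2 y hy, smul_zero]⟩

lemma IsLevel.cochainRep {n m : ℕ} (h : ExtArc A ℂ) {ω : zgO A [⋀^Fin n]→ₗ[ℂ] X.V}
    (hω : IsLevel X m ω) : IsLevel X m (cochainRep X n h ω) := by
  refine ⟨fun v ⟨i, hi⟩ => ?_, fun y hy v => ?_⟩
  · rw [cochainRep_apply, hω.1 _ ⟨i, convVanish_adConv h⁻¹ hi⟩, map_zero]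
  · have hy' : y = Ad A h (Ad A h⁻¹ y) := by
      rw [← Module.End.mul_apply, ← map_mul, mul_inv_cancel, map_one]; rfl
    rw [cochainRep_apply, hy', ← X.pointRep_lie, hω.2 _ (convVanish_adConv h⁻¹ hy), map_zero]

lemma IsLevel.ceD {n m : ℕ} {ω : zgO A [⋀^Fin n]→ₗ[ℂ] X.V} (hω : IsLevel X m ω) :
    IsLevel X m (ceD (zgO A) X.V n ω) := by
  refine ⟨fun v ⟨j, hj⟩ => ?_, fun y hy v => ?_⟩
  · rw [ceD_apply]
    refine Finset.sum_eq_zero fun i _ => ?_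
    by_cases hij : i = j
    · subst hij
      rw [hω.2 _ hj, Finset.sum_eq_zero, sub_zero, smul_zero]
      intro k _
      refine hω.1 _ ⟨k, ?_⟩
      rw [Function.update_self]
      exact ConvVanish.lie (Or.inl hj)
    · obtain ⟨l, rfl⟩ := Fin.exists_succAbove_eq (Ne.symm hij)
      rw [hω.1 (i.removeNth v) ⟨l, hj⟩, lie_zero, Finset.sum_eq_zero, sub_zero, smul_zero]
      intro k _
      refine hω.1 _ ⟨l, ?_⟩
      by_cases hk : l = k
      · subst hk
        rw [Function.update_self]
        exact ConvVanish.lie (Or.inr hj)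
      · rw [Function.update_of_ne hk]
        exact hj
  · rw [ceD_apply, lie_sum]
    refine Finset.sum_eq_zero fun i _ => ?_
    have h1 : ⁅y, ⁅v i, ω (i.removeNth v)⁆⁆ = 0 := by
      rw [leibniz_lie, hω.2 _ hy, lie_zero, add_zero]
      exact hω.2 _ (ConvVanish.lie (Or.inl hy)) _
    rw [lie_zsmul, lie_sub, h1, lie_sum, Finset.sum_eq_zero, sub_zero, smul_zero]
    exact fun k _ => hω.2 _ hy _

variable (X)

/-- The term of degree `n` of `[V ⊗ Sym^•((z𝔤(𝒪))^*[-1])]^G`: the `G`-invariant continuous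
alternating `n`-forms on `z𝔤(𝒪)` with values in `V` (the symmetric algebra on a space placed in
degree one is its exterior algebra). -/
def ceInv (n : ℕ) : Submodule ℂ (zgO A [⋀^Fin n]→ₗ[ℂ] X.V) where
  carrier := {ω | (∃ m, IsLevel X m ω) ∧ ∀ g : Points A ℂ, cochainRep X n (constArc A g) ω = ω}
  zero_mem' := ⟨⟨0, by simp [IsLevel]⟩, fun g => map_zero _⟩
  add_mem' := by
    rintro ω η ⟨⟨m, hm⟩, h1⟩ ⟨⟨m', hm'⟩, h2⟩
    exact ⟨⟨max m m', (hm.mono (le_max_left _ _)).add (hm'.mono (le_max_right _ _))⟩,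
      fun g => by rw [map_add, h1, h2]⟩
  smul_mem' := by
    rintro c ω ⟨⟨m, hm⟩, h1⟩
    exact ⟨⟨m, hm.smul c⟩, fun g => by rw [map_smul, h1]⟩

lemma ceInv_rot (n : ℕ) (t : ℂˣ) {ω : zgO A [⋀^Fin n]→ₗ[ℂ] X.V} (hω : ω ∈ ceInv X n) :
    cochainRep X n (SemidirectProduct.inr t) ω ∈ ceInv X n := by
  obtain ⟨⟨m, hm⟩, h⟩ := hω
  refine ⟨⟨m, hm.cochainRep _⟩, fun g => ?_⟩
  rw [← Module.End.mul_apply, ← map_mul, ← inr_mul_constArc, map_mul, Module.End.mul_apply, h]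

lemma ceInv_ceD (n : ℕ) {ω : zgO A [⋀^Fin n]→ₗ[ℂ] X.V} (hω : ω ∈ ceInv X n) :
    ceD (zgO A) X.V n ω ∈ ceInv X (n + 1) := by
  obtain ⟨⟨m, hm⟩, h⟩ := hω
  exact ⟨⟨m, hm.ceD⟩, fun g => by rw [← ceD_cochainRep, h]⟩

/-- The action of the rotation factor `ℂ^*` on the invariant cochains. -/
def ceInvRep (n : ℕ) : Representation ℂ ℂˣ (ceInv X n) where
  toFun t := (cochainRep X n (SemidirectProduct.inr t)).restrict fun _ hω => ceInv_rot X n t hω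
  map_one' := by
    ext ω : 2
    simp
  map_mul' s t := by
    ext ω : 2
    simp

/-- The complex `[V ⊗ Sym^•((z𝔤(𝒪))^*[-1])]^G` of representations of `ℂ^*`, with the
Chevalley-Eilenberg differential. -/
def ceComplex : CochainComplex (Rep.{v} ℂ ℂˣ) ℕ :=
  CochainComplex.of (fun n => Rep.of (ceInvRep X n))
    (fun n => Rep.ofHom
      { toLinearMap := (ceD (zgO A) X.V n).restrict fun _ hω => ceInv_ceD X n hω
        isIntertwining' := fun t => by
          ext ω : 2
          exact ceD_cochainRep X n _ _ })
    (fun n => by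
      ext ω : 3
      exact Subtype.ext (ceD_ceD _))

/-! ### Derived invariants -/

/-- Morphisms of algebraic representations: linear maps which commute with the action of
`G̃_𝒪(R)` for all `R`. -/
structure ExtArcRep.Hom (X Y : ExtArcRep.{v} A) where
  lin : X.V →ₗ[ℂ] Y.V
  comm (R : Type) [CommRing R] [Algebra ℂ R] (h : ExtArc A R) (w : R ⊗[ℂ] X.V) :
    lin.lTensor R (X.act R h w) = Y.act R h (lin.lTensor R w)

/-- Injective objects of the category of algebraic representations of `G̃_𝒪`. -/
def ExtArcRep.IsInjective (J : ExtArcRep.{v} A) : Prop :=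
  ∀ (Y Z : ExtArcRep.{v} A) (i : ExtArcRep.Hom Y Z) (_ : Function.Injective i.lin)
    (f : ExtArcRep.Hom Y J), ∃ g : ExtArcRep.Hom Z J, g.lin ∘ₗ i.lin = f.lin

/-- Injective resolutions `0 → V → I⁰ → I¹ → ⋯` in the category of algebraic representations
of `G̃_𝒪`. -/
structure ExtArcRep.InjRes (X : ExtArcRep.{v} A) where
  I : ℕ → ExtArcRep.{v} A
  injective (n : ℕ) : (I n).IsInjective
  ι : ExtArcRep.Hom X (I 0)
  d (n : ℕ) : ExtArcRep.Hom (I n) (I (n + 1))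
  ι_injective : Function.Injective ι.lin
  exact_zero : Function.Exact ι.lin (d 0).lin
  exact_succ (n : ℕ) : Function.Exact (d n).lin (d (n + 1)).lin

/-- The invariants `V^{G(𝒪)}` under the group scheme `G(𝒪)`: the vectors fixed by `G(R[[z]])` for
all `R`. -/
def ExtArcRep.inv : Submodule ℂ X.V where
  carrier := {v | ∀ (R : Type) [CommRing R] [Algebra ℂ R] (g : Arc A R),
    X.act R (SemidirectProduct.inl g) (1 ⊗ₜ v) = 1 ⊗ₜ v}
  zero_mem' := by intro R _ _ g; simp
  add_mem' := by
    intro v w hv hw R _ _ g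
    rw [TensorProduct.tmul_add, map_add, hv, hw]
  smul_mem' := by
    intro c v hv R _ _ g
    have h : (1 ⊗ₜ (c • v) : R ⊗[ℂ] X.V) = (algebraMap ℂ R c) • (1 ⊗ₜ v) := by
      rw [TensorProduct.smul_tmul', TensorProduct.tmul_smul, TensorProduct.smul_tmul',
        algebraMap_smul]
    rw [h, map_smul, hv]

lemma ExtArcRep.inv_rot (t : ℂˣ) {v : X.V} (hv : v ∈ X.inv) :
    X.pointRep (SemidirectProduct.inr t) v ∈ X.inv := by
  intro R _ _ g
  have h : (SemidirectProduct.inl g : ExtArc A R) *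
        extBase R (SemidirectProduct.inr t : ExtArc A ℂ) =
      extBase R (SemidirectProduct.inr t : ExtArc A ℂ) * SemidirectProduct.inl
        ((loopRot A R (extBase R (SemidirectProduct.inr t : ExtArc A ℂ)).right)⁻¹ g) := by
    ext : 1 <;> simp [ExtArc.map, extBase]
  rw [← X.act_extBase, ← Module.End.mul_apply, ← map_mul, h, map_mul, Module.End.mul_apply, hv]

/-- The action of the quotient `ℂ^* = G̃_𝒪 / G(𝒪)` on `V^{G(𝒪)}`. -/
def ExtArcRep.invRep : Representation ℂ ℂˣ X.inv where
  toFun t := (X.pointRep (SemidirectProduct.inr t)).restrict fun _ hv => X.inv_rot t hv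
  map_one' := by
    ext v : 2
    simp
  map_mul' s t := by
    ext v : 2
    simp

variable {X} in
lemma ExtArcRep.Hom.map_inv {Y : ExtArcRep.{v} A} (f : ExtArcRep.Hom X Y) {v : X.V}
    (hv : v ∈ X.inv) : f.lin v ∈ Y.inv := by
  intro R _ _ g
  have h := f.comm R (SemidirectProduct.inl g) (1 ⊗ₜ v)
  rw [hv, LinearMap.lTensor_tmul] at h
  exact h.symm

variable {X} in
lemma ExtArcRep.Hom.map_pointRep {Y : ExtArcRep.{v} A} (f : ExtArcRep.Hom X Y) (h : ExtArc A ℂ)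
    (v : X.V) : f.lin (X.pointRep h v) = Y.pointRep h (f.lin v) := by
  have h1 := f.comm ℂ h (1 ⊗ₜ v)
  apply_fun TensorProduct.lid ℂ Y.V at h1
  have h2 : ∀ w : ℂ ⊗[ℂ] X.V, TensorProduct.lid ℂ Y.V (f.lin.lTensor ℂ w) =
      f.lin (TensorProduct.lid ℂ X.V w) := fun w => by
    induction w with
    | zero => simp
    | add a b ha hb => simp only [map_add, ha, hb]
    | tmul r v => simp
  rw [h2] at h1
  simpa [ExtArcRep.pointRep] using h1

/-- The complex `0 → (I⁰)^{G(𝒪)} → (I¹)^{G(𝒪)} → ⋯` of representations of `ℂ^*` formed from an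
injective resolution of `V` over `G̃_𝒪`: it computes the derived `G(𝒪)`-invariants of `V`. -/
def ExtArcRep.InjRes.invComplex {X : ExtArcRep.{v} A} (P : X.InjRes) :
    CochainComplex (Rep.{v} ℂ ℂˣ) ℕ :=
  CochainComplex.of (fun n => Rep.of (P.I n).invRep)
    (fun n => Rep.ofHom
      { toLinearMap := (P.d n).lin.restrict fun _ hv => (P.d n).map_inv hv
        isIntertwining' := fun t => by
          ext v : 2
          exact (P.d n).map_pointRep _ _ })
    (fun n => by
      ext v : 3
      exact Subtype.ext ((P.exact_succ n).apply_apply_eq_zero _))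

/-- `G = Spec A` is a complex reductive group, not necessarily connected: it is the
complexification of a compact Lie group, that is, its group of complex points contains a subgroup
which is compact in the classical topology (that of pointwise convergence of functions) and Zariski
dense (no nonzero regular function vanishes on it). -/
def IsReductive (A : Type) [CommRing A] [HopfAlgebra ℂ A] : Prop :=
  ∃ K : Subgroup (Points A ℂ),
    IsCompact ((fun (g : Points A ℂ) (a : A) => g a) '' (K : Set (Points A ℂ))) ∧
    ∀ a : A, (∀ g ∈ K, g a = 0) → a = 0

end Representations

end ArcRep
end

/-! Both complexes are replaced by their cohomology. Every subrepresentation of an algebraic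
representation of ℂ^* is a direct summand (`monosSplit_of_isAlg`), and all terms of both complexes
are algebraic. Hence any family of isomorphisms between the cohomologies, chosen independently in
each degree, is induced by a morphism of complexes (`exists_quasiIso_of_homology_iso`). What remains
is an isomorphism of ℂ^*-representations in each degree (`nonempty_homology_iso`).

This is dimension shifting along 0 → X → I⁰ → I⁰/X → 0, and it needs three facts about X ↦
`ceComplex X`. It preserves short exact sequences (`ceMap_shortExact`), because a lift of a form
along a linear section can be averaged over the compact Zariski dense subgroup. Its cohomology in
degree zero is the space of G(𝒪)-invariants (`mem_inv_iff`). Its cohomology in positive degrees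
vanishes for injective X (`injective_acyclic`).

By Frobenius reciprocity the cofree representations ℂ[G̃_𝒪] ⊗ W are injective and every
representation embeds in one. This gives the existence of resolutions, and it makes every injective
representation a direct summand of a cofree one, so that acyclicity has to be proved for cofree
representations only (`cofree_acyclic`).

The tool for this is loop rotation. Let g be the universal arc and `rotGen` the derivation of
ℂ[G̃_𝒪] which multiplies the coefficients of zⁿ in g by n. Put Θ = g⁻¹ z dg/dz, a function with
values in z𝔤(𝒪) (`rotField`). Moving g by rotation is the same as moving it by g·Θ, so `rotGen` is a
combination of the left invariant vector fields of z𝔤(𝒪), whose coefficients are the coordinates of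
Θ (`rotGen_eq_sum`). The coefficients are functions, and y in z𝔤(𝒪) differentiates Θ to [Θ, y] + z
dy/dz (`convDer_vf_rotField`). With this law Cartan's formula (`ceD_contract`) shows that
contraction with Θ is a homotopy between zero and the operator T which acts by `rotGen` on
coefficients and by z d/dz on the arguments of a form. The eigenvalues of `rotGen` are at least 0
and those of z d/dz on z𝔤(𝒪) are at least 1, so on n-forms the spectrum of T is bounded below by n
(`spectrum_forms`). For n > 0 every cocycle ω is therefore T η for a cocycle η, and is the
differential of the contraction of η.

The same vector field gives the invariants. A function killed by z𝔤(𝒪) is killed by `rotGen`, hence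
unchanged under z ↦ qz, also for q = 0; it depends on g(0) only. This takes the place of
exponentiating the action of z𝔤(𝒪). -/

noncomputable section
namespace ArcRep
open WithConv Coalgebra
open scoped TensorProduct

/-! ### Split objects and comparison of complexes in an abelian category. -/

section HomologicalAlgebra

open CategoryTheory CategoryTheory.Limits

universe u w

variable {C : Type u} [Category.{w} C] [Abelian C]

/-- An object of which every subobject is a direct summand. -/
def MonosSplit (M : C) : Prop :=
  ∀ ⦃N : C⦄ (f : N ⟶ M), Mono f → IsSplitMono f

lemma MonosSplit.of_mono {M N : C} (hM : MonosSplit M) (f : N ⟶ M) [Mono f] : MonosSplit N := by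
  intro L g hg
  have := hM (g ≫ f) inferInstance
  exact ⟨⟨⟨f ≫ retraction (g ≫ f), by rw [← Category.assoc, IsSplitMono.id]⟩⟩⟩

/-- A retraction r of the kernel inclusion κ gives the endomorphism 1 - rκ (r first), which kills
the kernel; it descends along `f` to a section. -/
lemma MonosSplit.isSplitEpi {M N : C} (hM : MonosSplit M) (f : M ⟶ N) [Epi f] :
    IsSplitEpi f := by
  have := hM (kernel.ι f) inferInstance
  let r := retraction (kernel.ι f)
  have hr : kernel.ι f ≫ r = 𝟙 _ := IsSplitMono.id _
  let c : Cofork (kernel.ι f) 0 := CokernelCofork.ofπ f (kernel.condition f)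
  have hc : IsColimit c := Abelian.epiIsCokernelOfKernel _ (limit.isLimit _)
  have h0 : kernel.ι f ≫ (𝟙 M - r ≫ kernel.ι f) = 0 := by
    rw [Preadditive.comp_sub, ← Category.assoc, hr]; simp
  refine ⟨⟨⟨hc.desc (CokernelCofork.ofπ _ h0), ?_⟩⟩⟩
  rw [← cancel_epi f, ← Category.assoc]
  have h1 : f ≫ hc.desc (CokernelCofork.ofπ _ h0) = 𝟙 M - r ≫ kernel.ι f :=
    hc.fac (CokernelCofork.ofπ _ h0) WalkingParallelPair.one
  rw [h1, Preadditive.sub_comp, Category.assoc, kernel.condition]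
  simp

lemma MonosSplit.of_epi {M N : C} (hM : MonosSplit M) (f : M ⟶ N) [Epi f] : MonosSplit N := by
  have := hM.isSplitEpi f
  exact hM.of_mono (section_ f)

/-- Complexes with completely reducible terms and isomorphic cohomology are quasi-isomorphic. -/
lemma exists_quasiIso_of_homology_iso (K L : CochainComplex C ℕ) (hK : ∀ n, MonosSplit (K.X n))
    (hL : ∀ n, MonosSplit (L.X n)) (e : ∀ n, Nonempty (K.homology n ≅ L.homology n)) :
    ∃ φ : K ⟶ L, QuasiIso φ := by
  have hr : ∀ n, IsSplitMono (K.homologyι n) := fun n =>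
    (hK n).of_epi (K.pOpcycles n) _ inferInstance
  have hs : ∀ n, IsSplitEpi (L.homologyπ n) := fun n =>
    ((hL n).of_mono (L.iCycles n)).isSplitEpi _
  -- The map factors through cohomology, Kⁿ → Hⁿ(K) ≅ Hⁿ(L) → Lⁿ, by a retraction onto Hⁿ(K) inside
  -- the opcycles and a section into the cycles of L. Its composites with both differentials vanish,
  -- so no compatibility between degrees is needed.
  let φ : K ⟶ L :=
    { f := fun n => K.pOpcycles n ≫ retraction (K.homologyι n) ≫ (e n).some.hom ≫
        section_ (L.homologyπ n) ≫ L.iCycles n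
      comm' := fun i j _ => by simp }
  refine ⟨φ, (quasiIso_iff _).2 fun n => (quasiIsoAt_iff_isIso_homologyMap _ _).2 ?_⟩
  suffices h : HomologicalComplex.homologyMap φ n = (e n).some.hom by
    rw [h]; infer_instance
  rw [← cancel_epi (K.homologyπ n), ← cancel_mono (L.homologyι n)]
  have h1 : K.homologyπ n ≫ HomologicalComplex.homologyMap φ n ≫ L.homologyι n =
      K.iCycles n ≫ φ.f n ≫ L.pOpcycles n := by
    rw [HomologicalComplex.homologyπ_naturality_assoc, HomologicalComplex.homology_π_ι,
      HomologicalComplex.cyclesMap_i_assoc]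
  rw [Category.assoc, h1]
  simp only [φ, Category.assoc]
  rw [← HomologicalComplex.homology_π_ι_assoc, ← HomologicalComplex.homology_π_ι]
  rw [IsSplitMono.id_assoc, IsSplitEpi.id_assoc]

/-- The first cohomology of `X₁` in a short exact sequence `0 → X₁ → X₂ → X₃ → 0` is determined by
the map on invariants if `X₂` is acyclic in degree one. -/
lemma homology_one_iso {S : ShortComplex (CochainComplex C ℕ)} (hS : S.ShortExact)
    (h2 : IsZero (S.X₂.homology 1)) {D : CochainComplex C ℕ}
    (e₀ : D.X 0 ≅ S.X₂.homology 0) (e₁ : D.cycles 1 ≅ S.X₃.homology 0)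
    (comm : D.toCycles 0 1 ≫ e₁.hom = e₀.hom ≫ HomologicalComplex.homologyMap S.g 0) :
    Nonempty (S.X₁.homology 1 ≅ D.homology 1) := by
  have hrel : (ComplexShape.up ℕ).Rel 0 1 := rfl
  have hepi := hS.epi_δ 0 1 hrel h2
  have hex := hS.homology_exact₃ 0 1 hrel
  have : Epi (ShortComplex.mk _ _ (hS.comp_δ 0 1 hrel)).g := hepi
  -- Both sides are cokernels: H¹(X₁) of H⁰(X₂) → H⁰(X₃), as the connecting map is onto, and H¹(D)
  -- of D⁰ → Z¹(D). The square `comm` identifies the two maps.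
  have i1 := (colimit.isColimit _).coconePointUniqueUpToIso hex.gIsCokernel
  have i2 := (colimit.isColimit _).coconePointUniqueUpToIso (D.homologyIsCokernel 0 1 (by simp))
  exact ⟨i1.symm ≪≫ (cokernel.mapIso _ _ e₀ e₁ comm).symm ≪≫ i2⟩

end HomologicalAlgebra

/-! ### Exactness in the category of representations. -/

section RepAlgebra

open CategoryTheory CategoryTheory.Limits

variable {Γ : Type} [Group Γ]

lemma rep_exact_iff (S : ShortComplex (Rep.{v} ℂ Γ)) :
    S.Exact ↔ Function.Exact S.f.hom S.g.hom := by
  rw [← ShortComplex.exact_map_iff_of_faithful S (forget₂ (Rep.{v} ℂ Γ) (ModuleCat ℂ)),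
    ShortComplex.ShortExact.moduleCat_exact_iff_function_exact]
  rfl

lemma rep_shortExact {S : ShortComplex (Rep.{v} ℂ Γ)} (h1 : Function.Injective S.f.hom)
    (h2 : Function.Exact S.f.hom S.g.hom) (h3 : Function.Surjective S.g.hom) : S.ShortExact where
  exact := (rep_exact_iff S).2 h2
  mono_f := (Rep.mono_iff_injective _).2 h1
  epi_g := (Rep.epi_iff_surjective _).2 h3

end RepAlgebra

/-! ### Regular vector-valued functions on a set of points. -/

section RegularFunctions

/-- Linear functionals on the second factor separate the points of a tensor product. -/
lemma tensor_eq_zero_of_dual {N M : Type*} [AddCommGroup N] [Module ℂ N] [AddCommGroup M]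
    [Module ℂ M] (T : N ⊗[ℂ] M)
    (h : ∀ l : M →ₗ[ℂ] ℂ, TensorProduct.rid ℂ N (l.lTensor N T) = 0) : T = 0 := by
  classical
  let b := Module.Basis.ofVectorSpace ℂ M
  apply (TensorProduct.equivFinsuppOfBasisRight (M := N) b).injective
  ext i
  rw [map_zero, Finsupp.zero_apply, ← h (b.coord i)]
  clear h
  induction T with
  | zero => simp
  | add x y hx hy => simp only [map_add, Finsupp.add_apply, hx, hy]
  | tmul x y => simp

variable {Γ B : Type*} [CommRing B] [Algebra ℂ B] (ev : Γ → (B →ₐ[ℂ] ℂ))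
  {M N : Type*} [AddCommGroup M] [Module ℂ M] [AddCommGroup N] [Module ℂ N]

/-- The `M`-valued function on `Γ` defined by an element of `B ⊗ M`. -/
def evT (g : Γ) : B ⊗[ℂ] M →ₗ[ℂ] M :=
  (TensorProduct.lid ℂ M).toLinearMap ∘ₗ (ev g).toLinearMap.rTensor M

@[simp] lemma evT_tmul (g : Γ) (b : B) (m : M) : evT ev g (b ⊗ₜ m) = ev g b • m := by
  simp [evT]

lemma evT_lTensor (g : Γ) (f : M →ₗ[ℂ] N) (T : B ⊗[ℂ] M) :
    evT ev g (f.lTensor B T) = f (evT ev g T) := by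
  induction T with
  | zero => simp
  | add x y hx hy => simp only [map_add, hx, hy]
  | tmul x y => simp

lemma evT_smul (g : Γ) (b : B) (T : B ⊗[ℂ] M) : evT ev g (b • T) = ev g b • evT ev g T := by
  induction T with
  | zero => simp
  | add x y hx hy => simp only [map_add, smul_add, hx, hy]
  | tmul x y => simp [TensorProduct.smul_tmul', mul_smul]

/-- No nonzero element of `B` vanishes on `S`. -/
def IsDense (S : Set Γ) : Prop := ∀ b : B, (∀ g ∈ S, ev g b = 0) → b = 0

variable {ev}

lemma IsDense.evT_eq_zero {S : Set Γ} (hS : IsDense ev S) {T : B ⊗[ℂ] M}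
    (h : ∀ g ∈ S, evT ev g T = 0) : T = 0 := by
  refine tensor_eq_zero_of_dual T fun l => hS _ fun g hg => ?_
  have h1 : ∀ T : B ⊗[ℂ] M, ev g (TensorProduct.rid ℂ B (l.lTensor B T)) = l (evT ev g T) := by
    intro T
    induction T with
    | zero => simp
    | add x y hx hy => simp only [map_add, hx, hy]
    | tmul x y => simp [mul_comm]
  rw [h1, h g hg, map_zero]

lemma IsDense.evT_ext {S : Set Γ} (hS : IsDense ev S) {T T' : B ⊗[ℂ] M}
    (h : ∀ g ∈ S, evT ev g T = evT ev g T') : T = T' :=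
  sub_eq_zero.1 (hS.evT_eq_zero fun g hg => by rw [map_sub, h g hg, sub_self])

variable (ev) in
/-- Regular functions on `Γ` with values in `M`. -/
def IsReg (F : Γ → M) : Prop := ∃ T : B ⊗[ℂ] M, ∀ g, F g = evT ev g T

variable (ev) in
lemma isReg_const (m : M) : IsReg ev fun _ => m := ⟨1 ⊗ₜ m, fun g => by simp⟩

lemma IsReg.add {F G : Γ → M} (hF : IsReg ev F) (hG : IsReg ev G) :
    IsReg ev fun g => F g + G g := by
  obtain ⟨T, hT⟩ := hF
  obtain ⟨T', hT'⟩ := hG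
  exact ⟨T + T', fun g => by simp only [map_add, hT, hT']⟩

lemma IsReg.sum {ι : Type*} (s : Finset ι) {F : ι → Γ → M} (hF : ∀ i ∈ s, IsReg ev (F i)) :
    IsReg ev fun g => ∑ i ∈ s, F i g := by
  classical
  induction s using Finset.induction_on with
  | empty => simpa using isReg_const ev (0 : M)
  | insert i s hi ih =>
    simp only [Finset.sum_insert hi]
    exact (hF _ (Finset.mem_insert_self _ _)).add
      (ih fun j hj => hF j (Finset.mem_insert_of_mem hj))

lemma IsReg.smul {f : Γ → ℂ} {F : Γ → M} (hf : IsReg ev f) (hF : IsReg ev F) :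
    IsReg ev fun g => f g • F g := by
  obtain ⟨t, ht⟩ := hf
  obtain ⟨T, hT⟩ := hF
  have h : ∀ g, evT ev g t = ev g (TensorProduct.rid ℂ B t) := fun g => by
    clear ht
    induction t with
    | zero => simp
    | add x y hx hy => simp only [map_add, hx, hy]
    | tmul x y => simp [mul_comm]
  exact ⟨TensorProduct.rid ℂ B t • T, fun g => by simp only [evT_smul, ht, hT, h]⟩

lemma isReg_of_eval {f : Γ → ℂ} (b : B) (h : ∀ g, f g = ev g b) : IsReg ev f :=
  ⟨b ⊗ₜ 1, fun g => by simp [h]⟩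

lemma IsReg.prod {ι : Type*} (s : Finset ι) {f : ι → Γ → ℂ} (hf : ∀ i ∈ s, IsReg ev (f i)) :
    IsReg ev fun g => ∏ i ∈ s, f i g := by
  classical
  induction s using Finset.induction_on with
  | empty => simpa using isReg_const ev (1 : ℂ)
  | insert i s hi ih =>
    simp only [Finset.prod_insert hi]
    exact (hf _ (Finset.mem_insert_self _ _)).smul
      (ih fun j hj => hf j (Finset.mem_insert_of_mem hj))

lemma IsReg.comp {F : Γ → M} (hF : IsReg ev F) (f : M →ₗ[ℂ] N) : IsReg ev fun g => f (F g) := by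
  obtain ⟨T, hT⟩ := hF
  exact ⟨f.lTensor B T, fun g => by simp only [evT_lTensor, hT]⟩

lemma IsReg.pi {ι : Type*} [Finite ι] {F : Γ → ι → M} (hF : ∀ i, IsReg ev fun g => F g i) :
    IsReg ev F := by
  classical
  have := Fintype.ofFinite ι
  have h := IsReg.sum Finset.univ fun i _ =>
    (hF i).comp (LinearMap.single ℂ (fun _ : ι => M) i)
  have e : (fun g => ∑ i, LinearMap.single ℂ (fun _ : ι => M) i (F g i)) = F := by
    funext g i
    simp [Finset.sum_apply, Pi.single_apply]
  rw [e] at h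
  exact h

/-- A regular function with values in a subspace is regular as a function to the subspace. -/
lemma IsReg.of_injective {S : Set Γ} (hS : IsDense ev S) {F : Γ → M} (f : M →ₗ[ℂ] N)
    (hf : Function.Injective f) (hF : IsReg ev fun g => f (F g)) : IsReg ev F := by
  obtain ⟨T, hT⟩ := hF
  have hex : Function.Exact f f.range.mkQ := LinearMap.exact_map_mkQ_range f
  -- The tensor representing f ∘ F dies in B ⊗ (N / im f), since it vanishes at all points of a
  -- dense set; right exactness of B ⊗ - then lifts it to B ⊗ M.
  have h0 : f.range.mkQ.lTensor B T = 0 := hS.evT_eq_zero fun g _ => by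
    rw [evT_lTensor, ← hT]
    exact hex.apply_apply_eq_zero _
  obtain ⟨T', rfl⟩ := (lTensor_exact B hex (Submodule.mkQ_surjective _) T).1 h0
  exact ⟨T', fun g => hf ((hT g).trans (evT_lTensor _ _ _ _))⟩

end RegularFunctions

/-! ### Algebraic representations, their coactions and averaging operators. -/

section AlgebraicRepresentations

variable {Γ B : Type*} [Group Γ] [CommRing B] [Algebra ℂ B] {ev : Γ → (B →ₐ[ℂ] ℂ)}
  {M N : Type*} [AddCommGroup M] [Module ℂ M] [AddCommGroup N] [Module ℂ N]
  {ρ : Representation ℂ Γ M} {σ : Representation ℂ Γ N}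

variable (ev ρ) in
/-- A representation all of whose orbit maps are regular. -/
def IsAlg : Prop := ∀ m, IsReg ev fun g => ρ g m

/-- The coaction of an algebraic representation. -/
def IsAlg.coact {S : Set Γ} (hS : IsDense ev S) (h : IsAlg ev ρ) : M →ₗ[ℂ] B ⊗[ℂ] M where
  -- Density of S makes the tensor representing an orbit map unique; this is why an arbitrary choice
  -- is linear in m.
  toFun m := (h m).choose
  map_add' m m' := hS.evT_ext fun g _ => by
    rw [map_add, ← (h m).choose_spec, ← (h m').choose_spec, ← (h (m + m')).choose_spec]
    exact map_add _ _ _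
  map_smul' c m := hS.evT_ext fun g _ => by
    rw [RingHom.id_apply, map_smul, ← (h m).choose_spec, ← (h (c • m)).choose_spec]
    exact map_smul _ _ _

lemma IsAlg.evT_coact {S : Set Γ} (hS : IsDense ev S) (h : IsAlg ev ρ) (g : Γ) (m : M) :
    evT ev g (h.coact hS m) = ρ g m := ((h m).choose_spec g).symm

lemma IsAlg.coact_map {S : Set Γ} (hS : IsDense ev S) (h : IsAlg ev ρ) (h' : IsAlg ev σ)
    (f : M →ₗ[ℂ] N) (hf : ∀ g m, f (ρ g m) = σ g (f m)) (m : M) :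
    h'.coact hS (f m) = f.lTensor B (h.coact hS m) :=
  hS.evT_ext fun g _ => by rw [evT_lTensor, evT_coact, evT_coact, hf]

lemma IsAlg.of_injective {S : Set Γ} (hS : IsDense ev S) (h' : IsAlg ev σ)
    (f : M →ₗ[ℂ] N) (hf : Function.Injective f) (hfρ : ∀ g m, f (ρ g m) = σ g (f m)) :
    IsAlg ev ρ := fun m => by
  have h := h' (f m)
  simp only [← hfρ] at h
  exact h.of_injective hS f hf

/-- Transform the coaction by a linear functional. -/
def IsAlg.transform {S : Set Γ} (hS : IsDense ev S) (h : IsAlg ev ρ) (l : B →ₗ[ℂ] ℂ) :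
    M →ₗ[ℂ] M :=
  (TensorProduct.lid ℂ M).toLinearMap ∘ₗ l.rTensor M ∘ₗ h.coact hS

/-- When `l` is an integral, `transform` is m ↦ ∫ ρ(g) m dg. It is built from the coaction alone, so
it commutes with every equivariant map; this is later applied to the differential and to changes of
coefficients. -/
lemma IsAlg.transform_map {S : Set Γ} (hS : IsDense ev S) (h : IsAlg ev ρ) (h' : IsAlg ev σ)
    (l : B →ₗ[ℂ] ℂ) (f : M →ₗ[ℂ] N) (hf : ∀ g m, f (ρ g m) = σ g (f m)) (m : M) :
    h'.transform hS l (f m) = f (h.transform hS l m) := by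
  simp only [transform, LinearMap.comp_apply, h.coact_map hS h' f hf]
  generalize h.coact hS m = T
  induction T with
  | zero => simp
  | add x y hx hy => simp only [map_add, hx, hy]
  | tmul x y => simp

lemma IsAlg.transform_of_fixed {S : Set Γ} (hS : IsDense ev S) (h : IsAlg ev ρ)
    (l : B →ₗ[ℂ] ℂ) {m : M} (hm : ∀ g, ρ g m = m) :
    h.transform hS l m = l 1 • m := by
  have : h.coact hS m = 1 ⊗ₜ m := hS.evT_ext fun g _ => by
    rw [h.evT_coact, hm]; simp
  simp [transform, this]

/-- A left invariant functional produces invariant vectors. -/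
lemma IsAlg.map_transform {S : Set Γ} (hS : IsDense ev S) (h : IsAlg ev ρ)
    (l : B →ₗ[ℂ] ℂ) {k : Γ} (τ : B →ₗ[ℂ] B) (hτ : ∀ g b, ev g (τ b) = ev (k * g) b)
    (c : ℂ) (hl : ∀ b, l (τ b) = c * l b) (m : M) :
    ρ k (h.transform hS l m) = c • h.transform hS l m := by
  -- Both tensors represent g ↦ ρ(kg) m: acting by k on the values equals translating the
  -- coefficient functions.
  have h1 : (ρ k).lTensor B (h.coact hS m) = τ.rTensor M (h.coact hS m) :=
    hS.evT_ext fun g _ => by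
      have h2 : ∀ T : B ⊗[ℂ] M, evT ev g (τ.rTensor M T) = evT ev (k * g) T := fun T => by
        induction T with
        | zero => simp
        | add x y hx hy => simp only [map_add, hx, hy]
        | tmul x y => simp [hτ]
      rw [evT_lTensor, h2, h.evT_coact, h.evT_coact, map_mul]
      rfl
  have h3 : ∀ T : B ⊗[ℂ] M, TensorProduct.lid ℂ M (l.rTensor M ((ρ k).lTensor B T)) =
      ρ k (TensorProduct.lid ℂ M (l.rTensor M T)) := fun T => by
    induction T with
    | zero => simp
    | add x y hx hy => simp only [map_add, hx, hy]
    | tmul x y => simp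
  have h4 : ∀ T : B ⊗[ℂ] M, TensorProduct.lid ℂ M (l.rTensor M (τ.rTensor M T)) =
      c • (TensorProduct.lid ℂ M (l.rTensor M T)) := fun T => by
    induction T with
    | zero => simp
    | add x y hx hy => simp only [map_add, hx, hy, smul_add]
    | tmul x y => simp [hl, mul_smul]
  change ρ k (TensorProduct.lid ℂ M (l.rTensor M (h.coact hS m))) = _
  rw [← h3, h1, h4]
  rfl

/-- A vector of an algebraic representation fixed by a dense set is fixed. -/
lemma IsAlg.fixed_of_dense {S : Set Γ} (hS : IsDense ev S) (h : IsAlg ev ρ) {m : M}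
    (hm : ∀ g ∈ S, ρ g m = m) (g : Γ) : ρ g m = m := by
  have : h.coact hS m = 1 ⊗ₜ m := hS.evT_ext fun g hg => by
    rw [h.evT_coact, hm g hg]; simp
  rw [← h.evT_coact hS, this]; simp

end AlgebraicRepresentations

/-! ### Integration of regular functions over the compact subgroup. -/

section Haar

variable (A : Type) [CommRing A] [HopfAlgebra ℂ A]

/-- Evaluation of regular functions at complex points. -/
def ptEv (g : Points A ℂ) : A →ₐ[ℂ] ℂ := g.ofConv

variable {A}

lemma points_mul_apply {S : Type} [CommRing S] [Algebra ℂ S] (g h : Points A S) (a : A) :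
    (g * h) a = ∑ i ∈ (ℛ ℂ a).index, g ((ℛ ℂ a).left i) * h ((ℛ ℂ a).right i) := by
  rw [AlgHom.convMul_apply, ← (ℛ ℂ a).eq]
  simp [map_sum]

lemma points_inv_apply {S : Type} [CommRing S] [Algebra ℂ S] (g : Points A S) (a : A) :
    g⁻¹ a = g (HopfAlgebra.antipode ℂ a) := rfl

/-- Left translation of regular functions: `(k · a)(g) = a(k g)`. -/
def leftTr (k : Points A ℂ) : A →ₗ[ℂ] A :=
  (TensorProduct.lid ℂ A).toLinearMap ∘ₗ k.ofConv.toLinearMap.rTensor A ∘ₗ comul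

lemma ptEv_leftTr (k g : Points A ℂ) (a : A) : ptEv A g (leftTr k a) = ptEv A (k * g) a := by
  change _ = (k * g) a
  rw [AlgHom.convMul_apply]
  change ptEv A g (TensorProduct.lid ℂ A (k.ofConv.toLinearMap.rTensor A (comul a))) = _
  generalize (comul a : A ⊗[ℂ] A) = T
  induction T with
  | zero => simp
  | add x y hx hy => simp only [map_add, hx, hy]
  | tmul x y => simp [ptEv]

open MeasureTheory in
/-- The normalized invariant integral over a compact Zariski dense subgroup. -/
lemma exists_invariant_integral (hG : IsReductive A) :
    ∃ K : Subgroup (Points A ℂ), IsDense (ptEv A) (K : Set (Points A ℂ)) ∧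
      ∃ l : A →ₗ[ℂ] ℂ, l 1 = 1 ∧ ∀ k ∈ K, ∀ a, l (leftTr k a) = l a := by
  obtain ⟨K, hc, hd⟩ := hG
  refine ⟨K, hd, ?_⟩
  let emb : K → A → ℂ := fun g a => (g : Points A ℂ) a
  let : TopologicalSpace K := TopologicalSpace.induced emb inferInstance
  have hemb : Topology.IsInducing emb := ⟨rfl⟩
  have hcont : ∀ a, Continuous fun g : K => (g : Points A ℂ) a := fun a =>
    (continuous_apply a).comp hemb.continuous
  have hrange : Set.range emb = (fun (g : Points A ℂ) (a : A) => g a) '' K := by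
    ext f; simp [emb]
  have : CompactSpace K := by
    rw [← isCompact_univ_iff, hemb.isCompact_iff, Set.image_univ, hrange]
    exact hc
  -- The value of a product at a is Σ g(a′) h(a″), a finite sum of products of coordinates;
  -- inversion is likewise evaluation at the antipode.
  have : ContinuousMul K := ⟨by
    rw [hemb.continuous_iff]
    refine continuous_pi fun a => ?_
    have : ∀ p : K × K, (emb ∘ fun p : K × K => p.1 * p.2) p a =
        ∑ i ∈ (ℛ ℂ a).index, (p.1 : Points A ℂ) ((ℛ ℂ a).left i) *
          (p.2 : Points A ℂ) ((ℛ ℂ a).right i) := fun p => points_mul_apply _ _ _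
    simp only [this]
    exact continuous_finsetSum _ fun i _ => ((hcont _).comp continuous_fst).mul
      ((hcont _).comp continuous_snd)⟩
  have : ContinuousInv K := ⟨by
    rw [hemb.continuous_iff]
    refine continuous_pi fun a => ?_
    exact hcont (HopfAlgebra.antipode ℂ a)⟩
  have : IsTopologicalGroup K := ⟨⟩
  let : MeasurableSpace K := borel K
  have : BorelSpace K := ⟨rfl⟩
  -- Haar measure normalised on the whole of K, so the total mass is 1 and constants integrate to
  -- themselves.
  let μ := Measure.haarMeasure (⊤ : TopologicalSpace.PositiveCompacts K)
  have hμ : μ Set.univ = 1 := Measure.haarMeasure_self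
  have : IsProbabilityMeasure μ := ⟨hμ⟩
  have hint : ∀ a, Integrable (fun g : K => (g : Points A ℂ) a) μ := fun a =>
    (hcont a).integrable_of_hasCompactSupport (HasCompactSupport.of_compactSpace _)
  let l : A →ₗ[ℂ] ℂ :=
    { toFun := fun a => ∫ g : K, (g : Points A ℂ) a ∂μ
      map_add' := fun a b => by
        rw [← integral_add (hint a) (hint b)]
        exact integral_congr_ae (Filter.Eventually.of_forall fun g =>
          map_add (g : Points A ℂ).ofConv a b)
      map_smul' := fun c a => by
        rw [RingHom.id_apply, ← integral_smul]
        exact integral_congr_ae (Filter.Eventually.of_forall fun g =>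
          map_smul (g : Points A ℂ).ofConv c a) }
  refine ⟨l, ?_, fun k hk a => ?_⟩
  · change ∫ g : K, (g : Points A ℂ).ofConv 1 ∂μ = 1
    simp
  · have h := integral_mul_left_eq_self (μ := μ) (fun g : K => (g : Points A ℂ) a) ⟨k, hk⟩
    refine Eq.trans ?_ h
    exact integral_congr_ae (Filter.Eventually.of_forall fun g => ptEv_leftTr k g a)

end Haar

/-! ### The coordinate ring of G̃_𝒪 and its universal point. -/

section CoordinateRing

variable (A : Type) [CommRing A] [HopfAlgebra ℂ A]

/-- Polynomials in the coefficients of a generic arc, a parameter and its inverse. -/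
abbrev CoordPoly : Type := MvPolynomial ((A × ℕ) ⊕ Bool) ℂ

variable {A} in
/-- The generic family of power series. -/
def genArc (a : A) : PowerSeries (CoordPoly A) :=
  PowerSeries.mk fun n => MvPolynomial.X (Sum.inl (a, n))

/-- The relations expressing that the generic arc is an algebra homomorphism and that the
two parameters are mutually inverse. -/
inductive CoordRel : CoordPoly A → Prop
  | add (a b : A) (n : ℕ) :
    CoordRel (PowerSeries.coeff n (genArc (a + b) - (genArc a + genArc b)))
  | mul (a b : A) (n : ℕ) :
    CoordRel (PowerSeries.coeff n (genArc (a * b) - genArc a * genArc b))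
  | alg (c : ℂ) (n : ℕ) :
    CoordRel (PowerSeries.coeff n (genArc (algebraMap ℂ A c) - algebraMap ℂ _ c))
  | unit : CoordRel (MvPolynomial.X (Sum.inr true) * MvPolynomial.X (Sum.inr false) - 1)

/-- The coordinate ring of the group scheme `G̃_𝒪`. -/
def Coord : Type := CoordPoly A ⧸ Ideal.span {p | CoordRel A p}

instance : CommRing (Coord A) :=
  inferInstanceAs (CommRing (CoordPoly A ⧸ Ideal.span {p | CoordRel A p}))

instance : Algebra ℂ (Coord A) :=
  inferInstanceAs (Algebra ℂ (CoordPoly A ⧸ Ideal.span {p | CoordRel A p}))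

namespace Coord

/-- The quotient map from the polynomial ring. -/
def proj : CoordPoly A →ₐ[ℂ] Coord A := Ideal.Quotient.mkₐ ℂ _

lemma proj_surjective : Function.Surjective (proj A) := Ideal.Quotient.mkₐ_surjective ℂ _

variable {A}

lemma proj_rel {p : CoordPoly A} (hp : CoordRel A p) : proj A p = 0 :=
  Ideal.Quotient.eq_zero_iff_mem.2 (Ideal.subset_span hp)

/-- The coefficients of the universal arc. -/
def arcCoeff (a : A) (n : ℕ) : Coord A := proj A (MvPolynomial.X (Sum.inl (a, n)))

lemma map_genArc (a : A) :
    PowerSeries.map (proj A : CoordPoly A →+* Coord A) (genArc a) =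
      PowerSeries.mk (arcCoeff a) := by
  ext n; simp [genArc, arcCoeff]

variable (A) in
/-- The universal arc. -/
def arc : Arc A (Coord A) := toConv
  { toFun := fun a => PowerSeries.mk (arcCoeff a)
    map_one' := by
      ext n
      have h := proj_rel (CoordRel.alg (A := A) 1 n)
      rw [← RingHom.coe_coe, ← PowerSeries.coeff_map, map_sub, map_genArc] at h
      simpa [sub_eq_zero] using h
    map_mul' := fun a b => by
      ext n
      have h := proj_rel (CoordRel.mul a b n)
      rw [← RingHom.coe_coe, ← PowerSeries.coeff_map, map_sub, map_mul, map_genArc, map_genArc,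
        map_genArc, map_sub, sub_eq_zero] at h
      exact h
    map_zero' := by
      ext n
      have h := proj_rel (CoordRel.alg (A := A) 0 n)
      rw [← RingHom.coe_coe, ← PowerSeries.coeff_map, map_sub, map_genArc] at h
      simpa [sub_eq_zero] using h
    map_add' := fun a b => by
      ext n
      have h := proj_rel (CoordRel.add a b n)
      rw [← RingHom.coe_coe, ← PowerSeries.coeff_map, map_sub, map_add, map_genArc, map_genArc,
        map_genArc, map_sub, sub_eq_zero] at h
      exact h
    commutes' := fun c => by
      ext n
      have h := proj_rel (CoordRel.alg (A := A) c n)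
      rw [← RingHom.coe_coe, ← PowerSeries.coeff_map, map_sub, map_genArc, map_sub,
        sub_eq_zero] at h
      refine h.trans ?_
      rw [PowerSeries.algebraMap_apply, PowerSeries.algebraMap_apply, PowerSeries.map_C]
      simp }

lemma coeff_arc (a : A) (n : ℕ) : PowerSeries.coeff n (arc A a) = arcCoeff a n :=
  PowerSeries.coeff_mk n (arcCoeff a)

variable (A) in
/-- The universal parameter of the rotation group. -/
def rot : (Coord A)ˣ where
  val := proj A (MvPolynomial.X (Sum.inr true))
  inv := proj A (MvPolynomial.X (Sum.inr false))
  val_inv := by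
    have h := proj_rel (CoordRel.unit (A := A))
    rwa [map_sub, map_mul, map_one, sub_eq_zero] at h
  inv_val := by
    have h := proj_rel (CoordRel.unit (A := A))
    rwa [map_sub, map_mul, map_one, sub_eq_zero, mul_comm] at h

/-- The homomorphism from the coordinate ring defined by an arc and a parameter. -/
def lift {R : Type} [CommRing R] [Algebra ℂ R] (g : Arc A R) (t : Rˣ) : Coord A →ₐ[ℂ] R :=
  let f : CoordPoly A →ₐ[ℂ] R := MvPolynomial.aeval
    (Sum.elim (fun p => PowerSeries.coeff p.2 (g p.1)) fun b => if b then (t : R) else (t⁻¹ : Rˣ))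
  Ideal.Quotient.liftₐ _ f (by
    have hg : ∀ a, PowerSeries.map (f : CoordPoly A →+* R) (genArc a) = g a := fun a => by
      ext n; simp [genArc, f]
    have h : Ideal.span {p | CoordRel A p} ≤ RingHom.ker (f : CoordPoly A →+* R) := by
      rw [Ideal.span_le]
      rintro p (⟨a, b, n⟩ | ⟨a, b, n⟩ | ⟨c, n⟩ | _)
      all_goals rw [SetLike.mem_coe, RingHom.mem_ker]
      · rw [← PowerSeries.coeff_map, map_sub, map_add, hg, hg, hg]
        change PowerSeries.coeff n (g.ofConv (a + b) - (g.ofConv a + g.ofConv b)) = 0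
        rw [map_add, sub_self, map_zero]
      · rw [← PowerSeries.coeff_map, map_sub, map_mul, hg, hg, hg]
        change PowerSeries.coeff n (g.ofConv (a * b) - (g.ofConv a * g.ofConv b)) = 0
        rw [map_mul, sub_self, map_zero]
      · rw [← PowerSeries.coeff_map, map_sub, hg]
        change PowerSeries.coeff n (g.ofConv (algebraMap ℂ A c) - _) = 0
        rw [AlgHom.commutes, PowerSeries.algebraMap_apply, PowerSeries.algebraMap_apply,
          PowerSeries.map_C]
        simp
      · simp [f]
    exact fun p hp => h hp)

@[simp] lemma lift_arcCoeff {R : Type} [CommRing R] [Algebra ℂ R] (g : Arc A R) (t : Rˣ) (a : A)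
    (n : ℕ) : lift g t (arcCoeff a n) = PowerSeries.coeff n (g a) :=
  (MvPolynomial.aeval_X _ _).trans rfl

@[simp] lemma lift_rot {R : Type} [CommRing R] [Algebra ℂ R] (g : Arc A R) (t : Rˣ) :
    lift g t (rot A : Coord A) = t :=
  (MvPolynomial.aeval_X _ _).trans rfl

lemma adjoin_eq_top (S : Subalgebra ℂ (Coord A)) (h1 : ∀ a n, arcCoeff a n ∈ S)
    (h2 : (rot A : Coord A) ∈ S) (h3 : ((rot A)⁻¹ : (Coord A)ˣ).val ∈ S) (x : Coord A) : x ∈ S := by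
  obtain ⟨p, rfl⟩ := proj_surjective A x
  induction p using MvPolynomial.induction_on with
  | C c =>
    rw [← MvPolynomial.algebraMap_eq, AlgHom.commutes]
    exact S.algebraMap_mem c
  | add p q hp hq => rw [map_add]; exact S.add_mem hp hq
  | mul_X p i hp =>
    rw [map_mul]
    refine S.mul_mem hp ?_
    rcases i with ⟨a, n⟩ | b
    · exact h1 a n
    · cases b
      · exact h3
      · exact h2

lemma algHom_ext {R : Type*} [CommRing R] [Algebra ℂ R] {f g : Coord A →ₐ[ℂ] R}
    (h1 : ∀ a n, f (arcCoeff a n) = g (arcCoeff a n)) (h2 : f (rot A : Coord A) = g (rot A)) :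
    f = g := by
  ext x
  refine adjoin_eq_top (AlgHom.equalizer f g) h1 h2 ?_ x
  have h : Units.map (f : Coord A →* R) (rot A) = Units.map (g : Coord A →* R) (rot A) :=
    Units.ext h2
  have h' := congrArg (fun u : Rˣ => ((u⁻¹ : Rˣ) : R)) h
  simpa [← map_inv] using h'

/-- The universal point of `G̃_𝒪`. -/
def univ : ExtArc A (Coord A) := SemidirectProduct.inr (rot A) * SemidirectProduct.inl (arc A)

/-- The homomorphism from the coordinate ring classifying a point of `G̃_𝒪`. -/
def classify {R : Type} [CommRing R] [Algebra ℂ R] (h : ExtArc A R) : Coord A →ₐ[ℂ] R :=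
  lift (loopRot A R h.right⁻¹ h.left) h.right

/-- Points are written with the rotation to the left of the arc. Right translation by an arc then
leaves the rotation alone and multiplies the arc without a twist; the price is the twist by
`h.right⁻¹` in `classify`. -/
lemma inr_mul_inl_eq {R : Type} [CommRing R] [Algebra ℂ R] (h : ExtArc A R) :
    (SemidirectProduct.inr h.right * SemidirectProduct.inl (loopRot A R h.right⁻¹ h.left) :
      ExtArc A R) = h := by
  ext : 1 <;> simp

lemma map_inr_inl {R S : Type} [CommRing R] [Algebra ℂ R] [CommRing S] [Algebra ℂ S]
    (f : R →ₐ[ℂ] S) (t : Rˣ) (g : Arc A R) :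
    ExtArc.map f (SemidirectProduct.inr t * SemidirectProduct.inl g) =
      (SemidirectProduct.inr (Units.map (f : R →* S) t) *
        SemidirectProduct.inl (Points.map (PowerSeries.mapAlgHom f) g) : ExtArc A S) := by
  rw [map_mul]
  simp [ExtArc.map]

lemma map_arc {R : Type} [CommRing R] [Algebra ℂ R] (f : Coord A →ₐ[ℂ] R) (a : A) (n : ℕ) :
    PowerSeries.coeff n (Points.map (PowerSeries.mapAlgHom f) (arc A) a) = f (arcCoeff a n) := by
  rw [← coeff_arc]
  exact PowerSeries.coeff_map (f : Coord A →+* R) n _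

/-- Together with `hom_ext` this says that `Coord A` represents the group functor G̃_𝒪. Identities
between homomorphisms out of `Coord A` can therefore be checked on the universal point. -/
lemma map_classify_univ {R : Type} [CommRing R] [Algebra ℂ R] (h : ExtArc A R) :
    ExtArc.map (classify h) univ = h := by
  rw [univ, map_inr_inl]
  conv_rhs => rw [← inr_mul_inl_eq h]
  congr 2
  · ext; simp [classify]
  · apply WithConv.ext; ext a n
    exact (map_arc _ _ _).trans (lift_arcCoeff _ _ _ _)

lemma hom_ext {R : Type} [CommRing R] [Algebra ℂ R] {f g : Coord A →ₐ[ℂ] R}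
    (h : ExtArc.map f univ = ExtArc.map g (univ : ExtArc A (Coord A))) : f = g := by
  rw [univ, map_inr_inl, map_inr_inl] at h
  have h2 := congrArg SemidirectProduct.right h
  simp only [SemidirectProduct.mul_right, SemidirectProduct.right_inr, SemidirectProduct.right_inl,
    mul_one] at h2
  rw [h2, mul_right_inj] at h
  have h1 := SemidirectProduct.inl_injective h
  refine algHom_ext (fun a n => ?_) (congrArg Units.val h2)
  rw [← map_arc, ← map_arc, h1]

end Coord

lemma ExtArc.map_map {A R S S' : Type} [CommRing A] [HopfAlgebra ℂ A] [CommRing R] [Algebra ℂ R]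
    [CommRing S] [Algebra ℂ S] [CommRing S'] [Algebra ℂ S'] (f : R →ₐ[ℂ] S) (f' : S →ₐ[ℂ] S')
    (h : ExtArc A R) : ExtArc.map f' (ExtArc.map f h) = ExtArc.map (f'.comp f) h := rfl

end CoordinateRing

/-! ### Cofree representations, Frobenius reciprocity and injective resolutions. -/

section Cofree

variable {A : Type} [CommRing A] [HopfAlgebra ℂ A]

lemma baseChange_ext {R : Type} [CommRing R] [Algebra ℂ R] {V N : Type*} [AddCommGroup V]
    [Module ℂ V] [AddCommGroup N] [Module R N] {f g : R ⊗[ℂ] V →ₗ[R] N}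
    (h : ∀ v, f (1 ⊗ₜ v) = g (1 ⊗ₜ v)) : f = g := by
  ext w
  induction w with
  | zero => simp
  | add x y hx hy => rw [map_add, map_add, hx, hy]
  | tmul r v =>
    have : (r ⊗ₜ v : R ⊗[ℂ] V) = r • (1 ⊗ₜ v) := by simp [TensorProduct.smul_tmul']
    rw [this, map_smul, map_smul, h]

/-- Right translation by a point of `G̃_𝒪` on the coordinate ring. -/
def translate {R : Type} [CommRing R] [Algebra ℂ R] (h : ExtArc A R) :
    Coord A →ₐ[ℂ] R ⊗[ℂ] Coord A :=
  Coord.classify (ExtArc.map Algebra.TensorProduct.includeRight Coord.univ *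
    ExtArc.map Algebra.TensorProduct.includeLeft h)

lemma map_translate_univ {R : Type} [CommRing R] [Algebra ℂ R] (h : ExtArc A R) :
    ExtArc.map (translate h) Coord.univ = ExtArc.map Algebra.TensorProduct.includeRight Coord.univ *
    ExtArc.map Algebra.TensorProduct.includeLeft h := Coord.map_classify_univ _

/-- Extension of `translate` to the base change of the coordinate ring. -/
def translateExt {R : Type} [CommRing R] [Algebra ℂ R] (h : ExtArc A R) :
    R ⊗[ℂ] Coord A →ₐ[R] R ⊗[ℂ] Coord A :=
  Algebra.TensorProduct.productLeftAlgHom Algebra.TensorProduct.includeLeft (translate h)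

lemma translateExt_tmul {R : Type} [CommRing R] [Algebra ℂ R] (h : ExtArc A R) (r : R)
    (x : Coord A) : translateExt h (r ⊗ₜ x) = r • translate h x := by
  simp [translateExt, Algebra.smul_def]

/-- On the universal point u this is associativity: u(gh) = (ug)h. -/
lemma translate_mul {R : Type} [CommRing R] [Algebra ℂ R] (g h : ExtArc A R) :
    translate (g * h) = ((translateExt g).restrictScalars ℂ).comp (translate h) := by
  apply Coord.hom_ext
  rw [← ExtArc.map_map, map_translate_univ, map_translate_univ, map_mul, map_mul,
    ExtArc.map_map, ExtArc.map_map]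
  have h1 : ((translateExt g).restrictScalars ℂ).comp Algebra.TensorProduct.includeRight =
      translate g := by
    ext x; simp [translateExt_tmul]
  have h2 : ((translateExt g).restrictScalars ℂ).comp Algebra.TensorProduct.includeLeft =
      Algebra.TensorProduct.includeLeft := by
    ext x; simp [translateExt_tmul, Algebra.smul_def]
  rw [h1, h2, map_translate_univ, mul_assoc]

lemma translate_one {R : Type} [CommRing R] [Algebra ℂ R] :
    translate (1 : ExtArc A R) = Algebra.TensorProduct.includeRight := by
  apply Coord.hom_ext
  rw [map_translate_univ, map_one, mul_one]

lemma translate_map {R S : Type} [CommRing R] [Algebra ℂ R] [CommRing S] [Algebra ℂ S]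
    (f : R →ₐ[ℂ] S) (h : ExtArc A R) :
    translate (ExtArc.map f h) =
      (Algebra.TensorProduct.map f (AlgHom.id ℂ (Coord A))).comp (translate h) := by
  apply Coord.hom_ext
  rw [← ExtArc.map_map, map_translate_univ, map_translate_univ, map_mul, ExtArc.map_map,
    ExtArc.map_map, ExtArc.map_map]
  congr 2
  congr 1
  ext x
  simp

variable (A) in
/-- The action of `G̃_𝒪(R)` on `R ⊗ (ℂ[G̃_𝒪] ⊗ W)` by right translation of functions. -/
def cofreeAct (W : Type v) [AddCommGroup W] [Module ℂ W] (R : Type) [CommRing R] [Algebra ℂ R]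
    (h : ExtArc A R) : R ⊗[ℂ] (Coord A ⊗[ℂ] W) →ₗ[R] R ⊗[ℂ] (Coord A ⊗[ℂ] W) :=
  LinearMap.liftBaseChange R
    ((TensorProduct.assoc ℂ R (Coord A) W).toLinearMap ∘ₗ (translate h).toLinearMap.rTensor W)

lemma cofreeAct_tmul (W : Type v) [AddCommGroup W] [Module ℂ W] {R : Type} [CommRing R]
    [Algebra ℂ R] (h : ExtArc A R) (r : R) (x : Coord A ⊗[ℂ] W) :
    cofreeAct A W R h (r ⊗ₜ x) =
      r • TensorProduct.assoc ℂ R (Coord A) W ((translate h).toLinearMap.rTensor W x) := rfl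

lemma cofreeAct_assoc (W : Type v) [AddCommGroup W] [Module ℂ W] {R : Type} [CommRing R]
    [Algebra ℂ R] (h : ExtArc A R) (y : R ⊗[ℂ] Coord A) (w : W) :
    cofreeAct A W R h (TensorProduct.assoc ℂ R (Coord A) W (y ⊗ₜ w)) =
      TensorProduct.assoc ℂ R (Coord A) W (translateExt h y ⊗ₜ w) := by
  induction y with
  | zero => simp
  | add x y hx hy => simp only [TensorProduct.add_tmul, map_add, hx, hy]
  | tmul r x =>
    rw [TensorProduct.assoc_tmul, cofreeAct_tmul, translateExt_tmul, LinearMap.rTensor_tmul,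
      AlgHom.toLinearMap_apply]
    generalize translate h x = z
    induction z with
    | zero => simp
    | add x y hx hy => simp only [TensorProduct.add_tmul, map_add, smul_add, hx, hy]
    | tmul s x => simp [TensorProduct.smul_tmul']

variable (A) in
/-- The cofree representation `ℂ[G̃_𝒪] ⊗ W`. -/
abbrev cofree (W : Type v) [AddCommGroup W] [Module ℂ W] : ExtArcRep.{v} A where
  V := Coord A ⊗[ℂ] W
  act R _ _ :=
    { toFun := cofreeAct A W R
      map_one' := baseChange_ext fun x => by
        rw [cofreeAct_tmul, translate_one, one_smul]
        induction x with
        | zero => simp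
        | add x y hx hy => rw [map_add, map_add, hx, hy, TensorProduct.tmul_add, map_add]
        | tmul x w => simp
      map_mul' := fun g h => baseChange_ext fun x => by
        rw [cofreeAct_tmul, Module.End.mul_apply, cofreeAct_tmul, one_smul, one_smul, translate_mul]
        induction x with
        | zero => simp
        | add x y hx hy => simp only [map_add, hx, hy]
        | tmul x w =>
          simp only [LinearMap.rTensor_tmul, AlgHom.toLinearMap_apply, cofreeAct_assoc]
          rfl }
  act_map {R S} _ _ _ _ f h w := by
    change f.toLinearMap.rTensor _ (cofreeAct A W R h w) = cofreeAct A W S _ _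
    induction w with
    | zero => simp
    | add x y hx hy => simp only [map_add, hx, hy]
    | tmul r x =>
      induction x with
      | zero => simp
      | add x y hx hy => simp only [TensorProduct.tmul_add, map_add, hx, hy]
      | tmul x w =>
        rw [LinearMap.rTensor_tmul, cofreeAct_tmul, cofreeAct_tmul, translate_map]
        simp only [LinearMap.rTensor_tmul, AlgHom.toLinearMap_apply, AlgHom.comp_apply]
        generalize translate h x = z
        induction z with
        | zero => simp
        | add x y hx hy => simp only [TensorProduct.add_tmul, map_add, smul_add, hx, hy]
        | tmul s x => simp [TensorProduct.smul_tmul']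

lemma cofree_act_tmul (W : Type v) [AddCommGroup W] [Module ℂ W] {R : Type} [CommRing R]
    [Algebra ℂ R] (h : ExtArc A R) (r : R) (x : Coord A ⊗[ℂ] W) :
    (cofree A W).act R h (r ⊗ₜ x : R ⊗[ℂ] (Coord A ⊗[ℂ] W)) =
      r • TensorProduct.assoc ℂ R (Coord A) W ((translate h).toLinearMap.rTensor W x) := rfl

namespace ExtArcRep

variable (X Y Z : ExtArcRep.{v} A)

/-- The coaction of the coordinate ring: the action of the universal point. -/
def coaction : X.V →ₗ[ℂ] Coord A ⊗[ℂ] X.V :=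
  (X.act (Coord A) Coord.univ).restrictScalars ℂ ∘ₗ TensorProduct.mk ℂ (Coord A) X.V 1

lemma coaction_apply (x : X.V) : X.coaction x = X.act (Coord A) Coord.univ (1 ⊗ₜ x) := rfl

/-- Every point is a specialization of the universal one, so by naturality the coaction determines
the whole action. -/
lemma act_one_tmul {R : Type} [CommRing R] [Algebra ℂ R] (h : ExtArc A R) (x : X.V) :
    X.act R h (1 ⊗ₜ x) = (Coord.classify h).toLinearMap.rTensor X.V (X.coaction x) := by
  rw [coaction_apply, X.act_map, Coord.map_classify_univ]
  simp

variable {X Y Z}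

/-- A linear map commuting with the coactions is a morphism of representations. -/
def Hom.ofOne (f : X.V →ₗ[ℂ] Y.V) (hf : ∀ (R : Type) [CommRing R] [Algebra ℂ R] (h : ExtArc A R)
    (x : X.V), f.lTensor R (X.act R h (1 ⊗ₜ x)) = Y.act R h (1 ⊗ₜ f x)) : Hom X Y where
  lin := f
  comm R _ _ h w := by
    have : f.baseChange R ∘ₗ X.act R h = Y.act R h ∘ₗ f.baseChange R :=
      baseChange_ext fun x => by
        simp only [LinearMap.comp_apply, LinearMap.baseChange_tmul]
        exact hf R h x
    exact LinearMap.congr_fun this w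

/-- Composition of morphisms. -/
def Hom.comp (g : Hom Y Z) (f : Hom X Y) : Hom X Z where
  lin := g.lin ∘ₗ f.lin
  comm R _ _ h w := by
    rw [LinearMap.lTensor_comp_apply, f.comm, g.comm, LinearMap.lTensor_comp_apply]

variable (X) in
/-- The identity morphism. -/
def Hom.id : Hom X X where
  lin := LinearMap.id
  comm R _ _ h w := by simp

lemma Hom.coaction_comm (f : Hom X Y) (x : X.V) :
    Y.coaction (f.lin x) = f.lin.lTensor _ (X.coaction x) := by
  rw [coaction_apply, coaction_apply, f.comm, LinearMap.lTensor_tmul]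

section Frobenius

variable {W : Type v} [AddCommGroup W] [Module ℂ W]

/-- The vector x goes to the function u ↦ l(u x); replacing x by h x replaces u by uh, which is
right translation. -/
lemma cofree_act_lTensor_coaction (l : X.V →ₗ[ℂ] W) {R : Type} [CommRing R] [Algebra ℂ R]
    (h : ExtArc A R) (x : X.V) :
    (l.lTensor (Coord A) ∘ₗ X.coaction).lTensor R (X.act R h (1 ⊗ₜ x)) =
      (cofree A W).act R h (1 ⊗ₜ ((l.lTensor (Coord A) ∘ₗ X.coaction) x :)) := by
  -- Coassociativity: both sides describe the action of the product of the universal point with h on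
  -- x, over R ⊗ `Coord A`.
  have h1 : (translate h).toLinearMap.rTensor X.V (X.coaction x) =
      (TensorProduct.assoc ℂ R (Coord A) X.V).symm
        (X.coaction.lTensor R (X.act R h (1 ⊗ₜ x))) := by
    rw [coaction_apply, X.act_map, map_translate_univ, map_mul, Module.End.mul_apply,
      LinearMap.rTensor_tmul, AlgHom.toLinearMap_apply, map_one]
    have h2 : X.act (R ⊗[ℂ] Coord A) (ExtArc.map Algebra.TensorProduct.includeLeft h) (1 ⊗ₜ x) =
        (Algebra.TensorProduct.includeLeft : R →ₐ[ℂ] R ⊗[ℂ] Coord A).toLinearMap.rTensor X.V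
          (X.act R h (1 ⊗ₜ x)) := by
      rw [X.act_map, LinearMap.rTensor_tmul, AlgHom.toLinearMap_apply, map_one]
    rw [h2]
    generalize X.act R h (1 ⊗ₜ x) = z
    induction z with
    | zero => simp
    | add a b ha hb => simp only [map_add, ha, hb]
    | tmul r y =>
      have h3 : (Algebra.TensorProduct.includeLeft : R →ₐ[ℂ] R ⊗[ℂ] Coord A).toLinearMap.rTensor X.V
          (r ⊗ₜ y) = ((r ⊗ₜ 1 : R ⊗[ℂ] Coord A)) • (1 ⊗ₜ y) := by
        simp [TensorProduct.smul_tmul']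
      rw [h3, map_smul, LinearMap.lTensor_tmul, coaction_apply]
      have h4 : X.act (R ⊗[ℂ] Coord A) (ExtArc.map Algebra.TensorProduct.includeRight Coord.univ)
          (1 ⊗ₜ y) = (Algebra.TensorProduct.includeRight :
            Coord A →ₐ[ℂ] R ⊗[ℂ] Coord A).toLinearMap.rTensor X.V (X.coaction y) := by
        rw [coaction_apply, X.act_map, LinearMap.rTensor_tmul, AlgHom.toLinearMap_apply, map_one]
      rw [h4, coaction_apply]
      generalize X.act (Coord A) Coord.univ (1 ⊗ₜ y) = z
      induction z with
      | zero => simp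
      | add a b ha hb => simp only [map_add, smul_add, TensorProduct.tmul_add, ha, hb]
      | tmul c y => simp [TensorProduct.smul_tmul']
  rw [cofree_act_tmul, one_smul, LinearMap.comp_apply]
  have h5 : ∀ z : Coord A ⊗[ℂ] X.V, TensorProduct.assoc ℂ R (Coord A) W
      ((translate h).toLinearMap.rTensor W (l.lTensor (Coord A) z)) =
      (l.lTensor (Coord A)).lTensor R (TensorProduct.assoc ℂ R (Coord A) X.V
        ((translate h).toLinearMap.rTensor X.V z)) := by
    intro z
    induction z with
    | zero => simp
    | add a b ha hb => simp only [map_add, ha, hb]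
    | tmul c y =>
      simp only [LinearMap.lTensor_tmul, LinearMap.rTensor_tmul, AlgHom.toLinearMap_apply]
      generalize translate h c = z
      induction z with
      | zero => simp
      | add a b ha hb => simp only [map_add, TensorProduct.add_tmul, ha, hb]
      | tmul c y => simp
  rw [h5, h1, LinearEquiv.apply_symm_apply, LinearMap.lTensor_comp_apply]

/-- The morphism to a cofree representation defined by a linear map. -/
def Hom.toCofree (l : X.V →ₗ[ℂ] W) : Hom X (cofree A W) :=
  Hom.ofOne (Y := cofree A W) (l.lTensor (Coord A) ∘ₗ X.coaction) fun _ _ _ h x =>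
    cofree_act_lTensor_coaction l h x

lemma Hom.toCofree_apply (l : X.V →ₗ[ℂ] W) (x : X.V) :
    (Hom.toCofree l).lin x = l.lTensor (Coord A) (X.coaction x) := rfl

variable (A W) in
/-- Evaluation at the unit of `G̃_𝒪`. -/
def cofreeEval : Coord A ⊗[ℂ] W →ₗ[ℂ] W :=
  (TensorProduct.lid ℂ W).toLinearMap ∘ₗ
    (Coord.classify (1 : ExtArc A ℂ)).toLinearMap.rTensor W

lemma cofreeEval_toCofree (l : X.V →ₗ[ℂ] W) (x : X.V) :
    cofreeEval A W ((Hom.toCofree l).lin x) = l x := by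
  have h := X.act_one_tmul (1 : ExtArc A ℂ) x
  rw [map_one, Module.End.one_apply] at h
  have h2 := congrArg (fun z => l (TensorProduct.lid ℂ X.V z)) h
  simp only [TensorProduct.lid_tmul, one_smul] at h2
  rw [h2, Hom.toCofree_apply]
  generalize X.coaction x = z
  induction z with
  | zero => simp
  | add a b ha hb => simp only [map_add, ha, hb]
  | tmul c y => simp [cofreeEval]

/-- An equivariant map is recovered from its values at the unit, because f(x)(u) = (u f(x))(1) = f(u
x)(1). With `cofreeEval_toCofree` this is Frobenius reciprocity: morphisms to `cofree A W` are
linear maps to W. -/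
lemma Hom.eq_toCofree (f : Hom X (cofree A W)) (x : X.V) :
    f.lin x = (Hom.toCofree (cofreeEval A W ∘ₗ f.lin)).lin x := by
  have h := f.coaction_comm x
  rw [Hom.toCofree_apply, LinearMap.lTensor_comp_apply, ← h, coaction_apply]
  change f.lin x = (cofreeEval A W).lTensor (Coord A)
    ((cofree A W).act (Coord A) Coord.univ (1 ⊗ₜ[ℂ] (f.lin x : Coord A ⊗[ℂ] W)))
  rw [cofree_act_tmul, one_smul]
  generalize (f.lin x : Coord A ⊗[ℂ] W) = z
  -- The counit axiom: in the product of two universal points the first, carried by the right tensor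
  -- factor, is specialized to the unit.
  have key : (Algebra.TensorProduct.productMap (AlgHom.id ℂ (Coord A))
      ((Algebra.ofId ℂ (Coord A)).comp (Coord.classify (1 : ExtArc A ℂ)))).comp
        (translate Coord.univ) = AlgHom.id ℂ (Coord A) := by
    apply Coord.hom_ext
    rw [← ExtArc.map_map, map_translate_univ, map_mul, ExtArc.map_map, ExtArc.map_map]
    have h1 : (Algebra.TensorProduct.productMap (AlgHom.id ℂ (Coord A))
      ((Algebra.ofId ℂ (Coord A)).comp (Coord.classify (1 : ExtArc A ℂ)))).comp
        Algebra.TensorProduct.includeRight =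
        (Algebra.ofId ℂ (Coord A)).comp (Coord.classify (1 : ExtArc A ℂ)) := by
      ext x; simp
    have h2 : (Algebra.TensorProduct.productMap (AlgHom.id ℂ (Coord A))
      ((Algebra.ofId ℂ (Coord A)).comp (Coord.classify (1 : ExtArc A ℂ)))).comp
        Algebra.TensorProduct.includeLeft = AlgHom.id ℂ (Coord A) := by
      ext x; simp
    rw [h1, h2, ← ExtArc.map_map, Coord.map_classify_univ, map_one, one_mul]
  change Coord A ⊗[ℂ] W at z
  induction z with
  | zero => simp
  | add a b ha hb => simp only [map_add, ← ha, ← hb]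
  | tmul c w =>
    rw [LinearMap.rTensor_tmul, AlgHom.toLinearMap_apply]
    have h3 := AlgHom.congr_fun key c
    rw [AlgHom.comp_apply, AlgHom.id_apply] at h3
    conv_lhs => rw [← h3]
    generalize translate (Coord.univ : ExtArc A (Coord A)) c = y
    induction y with
    | zero => simp
    | add a b ha hb => simp only [map_add, TensorProduct.add_tmul, ← ha, ← hb]
    | tmul a b =>
      simp only [Algebra.TensorProduct.productMap_apply_tmul, AlgHom.id_apply, AlgHom.comp_apply,
        TensorProduct.assoc_tmul, LinearMap.lTensor_tmul, cofreeEval, LinearMap.comp_apply,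
        LinearMap.rTensor_tmul, AlgHom.toLinearMap_apply, LinearEquiv.coe_coe,
        TensorProduct.lid_tmul]
      rw [Algebra.ofId_apply, mul_comm, ← Algebra.smul_def, TensorProduct.smul_tmul]

-- By Frobenius reciprocity a morphism to a cofree representation extends as soon as the
-- corresponding linear map to W does, and over a field a linear retraction of `i` achieves that.
variable (A W) in
lemma cofree_isInjective : (cofree A W).IsInjective := by
  intro Y Z i hi f
  obtain ⟨r, hr⟩ := LinearMap.exists_leftInverse_of_injective i.lin (LinearMap.ker_eq_bot.2 hi)
  refine ⟨Hom.toCofree (cofreeEval A W ∘ₗ f.lin ∘ₗ r), ?_⟩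
  ext y
  rw [f.eq_toCofree, LinearMap.comp_apply, Hom.toCofree_apply, Hom.toCofree_apply,
    i.coaction_comm, ← LinearMap.lTensor_comp_apply]
  congr 2
  ext y
  simp only [LinearMap.comp_apply]
  rw [← LinearMap.comp_apply r, hr, LinearMap.id_apply]

end Frobenius

variable (X) in
/-- Every representation embeds in a cofree one. -/
def embed : Hom X (cofree A X.V) := Hom.toCofree LinearMap.id

variable (X) in
lemma embed_injective : Function.Injective (embed X).lin := fun x y h => by
  have := congrArg (cofreeEval A X.V) h
  rwa [embed, cofreeEval_toCofree, cofreeEval_toCofree] at this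

section Quotient

/-- The action on a quotient, on the image of `1 ⊗ V`. -/
def quotAct (i : Hom X Y) (R : Type) [CommRing R] [Algebra ℂ R] (h : ExtArc A R) :
    R ⊗[ℂ] (Y.V ⧸ i.lin.range) →ₗ[R] R ⊗[ℂ] (Y.V ⧸ i.lin.range) :=
  LinearMap.liftBaseChange R (i.lin.range.liftQ
    (i.lin.range.mkQ.lTensor R ∘ₗ (Y.act R h).restrictScalars ℂ ∘ₗ TensorProduct.mk ℂ R Y.V 1) (by
      rintro _ ⟨x, rfl⟩
      have h1 := i.comm R h (1 ⊗ₜ x)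
      rw [LinearMap.lTensor_tmul] at h1
      rw [LinearMap.mem_ker]
      change i.lin.range.mkQ.lTensor R (Y.act R h (1 ⊗ₜ i.lin x)) = 0
      rw [← h1, ← LinearMap.lTensor_comp_apply, LinearMap.range_mkQ_comp, LinearMap.lTensor_zero,
        LinearMap.zero_apply]))

lemma quotAct_mkQ (i : Hom X Y) (R : Type) [CommRing R] [Algebra ℂ R] (h : ExtArc A R)
    (w : R ⊗[ℂ] Y.V) :
    quotAct i R h (i.lin.range.mkQ.baseChange R w) = i.lin.range.mkQ.baseChange R (Y.act R h w) := by
  have : quotAct i R h ∘ₗ i.lin.range.mkQ.baseChange R =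
      i.lin.range.mkQ.baseChange R ∘ₗ Y.act R h := baseChange_ext fun y => by
    rw [LinearMap.comp_apply, LinearMap.baseChange_tmul, quotAct, LinearMap.liftBaseChange_tmul,
      one_smul]
    rfl
  exact LinearMap.congr_fun this w

/-- The cokernel of a morphism of representations. -/
abbrev quot (i : Hom X Y) : ExtArcRep.{v} A where
  V := Y.V ⧸ i.lin.range
  act R _ _ :=
    { toFun := quotAct i R
      map_one' := by
        refine LinearMap.ext fun w => ?_
        obtain ⟨w, rfl⟩ := LinearMap.lTensor_surjective R (Submodule.mkQ_surjective i.lin.range) w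
        exact (quotAct_mkQ i R 1 w).trans (by rw [map_one]; rfl)
      map_mul' := fun g h => by
        refine LinearMap.ext fun w => ?_
        obtain ⟨w, rfl⟩ := LinearMap.lTensor_surjective R (Submodule.mkQ_surjective i.lin.range) w
        refine (quotAct_mkQ i R (g * h) w).trans ?_
        rw [map_mul, Module.End.mul_apply, Module.End.mul_apply]
        refine Eq.trans ?_ (congrArg (quotAct i R g) (quotAct_mkQ i R h w).symm)
        exact (quotAct_mkQ i R g _).symm }
  act_map {R S} _ _ _ _ f h w := by
    obtain ⟨w, rfl⟩ := LinearMap.lTensor_surjective R (Submodule.mkQ_surjective i.lin.range) w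
    change f.toLinearMap.rTensor _ (quotAct i R h (i.lin.range.mkQ.baseChange R w)) =
      quotAct i S _ _
    rw [quotAct_mkQ]
    have h1 : ∀ w : R ⊗[ℂ] Y.V, f.toLinearMap.rTensor _ (i.lin.range.mkQ.lTensor R w) =
        i.lin.range.mkQ.lTensor S (f.toLinearMap.rTensor _ w) := fun w => by
      rw [← LinearMap.comp_apply, ← LinearMap.comp_apply, LinearMap.rTensor_comp_lTensor,
        LinearMap.lTensor_comp_rTensor]
    rw [h1]
    refine (h1 _).trans ?_
    rw [Y.act_map]
    exact (quotAct_mkQ i S _ _).symm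

/-- The projection to the cokernel. -/
def quotMap (i : Hom X Y) : Hom Y (quot i) where
  lin := i.lin.range.mkQ
  comm R _ _ h w := (quotAct_mkQ i R h w).symm

lemma quotMap_surjective (i : Hom X Y) : Function.Surjective (quotMap i).lin :=
  Submodule.mkQ_surjective _

lemma quotMap_exact (i : Hom X Y) : Function.Exact i.lin (quotMap i).lin :=
  LinearMap.exact_map_mkQ_range _

/-- The morphism from the cokernel defined by a morphism vanishing on the image. -/
def quotDesc (i : Hom X Y) (f : Hom Y Z) (hf : ∀ x, f.lin (i.lin x) = 0) : Hom (quot i) Z where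
  lin := i.lin.range.liftQ f.lin (by rintro _ ⟨x, rfl⟩; exact hf x)
  comm R _ _ h w := by
    obtain ⟨w, rfl⟩ := LinearMap.lTensor_surjective R (quotMap_surjective i) w
    rw [← (quotMap i).comm]
    have h1 : (i.lin.range.liftQ f.lin (by rintro _ ⟨x, rfl⟩; exact hf x)) ∘ₗ (quotMap i).lin =
      f.lin := Submodule.liftQ_mkQ _ _ _
    rw [← LinearMap.lTensor_comp_apply, ← LinearMap.lTensor_comp_apply]
    erw [h1]
    exact f.comm R h w

lemma quotDesc_quotMap (i : Hom X Y) (f : Hom Y Z) (hf : ∀ x, f.lin (i.lin x) = 0) (y : Y.V) :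
    (quotDesc i f hf).lin ((quotMap i).lin y) = f.lin y := Submodule.liftQ_apply _ _ _

end Quotient

/-- The iterated cosyzygies of a representation. -/
def cosyzygy (X : ExtArcRep.{v} A) : ℕ → ExtArcRep.{v} A
  | 0 => X
  | n + 1 => quot (embed (cosyzygy X n))

/-- The resolution of a representation by cofree representations. -/
def cofreeRes (X : ExtArcRep.{v} A) : X.InjRes where
  I n := cofree A (cosyzygy X n).V
  injective n := cofree_isInjective A _
  ι := embed X
  -- The resolution is spliced from the sequences 0 → Ωⁿ → cofree → Ωⁿ⁺¹ → 0, where Ωⁿ is the n-th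
  -- cosyzygy.
  d n := (embed (cosyzygy X (n + 1))).comp (quotMap (embed (cosyzygy X n)))
  ι_injective := embed_injective X
  exact_zero := (Function.Injective.comp_exact_iff_exact (embed_injective (cosyzygy X 1))).2
    (quotMap_exact (embed X))
  exact_succ n := by
    have h := (Function.Injective.comp_exact_iff_exact (embed_injective (cosyzygy X (n + 2)))).2
      (quotMap_exact (embed (cosyzygy X (n + 1))))
    exact (Function.Surjective.comp_exact_iff_exact
      (quotMap_surjective (embed (cosyzygy X n)))).2 h

end ExtArcRep

end Cofree

/-! ### Left invariant vector fields and the rotation grading on the coordinate ring. -/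

section Derivations

variable {A : Type} [CommRing A] [HopfAlgebra ℂ A]

/-- Derivations of `R[[z]]` act on the convolution algebra. -/
def convDer {R : Type} [CommRing R] [Algebra ℂ R]
    (δ : Derivation ℂ (PowerSeries R) (PowerSeries R)) (x : Conv A R) : Conv A R :=
  toConv (δ.toLinearMap ∘ₗ x.ofConv)

lemma convDer_apply {R : Type} [CommRing R] [Algebra ℂ R]
    (δ : Derivation ℂ (PowerSeries R) (PowerSeries R)) (x : Conv A R) (a : A) :
    convDer δ x a = δ (x a) := rfl

/-- The convolution product uses the coproduct of A and multiplication in R[[z]]; the derivation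
meets only the latter. -/
lemma convDer_mul {R : Type} [CommRing R] [Algebra ℂ R]
    (δ : Derivation ℂ (PowerSeries R) (PowerSeries R)) (x y : Conv A R) :
    convDer δ (x * y) = convDer δ x * y + x * convDer δ y := by
  apply WithConv.ext; ext a : 1
  change δ ((x * y) a) = (convDer δ x * y) a + (x * convDer δ y) a
  rw [(ℛ ℂ a).convMul_apply, (ℛ ℂ a).convMul_apply, (ℛ ℂ a).convMul_apply, map_sum,
    ← Finset.sum_add_distrib]
  refine Finset.sum_congr rfl fun i _ => ?_
  rw [Derivation.leibniz, convDer_apply, convDer_apply, smul_eq_mul, smul_eq_mul]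
  ring

lemma convDer_one {R : Type} [CommRing R] [Algebra ℂ R]
    (δ : Derivation ℂ (PowerSeries R) (PowerSeries R)) : convDer δ (1 : Conv A R) = 0 := by
  apply WithConv.ext; ext a : 1
  exact δ.map_algebraMap _

/-- The Euler derivation `z d/dz`. -/
def euler (R : Type) [CommRing R] [Algebra ℂ R] :
    Derivation ℂ (PowerSeries R) (PowerSeries R) :=
  ((PowerSeries.X : PowerSeries R) • PowerSeries.derivative R).restrictScalars ℂ

@[simp] lemma coeff_euler {R : Type} [CommRing R] [Algebra ℂ R] (n : ℕ) (f : PowerSeries R) :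
    PowerSeries.coeff n (euler R f) = n * PowerSeries.coeff n f := by
  change PowerSeries.coeff n (PowerSeries.X * PowerSeries.derivative R f) = _
  cases n with
  | zero => simp
  | succ n =>
    rw [PowerSeries.coeff_succ_X_mul, PowerSeries.coeff_derivative]
    push_cast
    ring

/-- The coefficientwise extension of a derivation to power series. -/
def psDer {R : Type} [CommRing R] [Algebra ℂ R] (D : Derivation ℂ R R) :
    Derivation ℂ (PowerSeries R) (PowerSeries R) :=
  Derivation.mk'
    { toFun := fun f => PowerSeries.mk fun n => D (PowerSeries.coeff n f)
      map_add' := fun f g => by ext n; simp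
      map_smul' := fun c f => by ext n; simp } fun f g => by
    ext n
    simp only [LinearMap.coe_mk, AddHom.coe_mk, PowerSeries.coeff_mk, PowerSeries.coeff_mul,
      map_sum, Derivation.leibniz, smul_eq_mul, map_add, Finset.sum_add_distrib]
    congr 1
    exact Finset.Nat.sum_antidiagonal_swap
      (f := fun x => PowerSeries.coeff x.1 g * D (PowerSeries.coeff x.2 f))

@[simp] lemma coeff_psDer {R : Type} [CommRing R] [Algebra ℂ R] (D : Derivation ℂ R R) (n : ℕ)
    (f : PowerSeries R) : PowerSeries.coeff n (psDer D f) = D (PowerSeries.coeff n f) :=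
  PowerSeries.coeff_mk n fun n => D (PowerSeries.coeff n f)

lemma convDer_comm {R : Type} [CommRing R] [Algebra ℂ R] (D : Derivation ℂ R R) (x : Conv A R) :
    convDer (psDer D) (convDer (euler R) x) = convDer (euler R) (convDer (psDer D) x) := by
  apply WithConv.ext; ext a n
  change PowerSeries.coeff n (psDer D (euler R (x a))) =
    PowerSeries.coeff n (euler R (psDer D (x a)))
  simp

/-- Base change of the convolution algebra. -/
abbrev convBase (R : Type) [CommRing R] [Algebra ℂ R] : Conv A ℂ →ₐ[ℂ] Conv A R :=
  convMap (psBase R)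

lemma convDer_psDer_base {R : Type} [CommRing R] [Algebra ℂ R] (D : Derivation ℂ R R)
    (x : Conv A ℂ) : convDer (psDer D) (convBase R x) = 0 := by
  apply WithConv.ext; ext a n
  change PowerSeries.coeff n (psDer D (psBase R (x a))) = _
  simp [coeff_psBase]

/-- `z d/dz` on `z𝔤(𝒪)`. -/
def zgEuler (A : Type) [CommRing A] [HopfAlgebra ℂ A] : Module.End ℂ (zgO A) where
  toFun x := ⟨convDer (euler ℂ) x, by
    refine ⟨fun a b => ?_, fun a => ?_⟩
    · rw [convDer_apply, convDer_apply, convDer_apply, x.2.1, map_add, Derivation.map_smul,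
        Derivation.map_smul]
    · rw [convDer_apply, coeff_euler]; simp⟩
  map_add' x y := Subtype.ext (by
    apply WithConv.ext; ext a : 1
    exact map_add (euler ℂ) ((x : Conv A ℂ) a) ((y : Conv A ℂ) a))
  map_smul' c x := Subtype.ext (by
    apply WithConv.ext; ext a : 1
    exact (euler ℂ).map_smul c ((x : Conv A ℂ) a))

lemma convDer_euler_base (R : Type) [CommRing R] [Algebra ℂ R] (x : zgO A) :
    convDer (euler R) (convBase R (x : Conv A ℂ)) = convBase R (zgEuler A x : Conv A ℂ) := by
  apply WithConv.ext; ext a n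
  change PowerSeries.coeff n (euler R (psBase R ((x : Conv A ℂ) a))) =
    PowerSeries.coeff n (psBase R (euler ℂ ((x : Conv A ℂ) a)))
  simp [coeff_psBase]

lemma convVanish_base {R : Type} [CommRing R] [Algebra ℂ R] {m : ℕ} {x : Conv A ℂ}
    (hx : ConvVanish m x) : ConvVanish m (convBase R x) := fun a k hk => by
  rw [convMap_apply, coeff_psBase, hx a k hk, map_zero]

lemma convVanish_convDer {R : Type} [CommRing R] [Algebra ℂ R] {m : ℕ} {x : Conv A R}
    (hx : ConvVanish m x) : ConvVanish m (convDer (euler R) x) := fun a k hk => by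
  rw [convDer_apply, coeff_euler, hx a k hk, mul_zero]

lemma coeff_convMap_mapAlgHom {R S : Type} [CommRing R] [Algebra ℂ R] [CommRing S] [Algebra ℂ S]
    (f : R →ₐ[ℂ] S) (x : Conv A R) (a : A) (n : ℕ) :
    PowerSeries.coeff n ((convMap (PowerSeries.mapAlgHom f) x) a) =
      f (PowerSeries.coeff n (x a)) :=
  PowerSeries.coeff_map (f : R →+* S) n _

lemma coeff_add_smul {R : Type} [CommRing R] [Algebra ℂ R] (e : R) (x y : Conv A R) (a : A)
    (n : ℕ) : PowerSeries.coeff n ((x + e • y) a) =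
      PowerSeries.coeff n (x a) + e * PowerSeries.coeff n (y a) := by
  change PowerSeries.coeff n (x a + e • y a) = _
  rw [map_add, PowerSeries.coeff_smul]
  rfl

namespace Coord

lemma classify_inr_inl {R : Type} [CommRing R] [Algebra ℂ R] (t : Rˣ) (g : Arc A R) :
    classify (SemidirectProduct.inr t * SemidirectProduct.inl g : ExtArc A R) = lift g t := by
  simp [classify]

lemma derivation_eq_zero {D : Derivation ℂ (Coord A) (Coord A)}
    (h1 : ∀ a n, D (arcCoeff a n) = 0) (h2 : D (rot A : Coord A) = 0) : D = 0 := by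
  ext x
  let S : Subalgebra ℂ (Coord A) :=
    { carrier := {x | D x = 0}
      mul_mem' := fun {x y} hx hy => by
        rw [Set.mem_ofPred_eq] at hx hy ⊢
        rw [D.leibniz, hx, hy, smul_zero, smul_zero, add_zero]
      add_mem' := fun {x y} hx hy => by
        rw [Set.mem_ofPred_eq] at hx hy ⊢
        rw [map_add, hx, hy, add_zero]
      algebraMap_mem' := fun c => D.map_algebraMap c }
  refine adjoin_eq_top S h1 h2 ?_ x
  have h : (rot A : Coord A) * ((rot A)⁻¹ : (Coord A)ˣ) = 1 := by simp
  have h' := congrArg D h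
  rw [D.leibniz, h2, smul_zero, add_zero, D.map_one_eq_zero, smul_eq_mul,
    Units.mul_right_eq_zero] at h'
  exact h'

lemma derivation_ext {D D' : Derivation ℂ (Coord A) (Coord A)}
    (h1 : ∀ a n, D (arcCoeff a n) = D' (arcCoeff a n))
    (h2 : D (rot A : Coord A) = D' (rot A : Coord A)) : D = D' :=
  sub_eq_zero.1 (derivation_eq_zero (fun a n => by
    rw [Derivation.sub_apply, h1, sub_self]) (by rw [Derivation.sub_apply, h2, sub_self]))

/-- The infinitesimal translation point `1 + ε y`. -/
abbrev tangPt (y : zgO A) : ExtArc A (DualNumber ℂ) :=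
  SemidirectProduct.inl (tang DualNumber.eps DualNumber.eps_mul_eps y)

/-- At ε = 0 the point 1 + ε y becomes the unit, so the part without ε is f itself. -/
lemma translate_tangPt (y : zgO A) (f : Coord A) :
    translate (tangPt y) f = 1 ⊗ₜ f +
      DualNumber.eps ⊗ₜ ExtArcRep.epsPart (Coord A) (translate (tangPt y) f) := by
  have h1 := ExtArcRep.dual_decomp (Coord A) (translate (tangPt y) f)
  have h2 : (TrivSqZeroExt.fstHom ℂ ℂ ℂ).toLinearMap.rTensor (Coord A)
      (translate (tangPt y) f) = 1 ⊗ₜ f := by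
    have h3 := AlgHom.congr_fun (translate_map (TrivSqZeroExt.fstHom ℂ ℂ ℂ) (tangPt y)) f
    rw [ExtArcRep.extMap_inl, map_tang] at h3
    have h0 : (TrivSqZeroExt.fstHom ℂ ℂ ℂ) (DualNumber.eps : DualNumber ℂ) = 0 := by simp
    simp only [h0, tang_zero, map_one, translate_one] at h3
    exact h3.symm
  rw [h2] at h1
  simpa using h1

/-- The left invariant vector field on `G̃_𝒪` defined by an element of `z𝔤(𝒪)`. -/
def vf (y : zgO A) : Derivation ℂ (Coord A) (Coord A) :=
  Derivation.mk' (ExtArcRep.epsPart (Coord A) ∘ₗ (translate (tangPt y)).toLinearMap) fun f g => by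
    have h : translate (tangPt y) (f * g) = _ := map_mul _ f g
    simp only [LinearMap.comp_apply, AlgHom.toLinearMap_apply]
    rw [h, translate_tangPt y f, translate_tangPt y g]
    simp only [mul_add, add_mul, Algebra.TensorProduct.tmul_mul_tmul, one_mul, mul_one,
      DualNumber.eps_mul_eps, TensorProduct.zero_tmul, add_zero, map_add, ExtArcRep.epsPart_one,
      ExtArcRep.epsPart_eps, zero_add, smul_eq_mul]
    ring

lemma translate_tangPt_eq (y : zgO A) (f : Coord A) :
    translate (tangPt y) f = 1 ⊗ₜ f + DualNumber.eps ⊗ₜ vf y f := translate_tangPt y f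

/-- Since the arc stands on the right in the universal point, right multiplication by 1 + ε y
changes the arc only; the rotation parameter is untouched. -/
lemma translate_tangPt_lift (y : zgO A) : translate (tangPt y) =
    lift (Points.map (PowerSeries.mapAlgHom Algebra.TensorProduct.includeRight) (arc A) *
      tang (DualNumber.eps ⊗ₜ 1 : DualNumber ℂ ⊗[ℂ] Coord A)
        (by rw [Algebra.TensorProduct.tmul_mul_tmul, DualNumber.eps_mul_eps,
          TensorProduct.zero_tmul]) y)
      (Units.map (Algebra.TensorProduct.includeRight :
        Coord A →ₐ[ℂ] DualNumber ℂ ⊗[ℂ] Coord A) (rot A)) := by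
  rw [translate, univ, map_inr_inl, ExtArcRep.extMap_inl, map_tang, mul_assoc, ← map_mul,
    classify_inr_inl]
  rfl

lemma vf_rot (y : zgO A) : vf y (rot A : Coord A) = 0 := by
  have h := translate_tangPt_eq y (rot A : Coord A)
  rw [translate_tangPt_lift, lift_rot] at h
  have h' := congrArg (ExtArcRep.epsPart (Coord A)) h
  rw [map_add, ExtArcRep.epsPart_eps, ExtArcRep.epsPart_one, zero_add] at h'
  rw [← h']
  exact ExtArcRep.epsPart_one _ _

lemma vf_arcCoeff (y : zgO A) (a : A) (n : ℕ) :
    vf y (arcCoeff a n) =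
      PowerSeries.coeff n ((lin (arc A) * convBase (Coord A) (y : Conv A ℂ)) a) := by
  have h := translate_tangPt_eq y (arcCoeff a n)
  have hq : ∀ (x : Conv A (Coord A)) (b : A) (k : ℕ),
      PowerSeries.coeff k ((convMap (S := DualNumber ℂ ⊗[ℂ] Coord A)
        (PowerSeries.mapAlgHom (Algebra.TensorProduct.includeRight)) x) b) =
        1 ⊗ₜ PowerSeries.coeff k (x b) := fun x b k =>
    coeff_convMap_mapAlgHom (S := DualNumber ℂ ⊗[ℂ] Coord A) _ _ _ _
  have hb : convMap (psBase (DualNumber ℂ ⊗[ℂ] Coord A)) (y : Conv A ℂ) =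
      convMap (S := DualNumber ℂ ⊗[ℂ] Coord A)
        (PowerSeries.mapAlgHom (Algebra.TensorProduct.includeRight)) (convBase (Coord A) (y : Conv A ℂ)) := by
    apply WithConv.ext; ext b n
    change PowerSeries.coeff n (psBase _ ((y : Conv A ℂ) b)) = PowerSeries.coeff n
      ((convMap (S := DualNumber ℂ ⊗[ℂ] Coord A)
        (PowerSeries.mapAlgHom (Algebra.TensorProduct.includeRight)) (convBase (Coord A) (y : Conv A ℂ))) b)
    rw [hq, convMap_apply, coeff_psBase]
    exact (coeff_psBase _ _ _).trans (Algebra.TensorProduct.algebraMap_apply' _)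
  rw [translate_tangPt_lift, lift_arcCoeff, ← lin_apply, map_mul, lin_map, lin_tang, mul_add,
    mul_one, mul_smul_comm, hb, ← map_mul, coeff_add_smul, hq, hq,
    Algebra.TensorProduct.tmul_mul_tmul, mul_one,
    one_mul] at h
  have h' := congrArg (ExtArcRep.epsPart (Coord A)) h
  rw [map_add, map_add, ExtArcRep.epsPart_eps, ExtArcRep.epsPart_one, ExtArcRep.epsPart_eps,
    ExtArcRep.epsPart_one, zero_add, zero_add] at h'
  exact h'.symm

/-- Left invariance: the vector field of y moves the universal arc g by g·y. The analogous formula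
for rotations is `convDer_rotGen_arc`. -/
lemma convDer_vf_arc (y : zgO A) : convDer (psDer (vf y)) (lin (arc A)) =
    lin (arc A) * convBase (Coord A) (y : Conv A ℂ) := by
  apply WithConv.ext; ext a n
  change PowerSeries.coeff n (psDer (vf y) (arc A a)) = _
  rw [coeff_psDer, coeff_arc, vf_arcCoeff]

/-- A function involves finitely many arc coefficients, and the coefficient of zⁿ in g·y depends on
y modulo zⁿ⁺¹ only. -/
lemma exists_vf_eq_zero (f : Coord A) :
    ∃ m, ∀ y : zgO A, ConvVanish m (y : Conv A ℂ) → vf y f = 0 := by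
  let S : Subalgebra ℂ (Coord A) :=
    { carrier := {f | ∃ m, ∀ y : zgO A, ConvVanish m (y : Conv A ℂ) → vf y f = 0}
      mul_mem' := by
        rintro f g ⟨m, hm⟩ ⟨m', hm'⟩
        refine ⟨max m m', fun y hy => ?_⟩
        rw [Derivation.leibniz, hm y (hy.mono (le_max_left _ _)),
          hm' y (hy.mono (le_max_right _ _)), smul_zero, smul_zero, add_zero]
      add_mem' := by
        rintro f g ⟨m, hm⟩ ⟨m', hm'⟩
        refine ⟨max m m', fun y hy => ?_⟩
        rw [map_add, hm y (hy.mono (le_max_left _ _)), hm' y (hy.mono (le_max_right _ _)),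
          add_zero]
      algebraMap_mem' := fun c => ⟨0, fun y _ => Derivation.map_algebraMap _ c⟩ }
  refine adjoin_eq_top S (fun a n => ⟨n, fun y hy => ?_⟩) ⟨0, fun y _ => vf_rot y⟩
    ⟨0, fun y _ => ?_⟩ f
  · rw [vf_arcCoeff]
    exact ConvVanish.mul (Or.inr (convVanish_base hy)) a n le_rfl
  · have h : (rot A : Coord A) * ((rot A)⁻¹ : (Coord A)ˣ) = 1 := by simp
    have h' := congrArg (vf y) h
    rwa [Derivation.leibniz, vf_rot, smul_zero, add_zero, Derivation.map_one_eq_zero, smul_eq_mul,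
      Units.mul_right_eq_zero] at h'

/-! ### The grading by loop rotation -/

/-- The scaling `z ↦ q z` of the universal arc, as a homomorphism to polynomials in `q`. -/
def scale : Coord A →ₐ[ℂ] Polynomial (Coord A) :=
  lift (Points.map (rescaleHom (Polynomial.X : Polynomial (Coord A)))
    (Points.map (PowerSeries.mapAlgHom (Polynomial.CAlgHom :
      Coord A →ₐ[ℂ] Polynomial (Coord A))) (arc A)))
    (Units.map (Polynomial.C : Coord A →+* Polynomial (Coord A)) (rot A))

lemma scale_arcCoeff (a : A) (n : ℕ) :
    scale (arcCoeff a n) = Polynomial.C (arcCoeff a n) * Polynomial.X ^ n := by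
  rw [scale, lift_arcCoeff]
  change PowerSeries.coeff n (PowerSeries.rescale Polynomial.X
    (Points.map (PowerSeries.mapAlgHom (Polynomial.CAlgHom :
      Coord A →ₐ[ℂ] Polynomial (Coord A))) (arc A) a)) = _
  rw [PowerSeries.coeff_rescale, map_arc, mul_comm]
  rfl

lemma scale_rot : scale (rot A : Coord A) = Polynomial.C (rot A : Coord A) := by
  rw [scale, lift_rot]; rfl

lemma eval_one_scale (f : Coord A) : (scale f).eval 1 = f := by
  have : ((Polynomial.aeval (1 : Coord A)).restrictScalars ℂ).comp scale =
      AlgHom.id ℂ (Coord A) := by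
    apply algHom_ext
    · intro a n
      simp [scale_arcCoeff, Polynomial.coe_aeval_eq_eval]
    · simp [scale_rot, Polynomial.coe_aeval_eq_eval]
  have h := AlgHom.congr_fun this f
  simpa [Polynomial.coe_aeval_eq_eval] using h

/-- The generator of the conjugation action of loop rotations. -/
def rotGen : Derivation ℂ (Coord A) (Coord A) :=
  Derivation.mk'
    { toFun := fun f => (Polynomial.derivative (scale f)).eval 1
      map_add' := fun f g => by simp
      map_smul' := fun c f => by simp } fun f g => by
    simp only [LinearMap.coe_mk, AddHom.coe_mk, map_mul, Polynomial.derivative_mul,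
      Polynomial.eval_add, Polynomial.eval_mul, eval_one_scale, smul_eq_mul]
    ring

lemma rotGen_apply (f : Coord A) : rotGen f = (Polynomial.derivative (scale f)).eval 1 := rfl

lemma rotGen_of_scale {f : Coord A} {j : ℕ} (h : scale f = Polynomial.C f * Polynomial.X ^ j) :
    rotGen f = (j : ℂ) • f := by
  rw [rotGen_apply, h, Polynomial.derivative_C_mul, Polynomial.derivative_X_pow,
    Algebra.smul_def, map_natCast]
  simp only [Polynomial.eval_mul, Polynomial.eval_C, Polynomial.eval_pow, Polynomial.eval_X,
    one_pow, mul_one, Polynomial.eval_natCast, map_natCast]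
  rw [mul_comm]

lemma rotGen_arcCoeff (a : A) (n : ℕ) : rotGen (arcCoeff a n) = (n : ℂ) • arcCoeff a n :=
  rotGen_of_scale (scale_arcCoeff a n)

lemma rotGen_rot : rotGen (rot A : Coord A) = 0 := by
  rw [rotGen_apply, scale_rot]; simp

/-- The generators are homogeneous, `arcCoeff a n` of weight n and the rotation parameter and its
inverse of weight 0. Products of homogeneous elements are homogeneous, so these elements span. -/
lemma scale_induction {p : Coord A → Prop} (h0 : p 0) (hadd : ∀ f g, p f → p g → p (f + g))
    (hom : ∀ (j : ℕ) f, scale f = Polynomial.C f * Polynomial.X ^ j → p f) (f : Coord A) :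
    p f := by
  let M : Submonoid (Coord A) :=
    { carrier := {f | ∃ j : ℕ, scale f = Polynomial.C f * Polynomial.X ^ j}
      one_mem' := ⟨0, by simp⟩
      mul_mem' := by
        rintro f g ⟨i, hi⟩ ⟨j, hj⟩
        refine ⟨i + j, ?_⟩
        rw [map_mul, hi, hj, Polynomial.C_mul, pow_add]
        ring }
  have hinv : ((rot A)⁻¹ : (Coord A)ˣ).val ∈ M := by
    refine ⟨0, ?_⟩
    have h2 : Units.map (scale : Coord A →ₐ[ℂ] Polynomial (Coord A)).toRingHom.toMonoidHom (rot A) =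
        Units.map (Polynomial.C : Coord A →+* Polynomial (Coord A)).toMonoidHom (rot A) :=
      Units.ext scale_rot
    have h := congrArg (fun u : (Polynomial (Coord A))ˣ => ((u⁻¹ : (Polynomial (Coord A))ˣ) :
      Polynomial (Coord A))) h2
    simp only [← map_inv] at h
    rw [pow_zero, mul_one]
    exact h
  have hf : f ∈ Algebra.adjoin ℂ (M : Set (Coord A)) :=
    adjoin_eq_top _
      (fun a n => Algebra.subset_adjoin (show arcCoeff a n ∈ M from ⟨n, scale_arcCoeff a n⟩))
      (Algebra.subset_adjoin (show (rot A : Coord A) ∈ M from ⟨0, by rw [scale_rot]; simp⟩))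
      (Algebra.subset_adjoin hinv) f
  rw [← Subalgebra.mem_toSubmodule, Algebra.adjoin_eq_span, Submonoid.closure_eq] at hf
  -- The predicate is not assumed stable under scalars, so the scalar is carried through the
  -- induction and absorbed into the homogeneous elements.
  suffices h : ∀ c : ℂ, p (c • f) by simpa using h 1
  induction hf using Submodule.span_induction with
  | mem f hf =>
    obtain ⟨j, hj⟩ := hf
    refine fun c => hom j _ ?_
    rw [map_smul, hj, Algebra.smul_def, Algebra.smul_def, Polynomial.C_mul, mul_assoc]
    rfl
  | zero => intro c; rwa [smul_zero]
  | add f g _ _ hf hg => intro c; rw [smul_add]; exact hadd _ _ (hf c) (hg c)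
  | smul c' f _ hf => intro c; rw [smul_smul]; exact hf _

end Coord

end Derivations

/-! ### The logarithmic derivative of the universal arc along z d/dz. -/

section LogarithmicDerivative

variable {A : Type} [CommRing A] [HopfAlgebra ℂ A]

/-- The logarithmic derivative `g⁻¹ δ(g)` of an arc. -/
def logDer {R : Type} [CommRing R] [Algebra ℂ R]
    (δ : Derivation ℂ (PowerSeries R) (PowerSeries R)) (g : Arc A R) : Conv A R :=
  lin g⁻¹ * convDer δ (lin g)

lemma lin_mul_logDer {R : Type} [CommRing R] [Algebra ℂ R]
    (δ : Derivation ℂ (PowerSeries R) (PowerSeries R)) (g : Arc A R) :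
    lin g * logDer δ g = convDer δ (lin g) := by
  rw [logDer, ← mul_assoc, ← map_mul, mul_inv_cancel, map_one, one_mul]

/-- The values of g are multiplicative and δ is a derivation; since g⁻¹g is the counit, g⁻¹δ(g) is a
derivation at the unit, that is, a family of elements of the Lie algebra. -/
lemma logDer_leibniz {R : Type} [CommRing R] [Algebra ℂ R]
    (δ : Derivation ℂ (PowerSeries R) (PowerSeries R)) (g : Arc A R) (a b : A) :
    logDer δ g (a * b) =
      counit (R := ℂ) a • logDer δ g b + counit (R := ℂ) b • logDer δ g a := by
  have h1 : ∀ a, LinearMap.mul' ℂ _ (TensorProduct.map (lin g⁻¹).ofConv (lin g).ofConv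
      (comul a)) = algebraMap ℂ (PowerSeries R) (counit a) := fun a => by
    rw [← LinearMap.convMul_apply, ← map_mul, inv_mul_cancel, map_one, LinearMap.convOne_apply]
  have key : ∀ p q : A ⊗[ℂ] A, LinearMap.mul' ℂ _
      (TensorProduct.map (lin g⁻¹).ofConv (convDer δ (lin g)).ofConv (p * q)) =
      LinearMap.mul' ℂ _ (TensorProduct.map (lin g⁻¹).ofConv (lin g).ofConv p) *
        LinearMap.mul' ℂ _ (TensorProduct.map (lin g⁻¹).ofConv (convDer δ (lin g)).ofConv q) +
      LinearMap.mul' ℂ _ (TensorProduct.map (lin g⁻¹).ofConv (lin g).ofConv q) *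
        LinearMap.mul' ℂ _ (TensorProduct.map (lin g⁻¹).ofConv (convDer δ (lin g)).ofConv p) := by
    intro p q
    induction p with
    | zero => simp
    | add p p' hp hp' => simp only [add_mul, map_add, hp, hp', mul_add]; ring
    | tmul a b =>
      induction q with
      | zero => simp
      | add q q' hq hq' => simp only [mul_add, map_add, hq, hq', add_mul]; ring
      | tmul c d =>
        have hm : ∀ (k : Arc A R) (x y : A), (lin k) (x * y) = lin k x * lin k y :=
          fun k x y => map_mul k.ofConv x y
        simp only [Algebra.TensorProduct.tmul_mul_tmul, TensorProduct.map_tmul,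
          LinearMap.mul'_apply, convDer_apply, hm, Derivation.leibniz, smul_eq_mul]
        ring
  have h3 := key (comul a) (comul b)
  rw [← Bialgebra.comul_mul, h1, h1] at h3
  simp only [← LinearMap.convMul_apply] at h3
  rw [Algebra.smul_def, Algebra.smul_def]
  exact h3

/-- Since z d/dz kills constant terms, the logarithmic derivative has values in z𝔤 and not only in
𝔤. -/
lemma coeff_zero_logDer {R : Type} [CommRing R] [Algebra ℂ R] (g : Arc A R) (a : A) :
    PowerSeries.coeff 0 (logDer (euler R) g a) = 0 := by
  have h : ConvVanish 0 (convDer (euler R) (lin g)) := fun a k hk => by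
    obtain rfl := Nat.le_zero.1 hk
    rw [convDer_apply, coeff_euler]; simp
  exact ConvVanish.mul (Or.inr h) a 0 le_rfl

namespace Coord

variable (A) in
/-- The vector field generating loop rotations, as a function with values in `z𝔤(𝒪)`. -/
def rotField : Conv A (Coord A) := logDer (euler (Coord A)) (arc A)

/-- On the universal arc g the derivation `rotGen` acts like z d/dz, multiplying the coefficient of
zⁿ by n, and z dg/dz = g·Θ. So rotations move g as the vector field of Θ would. -/
lemma convDer_rotGen_arc : convDer (psDer rotGen) (lin (arc A)) = lin (arc A) * rotField A := by
  rw [rotField, lin_mul_logDer]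
  apply WithConv.ext; ext a n
  change PowerSeries.coeff n (psDer rotGen (arc A a)) =
    PowerSeries.coeff n (euler (Coord A) (arc A a))
  rw [coeff_psDer, coeff_arc, rotGen_arcCoeff, coeff_euler, coeff_arc, Algebra.smul_def, map_natCast]

/-- Replacing g by g(1 + ε y) in Θ = g⁻¹ z dg/dz gives Θ + ε([Θ, y] + z dy/dz). The last term is
what makes z d/dz appear in Cartan's formula. -/
lemma convDer_vf_rotField (y : zgO A) : convDer (psDer (vf y)) (rotField A) =
    rotField A * convBase (Coord A) (y : Conv A ℂ) - convBase (Coord A) (y : Conv A ℂ) * rotField A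
      + convBase (Coord A) (zgEuler A y : Conv A ℂ) := by
  have h0 : lin (arc A)⁻¹ * lin (arc A) = (1 : Conv A (Coord A)) := by
    rw [← map_mul, inv_mul_cancel, map_one]
  have h0' : lin (arc A) * lin (arc A)⁻¹ = (1 : Conv A (Coord A)) := by
    rw [← map_mul, mul_inv_cancel, map_one]
  have h1 := congrArg (convDer (psDer (vf y))) h0
  rw [convDer_mul, convDer_vf_arc, convDer_one, ← mul_assoc, h0, one_mul] at h1
  have h2 : convDer (psDer (vf y)) (lin (arc A)⁻¹) =
      - (convBase (Coord A) (y : Conv A ℂ) * lin (arc A)⁻¹) := by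
    have h3 := congrArg (· * lin (arc A)⁻¹) h1
    simp only [add_mul, zero_mul, mul_assoc, h0', mul_one] at h3
    exact eq_neg_of_add_eq_zero_left h3
  rw [rotField, logDer, convDer_mul, h2, convDer_comm, convDer_vf_arc, convDer_mul,
    convDer_euler_base, mul_add, ← mul_assoc, ← mul_assoc, h0, one_mul]
  have h3 : ∀ a b : Conv A (Coord A), -a * b = -(a * b) := fun a b => by
    rw [eq_neg_iff_add_eq_zero, ← add_mul, neg_add_cancel, zero_mul]
  rw [← mul_assoc (convBase (Coord A) (y : Conv A ℂ)), ← add_assoc, sub_eq_neg_add]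
  exact congrArg (fun t => t + _ + _) (h3 _ _)

/-- Loop rotation normalizes the left invariant vector fields and acts on them through z d/dz; the
commutator is a derivation, so it is compared on generators. -/
lemma vf_rotGen (y : zgO A) (f : Coord A) :
    vf y (rotGen f) = rotGen (vf y f) + vf (zgEuler A y) f := by
  have : ⁅vf y, rotGen⁆ = vf (zgEuler A y) := by
    refine derivation_ext (fun a n => ?_) ?_
    · rw [Derivation.commutator_apply, rotGen_arcCoeff, Derivation.map_smul, vf_arcCoeff,
        vf_arcCoeff, sub_eq_iff_eq_add]
      have h := congrArg (fun x : Conv A (Coord A) => PowerSeries.coeff n (x a))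
        (convDer_mul (euler (Coord A)) (lin (arc A)) (convBase (Coord A) (y : Conv A ℂ)))
      have h' := congrArg (fun x : Conv A (Coord A) => PowerSeries.coeff n (x a))
        (convDer_mul (psDer rotGen) (lin (arc A)) (convBase (Coord A) (y : Conv A ℂ)))
      rw [convDer_euler_base, ← lin_mul_logDer, ← rotField, ← convDer_rotGen_arc] at h
      rw [convDer_psDer_base, mul_zero, add_zero] at h'
      simp only [convDer_apply, coeff_euler, coeff_psDer] at h h'
      rw [Algebra.smul_def, map_natCast, h, h', add_comm]
      exact map_add (PowerSeries.coeff n) _ _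
    · rw [Derivation.commutator_apply, rotGen_rot, vf_rot, vf_rot, map_zero, map_zero, sub_self]
  rw [← this, Derivation.commutator_apply]
  abel

/-! ### Retraction to constant arcs -/

lemma scale_rotGen (f : Coord A) :
    scale (rotGen f) = Polynomial.X * Polynomial.derivative (scale f) := by
  induction f using scale_induction with
  | h0 => simp
  | hadd f g hf hg => rw [map_add, map_add, hf, hg, map_add, map_add, mul_add]
  | hom j f hf =>
    rw [rotGen_of_scale hf, map_smul, hf, Polynomial.derivative_C_mul, Polynomial.derivative_X_pow,
      Algebra.smul_def, map_natCast]
    cases j with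
    | zero => simp
    | succ j => simp [pow_succ]; ring

/-- The retraction of the universal arc to its value at `z = 0`. -/
def zeroScale : Coord A →ₐ[ℂ] Coord A :=
  ((Polynomial.aeval (0 : Coord A)).restrictScalars ℂ).comp scale

lemma zeroScale_apply (f : Coord A) : zeroScale f = (scale f).eval 0 := by
  simp [zeroScale, Polynomial.coe_aeval_eq_eval]

/-- If `rotGen f` = 0, the polynomial `scale f` in q has zero derivative, so in characteristic zero
it is constant and its values at q = 1 and q = 0 agree. -/
lemma zeroScale_eq_self {f : Coord A} (hf : rotGen f = 0) : zeroScale f = f := by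
  have h := scale_rotGen f
  rw [hf, map_zero] at h
  have h2 : Polynomial.derivative (scale f) = 0 := by
    ext n
    have := congrArg (fun p => Polynomial.coeff p (n + 1)) h
    simpa using this.symm
  have : ∀ n, (scale f).coeff (n + 1) = 0 := fun n => by
    have h3 := congrArg (fun p => Polynomial.coeff p n) h2
    simp only [Polynomial.coeff_derivative, Polynomial.coeff_zero] at h3
    have h4 : ((n : ℂ) + 1) • (scale f).coeff (n + 1) = 0 := by
      rw [Algebra.smul_def, mul_comm, ← h3]
      simp
    exact (smul_eq_zero.1 h4).resolve_left (Nat.cast_add_one_ne_zero n)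
  have h5 : scale f = Polynomial.C ((scale f).coeff 0) := by
    ext n
    cases n with
    | zero => simp
    | succ n => rw [this, Polynomial.coeff_C_succ]
  have h6 := eval_one_scale f
  rw [zeroScale_apply]
  rw [h5] at h6 ⊢
  simpa using h6

end Coord

end LogarithmicDerivative

/-! ### Bases of 𝔤 and coordinates on z𝔤(𝒪). -/

section Frames

variable (A : Type) [CommRing A] [HopfAlgebra ℂ A]

/-- A basis of the Lie algebra of `G` with functions dual to it. -/
structure Frame where
  r : ℕ
  ξ : Fin r → A →ₗ[ℂ] ℂ
  α : Fin r → A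
  leibniz (j : Fin r) (a b : A) : ξ j (a * b) = counit (R := ℂ) a * ξ j b + counit (R := ℂ) b * ξ j a
  dual (i j : Fin r) : ξ i (α j) = if i = j then 1 else 0
  expand (δ : A →ₗ[ℂ] ℂ)
    (hδ : ∀ a b, δ (a * b) = counit (R := ℂ) a * δ b + counit (R := ℂ) b * δ a) (a : A) :
    δ a = ∑ j, ξ j a * δ (α j)

/-- The Lie algebra of `G`. -/
def tangentSpace : Submodule ℂ (A →ₗ[ℂ] ℂ) where
  carrier := {δ | ∀ a b, δ (a * b) = counit (R := ℂ) a * δ b + counit (R := ℂ) b * δ a}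
  zero_mem' := by simp
  add_mem' := by
    intro δ δ' h h' a b
    rw [LinearMap.add_apply, h, h', LinearMap.add_apply, LinearMap.add_apply]
    ring
  smul_mem' := by
    intro c δ h a b
    rw [LinearMap.smul_apply, h, LinearMap.smul_apply, LinearMap.smul_apply]
    simp only [smul_eq_mul]
    ring

/-- A derivation at the unit is determined by its values on finitely many algebra generators. -/
instance [Algebra.FiniteType ℂ A] : FiniteDimensional ℂ (tangentSpace A) := by
  obtain ⟨s, hs⟩ := Algebra.FiniteType.out (R := ℂ) (A := A)
  let f : tangentSpace A →ₗ[ℂ] (s → ℂ) :=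
    LinearMap.pi fun a => LinearMap.applyₗ (a : A) ∘ₗ (tangentSpace A).subtype
  refine FiniteDimensional.of_injective f ((injective_iff_map_eq_zero f).2 fun δ hδ => ?_)
  refine Subtype.ext (LinearMap.ext fun a => ?_)
  have ha : a ∈ Algebra.adjoin ℂ (s : Set A) := hs ▸ Algebra.mem_top
  have h1 : (δ : A →ₗ[ℂ] ℂ) 1 = 0 := by
    have := δ.2 1 1
    simpa using this
  induction ha using Algebra.adjoin_induction with
  | mem a ha => exact congrFun hδ ⟨a, ha⟩
  | algebraMap c =>
    rw [Algebra.algebraMap_eq_smul_one, map_smul, h1, smul_zero]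
    rfl
  | add a b _ _ ha hb => rw [map_add, ha, hb]; simp
  | mul a b _ _ ha hb => rw [δ.2 a b, ha, hb]; simp

instance [Algebra.FiniteType ℂ A] : Nonempty (Frame A) := by
  let b := Module.finBasis ℂ (tangentSpace A)
  let F : A →ₗ[ℂ] (Fin (Module.finrank ℂ (tangentSpace A)) → ℂ) :=
    LinearMap.pi fun j => (b j : A →ₗ[ℂ] ℂ)
  -- Linearly independent functionals are jointly surjective: a functional vanishing on the range
  -- would be a linear relation between them. Preimages of the unit vectors serve as the dual
  -- functions.
  have hF : Function.Surjective F := by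
    rw [← LinearMap.range_eq_top]
    by_contra hne
    obtain ⟨l, hl0, hl⟩ := Submodule.exists_le_ker_of_lt_top _ (lt_top_iff_ne_top.2 hne)
    have h1 : ∑ j, l (Pi.single j 1) • b j = 0 := by
      refine Subtype.ext (LinearMap.ext fun a => ?_)
      have h2 : l (F a) = 0 := hl ⟨a, rfl⟩
      rw [LinearMap.pi_apply_eq_sum_univ l (F a)] at h2
      simp only [AddSubmonoidClass.coe_finsetSum, Submodule.coe_smul, LinearMap.sum_apply,
        LinearMap.smul_apply, ZeroMemClass.coe_zero, LinearMap.zero_apply]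
      rw [← h2]
      refine Finset.sum_congr rfl fun j _ => ?_
      rw [smul_eq_mul, smul_eq_mul, mul_comm]
      congr 1
      congr 1
      ext i
      simp [Pi.single_apply, eq_comm]
    have h3 := Fintype.linearIndependent_iff.1 b.linearIndependent _ h1
    apply hl0
    ext j
    simpa using h3 j
  choose α hα using fun j => hF (Pi.single j 1)
  have hdual : ∀ i j, (b i : A →ₗ[ℂ] ℂ) (α j) = if i = j then 1 else 0 := fun i j => by
    have := congrFun (hα j) i
    rwa [Pi.single_apply] at this
  exact ⟨{
    r := _
    ξ := fun j => b j
    α := α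
    leibniz := fun j => (b j).2
    dual := hdual
    expand := fun δ hδ a => by
      have h := b.sum_repr ⟨δ, hδ⟩
      have h2 : ∀ a, δ a = ∑ j, b.repr ⟨δ, hδ⟩ j * (b j : A →ₗ[ℂ] ℂ) a := fun a => by
        have := congrArg (fun x : tangentSpace A => (x : A →ₗ[ℂ] ℂ) a) h
        simp only [AddSubmonoidClass.coe_finsetSum, Submodule.coe_smul, LinearMap.sum_apply,
          LinearMap.smul_apply, smul_eq_mul] at this
        exact this.symm
      have h3 : ∀ j, δ (α j) = b.repr ⟨δ, hδ⟩ j := fun j => by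
        rw [h2]; simp [hdual]
      rw [h2]
      exact Finset.sum_congr rfl fun j _ => by rw [h3, mul_comm] }⟩

variable {A}

namespace Frame

variable (Φ : Frame A)

lemma expand_module {M : Type*} [AddCommGroup M] [Module ℂ M] (δ : A →ₗ[ℂ] M)
    (hδ : ∀ a b, δ (a * b) = counit (R := ℂ) a • δ b + counit (R := ℂ) b • δ a) (a : A) :
    δ a = ∑ j, Φ.ξ j a • δ (Φ.α j) := by
  rw [← sub_eq_zero, ← Module.forall_dual_apply_eq_zero_iff ℂ]
  intro l
  rw [map_sub, sub_eq_zero, map_sum]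
  have := Φ.expand (l ∘ₗ δ) (fun a b => by simp [hδ]) a
  simpa using this

/-- The elements `z^{k+1} ξⱼ` of `z𝔤(𝒪)`. -/
def e (k : ℕ) (j : Fin Φ.r) : zgO A :=
  ⟨toConv (PowerSeries.monomial (k + 1) ∘ₗ Φ.ξ j), by
    refine ⟨fun a b => ?_, fun a => ?_⟩
    · change PowerSeries.monomial (k + 1) (Φ.ξ j (a * b)) =
        counit (R := ℂ) a • PowerSeries.monomial (k + 1) (Φ.ξ j b) +
          counit (R := ℂ) b • PowerSeries.monomial (k + 1) (Φ.ξ j a)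
      rw [Φ.leibniz, map_add, ← smul_eq_mul, ← smul_eq_mul, map_smul, map_smul]
    · change PowerSeries.coeff 0 (PowerSeries.monomial (k + 1) (Φ.ξ j a)) = 0
      rw [PowerSeries.coeff_monomial, if_neg (Nat.succ_ne_zero k).symm]⟩

lemma coeff_e (k : ℕ) (j : Fin Φ.r) (a : A) (n : ℕ) :
    PowerSeries.coeff n ((Φ.e k j : Conv A ℂ) a) = if n = k + 1 then Φ.ξ j a else 0 :=
  PowerSeries.coeff_monomial _ _ _

lemma convVanish_e {m k : ℕ} (h : m ≤ k) (j : Fin Φ.r) : ConvVanish m (Φ.e k j : Conv A ℂ) :=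
  fun a n hn => by rw [coeff_e, if_neg (by omega)]

/-- The eigenvalue is k + 1 rather than k because the constant arcs are left out. Its positivity is
what makes forms of positive degree acyclic. -/
lemma zgEuler_e (k : ℕ) (j : Fin Φ.r) : zgEuler A (Φ.e k j) = ((k : ℂ) + 1) • Φ.e k j := by
  apply Subtype.ext
  apply WithConv.ext; ext a n
  change PowerSeries.coeff n (euler ℂ ((Φ.e k j : Conv A ℂ) a)) =
    PowerSeries.coeff n (((k : ℂ) + 1) • ((Φ.e k j : Conv A ℂ) a))
  rw [coeff_euler, PowerSeries.coeff_smul, coeff_e]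
  split_ifs with h
  · rw [h]; push_cast; rfl
  · simp

/-- The coordinate functions dual to the elements `z^{k+1} ξⱼ`. -/
def coord (k : ℕ) (j : Fin Φ.r) : zgO A →ₗ[ℂ] ℂ where
  toFun x := PowerSeries.coeff (k + 1) ((x : Conv A ℂ) (Φ.α j))
  map_add' x y := map_add (PowerSeries.coeff (k + 1)) _ _
  map_smul' c x := PowerSeries.coeff_smul (k + 1) ((x : Conv A ℂ) (Φ.α j)) c

/-- An infinitesimal family vanishing at `z = 0` is determined modulo `z^{m+1}` by its
coordinates. -/
lemma convVanish_sub_sum {R : Type} [CommRing R] [Algebra ℂ R] (m : ℕ) (x : Conv A R)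
    (hx : ∀ a b, x (a * b) = counit (R := ℂ) a • x b + counit (R := ℂ) b • x a)
    (h0 : ∀ a, PowerSeries.coeff 0 (x a) = 0) :
    ConvVanish m (x - ∑ k ∈ Finset.range m, ∑ j,
      PowerSeries.coeff (k + 1) (x (Φ.α j)) • convBase R (Φ.e k j : Conv A ℂ)) := by
  intro a n hn
  have h1 : ∀ s : Conv A R, PowerSeries.coeff n ((x - s) a) =
      PowerSeries.coeff n (x a) - PowerSeries.coeff n (s a) := fun s => map_sub _ _ _
  have h2 : PowerSeries.coeff n ((∑ k ∈ Finset.range m, ∑ j,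
      PowerSeries.coeff (k + 1) (x (Φ.α j)) • convBase R (Φ.e k j : Conv A ℂ)) a) =
      ∑ k ∈ Finset.range m, ∑ j, PowerSeries.coeff (k + 1) (x (Φ.α j)) *
        algebraMap ℂ R (if n = k + 1 then Φ.ξ j a else 0) := by
    let L : Conv A R →+ R :=
      { toFun := fun s => PowerSeries.coeff n (s a)
        map_zero' := map_zero _
        map_add' := fun s t => map_add _ _ _ }
    change L _ = _
    simp only [map_sum]
    refine Finset.sum_congr rfl fun k _ => Finset.sum_congr rfl fun j _ => ?_
    change PowerSeries.coeff n ((PowerSeries.coeff (k + 1) (x (Φ.α j)) : R) • (psBase R ((Φ.e k j : Conv A ℂ) a))) = _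
    rw [PowerSeries.coeff_smul, coeff_psBase, coeff_e]
    rfl
  rw [h1, h2]
  cases n with
  | zero => rw [h0]; simp
  | succ n =>
    rw [Finset.sum_eq_single n]
    · have := Φ.expand_module (((PowerSeries.coeff (R := R) (n + 1)).restrictScalars ℂ) ∘ₗ x.ofConv)
        (fun a b => by
          change PowerSeries.coeff (n + 1) (x (a * b)) = _
          rw [hx, map_add, PowerSeries.coeff_smul, PowerSeries.coeff_smul]
          rfl) a
      rw [sub_eq_zero]
      refine this.trans (Finset.sum_congr rfl fun j _ => ?_)
      rw [if_pos rfl, Algebra.smul_def, mul_comm]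
      rfl
    · intro k _ hk
      refine Finset.sum_eq_zero fun j _ => ?_
      rw [if_neg (by omega), map_zero, mul_zero]
    · intro h
      exact absurd (Finset.mem_range.2 hn) h

lemma convBase_complex (x : Conv A ℂ) : convBase ℂ x = x := by
  apply WithConv.ext; ext a n
  change PowerSeries.coeff n (psBase ℂ (x a)) = _
  rw [coeff_psBase]
  rfl

/-- The truncation of `z𝔤(𝒪)` modulo `z^{m+1}`. -/
def trunc (m : ℕ) (x : zgO A) : zgO A := ∑ k ∈ Finset.range m, ∑ j, Φ.coord k j x • Φ.e k j

lemma convVanish_sub_trunc (m : ℕ) (x : zgO A) :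
    ConvVanish m ((x - Φ.trunc m x : zgO A) : Conv A ℂ) := by
  have h := Φ.convVanish_sub_sum m (x : Conv A ℂ) x.2.1 x.2.2
  have h2 : ((x - Φ.trunc m x : zgO A) : Conv A ℂ) = x - ∑ k ∈ Finset.range m, ∑ j,
      PowerSeries.coeff (k + 1) ((x : Conv A ℂ) (Φ.α j)) • convBase ℂ (Φ.e k j : Conv A ℂ) := by
    simp only [convBase_complex, trunc]
    push_cast
    rfl
  rw [h2]
  exact h

end Frame

end Frames

/-! ### Loop rotation as a combination of vector fields; local nilpotence of levels. -/

section Generation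

variable {A : Type} [CommRing A] [HopfAlgebra ℂ A]

namespace Coord

open Filter in
/-- A sequence of derivations which is eventually zero on each of the generators is eventually
zero on each element. -/
lemma eventually_derivation_eq_zero {D : ℕ → Derivation ℂ (Coord A) (Coord A)}
    (h1 : ∀ a n, ∀ᶠ m in atTop, D m (arcCoeff a n) = 0)
    (h2 : ∀ᶠ m in atTop, D m (rot A : Coord A) = 0) (f : Coord A) :
    ∀ᶠ m in atTop, D m f = 0 := by
  let S : Subalgebra ℂ (Coord A) :=
    { carrier := {f | ∀ᶠ m in atTop, D m f = 0}
      mul_mem' := fun {f g} hf hg => (hf.and hg).mono fun m h => by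
        rw [Derivation.leibniz, h.1, h.2, smul_zero, smul_zero, add_zero]
      add_mem' := fun {f g} hf hg => (hf.and hg).mono fun m h => by
        rw [map_add, h.1, h.2, add_zero]
      algebraMap_mem' := fun c => Eventually.of_forall fun m => (D m).map_algebraMap c }
  refine adjoin_eq_top S h1 h2 (h2.mono fun m hm => ?_) f
  have h : (rot A : Coord A) * ((rot A)⁻¹ : (Coord A)ˣ) = 1 := by simp
  have h' := congrArg (D m) h
  rwa [Derivation.leibniz, hm, smul_zero, add_zero, Derivation.map_one_eq_zero, smul_eq_mul,
    Units.mul_right_eq_zero] at h'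

/-- The coordinates of the vector field of loop rotations in a frame. -/
def rotCoord (Φ : Frame A) (k : ℕ) (j : Fin Φ.r) : Coord A :=
  PowerSeries.coeff (k + 1) (rotField A (Φ.α j))

/-- Expand Θ in the frame up to order m: the remainder vanishes modulo zᵐ⁺¹, so it does not reach
the coefficient of zⁿ of g·Θ when n ≤ m. -/
lemma rotGen_arcCoeff_eq_sum (Φ : Frame A) {m n : ℕ} (h : n ≤ m) (a : A) :
    rotGen (arcCoeff a n) =
      ∑ k ∈ Finset.range m, ∑ j, rotCoord Φ k j • vf (Φ.e k j) (arcCoeff a n) := by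
  have h1 := Φ.convVanish_sub_sum m (rotField A) (logDer_leibniz _ _) (coeff_zero_logDer _)
  have h2 : ConvVanish m (lin (arc A) * (rotField A - ∑ k ∈ Finset.range m, ∑ j,
      rotCoord Φ k j • convBase (Coord A) (Φ.e k j : Conv A ℂ))) := ConvVanish.mul (Or.inr h1)
  have h3 := h2 a n h
  rw [mul_sub, ← convDer_rotGen_arc, Finset.mul_sum] at h3
  simp only [Finset.mul_sum, mul_smul_comm] at h3
  have h4 : PowerSeries.coeff n (convDer (psDer rotGen) (lin (arc A)) a) =
      rotGen (arcCoeff a n) := by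
    rw [convDer_apply, coeff_psDer]
    exact congrArg rotGen (coeff_arc a n)
  let L : Conv A (Coord A) →ₗ[Coord A] Coord A :=
    { toFun := fun s => PowerSeries.coeff n (s a)
      map_add' := fun s t => map_add _ _ _
      map_smul' := fun c s => PowerSeries.coeff_smul n (s a) c }
  have h5 := (map_sub L _ _).symm.trans h3
  rw [sub_eq_zero] at h5
  refine h4.symm.trans (h5.trans ?_)
  simp only [map_sum, map_smul, vf_arcCoeff]
  rfl

/-- Loop rotations are generated by `z𝔤(𝒪)`. -/
lemma rotGen_eq_sum (Φ : Frame A) {m : ℕ} {f : Coord A}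
    (hf : ∀ y : zgO A, ConvVanish m (y : Conv A ℂ) → vf y f = 0) :
    rotGen f = ∑ k ∈ Finset.range m, ∑ j, rotCoord Φ k j • vf (Φ.e k j) f := by
  -- The defect of the truncated expansion is a derivation for each m. It vanishes on each generator
  -- for m large, hence on f for m large.
  let D : ℕ → Derivation ℂ (Coord A) (Coord A) := fun m =>
    rotGen - ∑ k ∈ Finset.range m, ∑ j, rotCoord Φ k j • vf (Φ.e k j)
  have hD : ∀ m f, D m f =
      rotGen f - ∑ k ∈ Finset.range m, ∑ j, rotCoord Φ k j • vf (Φ.e k j) f := fun m f => by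
    have hsum : ∀ (ι : Type) (s : Finset ι) (E : ι → Derivation ℂ (Coord A) (Coord A)),
        (∑ i ∈ s, E i) f = ∑ i ∈ s, E i f := fun ι s E =>
      map_sum ({ toFun := fun D => D f, map_zero' := rfl, map_add' := fun _ _ => rfl } :
        Derivation ℂ (Coord A) (Coord A) →+ Coord A) E s
    simp only [D, Derivation.sub_apply, hsum, Derivation.smul_apply]
  have h := eventually_derivation_eq_zero (D := D)
    (fun a n => (Filter.eventually_ge_atTop n).mono fun m hm => by
      rw [hD, sub_eq_zero, rotGen_arcCoeff_eq_sum Φ hm])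
    (Filter.Eventually.of_forall fun m => by
      rw [hD, rotGen_rot, Finset.sum_eq_zero, sub_zero]
      exact fun k _ => Finset.sum_eq_zero fun j _ => by rw [vf_rot, smul_zero]) f
  obtain ⟨M, hM, hm⟩ := (h.and (Filter.eventually_ge_atTop m)).exists
  rw [hD, sub_eq_zero] at hM
  rw [hM]
  -- The expansion is now known for a large order M; its terms with k ≥ m vanish since f is killed
  -- by level m.
  refine (Finset.sum_subset (Finset.range_mono hm) fun k _ hk => ?_).symm
  rw [Finset.mem_range, not_lt] at hk
  exact Finset.sum_eq_zero fun j _ => by rw [hf _ (Φ.convVanish_e hk j), smul_zero]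

end Coord

namespace ExtArcRep

variable {X Y : ExtArcRep.{v} A}

lemma Hom.map_lie (f : Hom X Y) (y : zgO A) (v : X.V) : f.lin ⁅y, v⁆ = ⁅y, f.lin v⁆ := by
  have h := f.comm (DualNumber ℂ) (Coord.tangPt y) (1 ⊗ₜ v)
  rw [X.act_tang, map_add, LinearMap.lTensor_tmul, LinearMap.lTensor_tmul, Y.act_tang] at h
  have h' := congrArg (epsPart Y.V) h
  simp only [map_add, epsPart_one, epsPart_eps, zero_add] at h'
  exact h'

instance (W : Type v) [AddCommGroup W] [Module ℂ W] :
    LieRingModule (zgO A) (Coord A ⊗[ℂ] W) :=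
  instLieRingModuleSubtypeConvComplexMemLieSubalgebraZgOV (cofree A W)

instance (W : Type v) [AddCommGroup W] [Module ℂ W] : LieModule ℂ (zgO A) (Coord A ⊗[ℂ] W) :=
  instLieModuleComplexSubtypeConvMemLieSubalgebraZgOV (cofree A W)

lemma cofree_lie (W : Type v) [AddCommGroup W] [Module ℂ W] (y : zgO A) (z : Coord A ⊗[ℂ] W) :
    ⁅y, z⁆ = ((Coord.vf y : Coord A →ₗ[ℂ] Coord A).rTensor W z : Coord A ⊗[ℂ] W) := by
  change epsPart (Coord A ⊗[ℂ] W) ((cofree A W).act (DualNumber ℂ) (Coord.tangPt y) (1 ⊗ₜ z)) = _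
  rw [cofree_act_tmul, one_smul]
  induction z with
  | zero => simp
  | add a b ha hb => simp only [map_add, ha, hb]
  | tmul f w =>
    rw [LinearMap.rTensor_tmul, AlgHom.toLinearMap_apply, Coord.translate_tangPt_eq,
      TensorProduct.add_tmul, map_add, TensorProduct.assoc_tmul, TensorProduct.assoc_tmul, map_add,
      epsPart_one, epsPart_eps, zero_add]
    rfl

lemma cofree_exists_level (W : Type v) [AddCommGroup W] [Module ℂ W] (z : Coord A ⊗[ℂ] W) :
    ∃ m, ∀ y : zgO A, ConvVanish m (y : Conv A ℂ) → ⁅y, z⁆ = 0 := by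
  simp only [cofree_lie]
  induction z with
  | zero => exact ⟨0, fun y _ => map_zero _⟩
  | add a b ha hb =>
    obtain ⟨m, hm⟩ := ha
    obtain ⟨m', hm'⟩ := hb
    refine ⟨max m m', fun y hy => ?_⟩
    rw [map_add, hm y (hy.mono (le_max_left _ _)), hm' y (hy.mono (le_max_right _ _)), add_zero]
  | tmul f w =>
    obtain ⟨m, hm⟩ := Coord.exists_vf_eq_zero f
    refine ⟨m, fun y hy => ?_⟩
    rw [LinearMap.rTensor_tmul, Derivation.coeFn_coe, hm y hy, TensorProduct.zero_tmul]

/-- Each vector of an algebraic representation is killed by `z^{m+1}𝔤(𝒪)` for some `m`. -/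
lemma exists_level (v : X.V) : ∃ m, ∀ y : zgO A, ConvVanish m (y : Conv A ℂ) → ⁅y, v⁆ = 0 := by
  obtain ⟨m, hm⟩ := cofree_exists_level X.V ((embed X).lin v)
  refine ⟨m, fun y hy => embed_injective X ?_⟩
  rw [Hom.map_lie, hm y hy, map_zero]

end ExtArcRep

end Generation

/-! ### Constant arcs and the description of G(𝒪)-invariants. -/

section Constants

variable {A : Type} [CommRing A] [HopfAlgebra ℂ A]

/-- Constant arcs. -/
def constPt {R : Type} [CommRing R] [Algebra ℂ R] (p : Points A R) : ExtArc A R :=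
  SemidirectProduct.inl (Points.map ((Algebra.ofId R (PowerSeries R)).restrictScalars ℂ) p)

lemma map_constPt {R S : Type} [CommRing R] [Algebra ℂ R] [CommRing S] [Algebra ℂ S]
    (f : R →ₐ[ℂ] S) (p : Points A R) : ExtArc.map f (constPt p) = constPt (Points.map f p) := by
  rw [constPt, ExtArcRep.extMap_inl, constPt]
  congr 1
  apply WithConv.ext; ext a : 1
  exact PowerSeries.map_C (f : R →+* S) (p a)

variable (X : ExtArcRep.{v} A)

/-- The action of `G` on a representation of `G̃_𝒪`. -/
abbrev constRep : Representation ℂ (Points A ℂ) X.V := X.pointRep.comp (constArc A)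

lemma lid_rTensor_act {R : Type} [CommRing R] [Algebra ℂ R] (f : R →ₐ[ℂ] ℂ) (h : ExtArc A R)
    (v : X.V) : TensorProduct.lid ℂ X.V (f.toLinearMap.rTensor X.V (X.act R h (1 ⊗ₜ v))) =
      X.pointRep (ExtArc.map f h) v := by
  rw [X.act_map, LinearMap.rTensor_tmul, AlgHom.toLinearMap_apply, map_one]
  rfl

lemma evT_act_constPt (g : Points A ℂ) (v : X.V) :
    evT (ptEv A) g (X.act A (constPt (toConv (AlgHom.id ℂ A))) (1 ⊗ₜ v)) =
      constRep X g v := by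
  have := lid_rTensor_act X (ptEv A g) (constPt (toConv (AlgHom.id ℂ A))) v
  rw [map_constPt] at this
  exact this

/-- The orbit map of v is represented by the action on v of the universal point of G, the identity
of A viewed as an A-point. -/
lemma isAlg_constRep : IsAlg (ptEv A) (constRep X) := fun v =>
  ⟨_, fun g => (evT_act_constPt X g v).symm⟩

variable {X}

/-- Density gives the identity at the universal point of G, from which it specializes to points in
every algebra R. -/
lemma act_constPt_of_fixed {S : Set (Points A ℂ)} (hS : IsDense (ptEv A) S) {v : X.V}
    (hv : ∀ g ∈ S, constRep X g v = v) {R : Type} [CommRing R] [Algebra ℂ R] (p : Points A R) :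
    X.act R (constPt p) (1 ⊗ₜ v) = 1 ⊗ₜ v := by
  have h : X.act A (constPt (toConv (AlgHom.id ℂ A))) (1 ⊗ₜ v) = 1 ⊗ₜ v :=
    hS.evT_ext fun g hg => by rw [evT_act_constPt, hv g hg]; simp
  have h2 := X.act_map p.ofConv (constPt (toConv (AlgHom.id ℂ A))) (1 ⊗ₜ v)
  rw [h, LinearMap.rTensor_tmul, AlgHom.toLinearMap_apply, map_one, map_constPt] at h2
  exact h2.symm

/-- The value of power series at `0`. -/
def constTerm (R : Type) [CommRing R] [Algebra ℂ R] : PowerSeries R →ₐ[ℂ] R :=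
  { PowerSeries.constantCoeff (R := R) with
    commutes' := fun c => by
      simp [PowerSeries.algebraMap_apply] }

/-- Setting q = 0 in g(qz) gives the constant arc g(0). -/
lemma classify_inl_comp_zeroScale {R : Type} [CommRing R] [Algebra ℂ R] (g : Arc A R) :
    (Coord.classify (SemidirectProduct.inl g : ExtArc A R)).comp Coord.zeroScale =
      Coord.classify (constPt (Points.map (constTerm R) g)) := by
  have h1 : ∀ g : Arc A R, Coord.classify (SemidirectProduct.inl g : ExtArc A R) =
      Coord.lift g 1 := fun g => by
    rw [← Coord.classify_inr_inl, map_one, one_mul]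
  rw [constPt, h1, h1]
  refine Coord.algHom_ext (fun a n => ?_) ?_
  · rw [AlgHom.comp_apply, Coord.zeroScale_apply, Coord.scale_arcCoeff, Polynomial.eval_mul,
      Polynomial.eval_C, Polynomial.eval_pow, Polynomial.eval_X, map_mul, Coord.lift_arcCoeff,
      Coord.lift_arcCoeff]
    change _ = PowerSeries.coeff n (algebraMap R (PowerSeries R) (constTerm R (g a)))
    rw [PowerSeries.algebraMap_apply, PowerSeries.coeff_C]
    split_ifs with h
    · subst h
      rw [pow_zero, map_one, mul_one, PowerSeries.coeff_zero_eq_constantCoeff]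
      rfl
    · rw [zero_pow h, map_zero, mul_zero]
  · rw [AlgHom.comp_apply, Coord.zeroScale_apply, Coord.scale_rot, Polynomial.eval_C,
      Coord.lift_rot, Coord.lift_rot]

/-- An element of `Coord A ⊗ W` killed by `z𝔤(𝒪)` does not depend on the higher coefficients of
the arc. -/
lemma zeroScale_rTensor_eq_self [Algebra.FiniteType ℂ A] {W : Type*} [AddCommGroup W] [Module ℂ W]
    {z : Coord A ⊗[ℂ] W}
    (hz : ∀ y : zgO A, (Coord.vf y : Coord A →ₗ[ℂ] Coord A).rTensor W z = 0) :
    (Coord.zeroScale (A := A)).toLinearMap.rTensor W z = z := by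
  have Φ : Frame A := Classical.arbitrary _
  have h : ∀ (l : W →ₗ[ℂ] ℂ) (D : Coord A →ₗ[ℂ] Coord A) (z : Coord A ⊗[ℂ] W),
      TensorProduct.rid ℂ _ (l.lTensor _ (D.rTensor W z)) =
        D (TensorProduct.rid ℂ _ (l.lTensor _ z)) := fun l D z => by
    induction z with
    | zero => simp
    | add a b ha hb => simp only [map_add, ha, hb]
    | tmul f w => simp
  refine sub_eq_zero.1 (tensor_eq_zero_of_dual _ fun l => ?_)
  rw [map_sub, map_sub, h, sub_eq_zero]
  refine Coord.zeroScale_eq_self ?_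
  -- Every element of z𝔤(𝒪) vanishes modulo z, so level 0 means being killed by all of z𝔤(𝒪); the
  -- sum expressing `rotGen` is then empty.
  rw [Coord.rotGen_eq_sum Φ (m := 0) fun y _ => ?_, Finset.sum_range_zero]
  have := h l (Coord.vf y) z
  rw [hz, map_zero, map_zero] at this
  exact this.symm

namespace ExtArcRep

/-- The invariants of `G(𝒪)` are the vectors killed by `z𝔤(𝒪)` and fixed by `G`. -/
lemma mem_inv_iff [Algebra.FiniteType ℂ A] {S : Set (Points A ℂ)} (hS : IsDense (ptEv A) S)
    {v : X.V} : v ∈ X.inv ↔ (∀ y : zgO A, ⁅y, v⁆ = 0) ∧ ∀ g, constRep X g v = v := by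
  refine ⟨fun hv => ⟨fun y => ?_, fun g => ?_⟩, fun ⟨h1, h2⟩ R _ _ g => ?_⟩
  · have h := hv (DualNumber ℂ) (tang DualNumber.eps DualNumber.eps_mul_eps y)
    change epsPart X.V _ = 0
    rw [h, epsPart_one]
  · have h := congrArg (TensorProduct.lid ℂ X.V) (hv ℂ
      (Points.map (Algebra.ofId ℂ (PowerSeries ℂ)) g))
    rw [TensorProduct.lid_tmul, one_smul] at h
    exact h
  -- The coaction of v is a function killed by z𝔤(𝒪), hence depends on the constant term of the arc
  -- only: an arc acts on v as its value at z = 0, under which v is fixed.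
  · have h3 : (Coord.zeroScale (A := A)).toLinearMap.rTensor X.V (X.coaction v) = X.coaction v :=
      zeroScale_rTensor_eq_self fun y => by
        rw [← cofree_lie]
        have := Hom.map_lie (embed X) y v
        rw [h1, map_zero, embed, Hom.toCofree_apply, LinearMap.lTensor_id_apply] at this
        exact this.symm
    rw [X.act_one_tmul, ← h3, ← LinearMap.comp_apply, ← LinearMap.rTensor_comp,
      ← AlgHom.comp_toLinearMap, classify_inl_comp_zeroScale, ← X.act_one_tmul,
      act_constPt_of_fixed hS fun g _ => h2 g]

end ExtArcRep

end Constants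

/-! ### Algebraicity of the action of loop rotations. -/

section Rotations

open LaurentPolynomial

/-- Evaluation of Laurent polynomials. -/
def unitEv (t : ℂˣ) : ℂ[T;T⁻¹] →ₐ[ℂ] ℂ :=
  { LaurentPolynomial.eval₂ (RingHom.id ℂ) t with
    commutes' := fun c => by
      simp [← LaurentPolynomial.C_eq_algebraMap] }

lemma unitEv_T (t : ℂˣ) (n : ℤ) : unitEv t (T n) = (t ^ n : ℂˣ) :=
  LaurentPolynomial.eval₂_T _ _ _

/-- Multiplied by a power of T, a Laurent polynomial becomes a polynomial; vanishing on ℂ^* gives it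
infinitely many roots. -/
lemma unitEv_isDense : IsDense unitEv Set.univ := by
  intro p hp
  obtain ⟨n, q, hq⟩ := exists_T_pow p
  have h : q = 0 := by
    refine Polynomial.eq_zero_of_infinite_isRoot q
      ((Set.finite_singleton (0 : ℂ)).infinite_compl.mono fun t ht => ?_)
    have h1 := hp (Units.mk0 t ht) (Set.mem_univ _)
    have h2 : unitEv (Units.mk0 t ht) (Polynomial.toLaurent q) = q.eval t :=
      LaurentPolynomial.eval₂_toLaurent _ _ _
    rw [hq, map_mul, h1, zero_mul] at h2
    exact h2.symm
  rw [h, map_zero] at hq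
  calc p = p * T n * T (-n) := by rw [mul_assoc, ← T_add]; simp
    _ = 0 := by rw [← hq, zero_mul]

variable {A : Type} [CommRing A] [HopfAlgebra ℂ A] (X : ExtArcRep.{v} A)

/-- The action of loop rotations on a representation of `G̃_𝒪`. -/
abbrev rotRep : Representation ℂ ℂˣ X.V := X.pointRep.comp SemidirectProduct.inr

lemma isAlg_rotRep : IsAlg unitEv (rotRep X) := fun v => by
  let u : (ℂ[T;T⁻¹])ˣ := ⟨T 1, T (-1), by rw [← T_add]; simp, by rw [← T_add]; simp⟩
  refine ⟨X.act _ (SemidirectProduct.inr u) (1 ⊗ₜ v), fun t => ?_⟩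
  have h := lid_rTensor_act X (unitEv t) (SemidirectProduct.inr u) v
  refine Eq.trans ?_ h.symm
  have : ExtArc.map (unitEv t) (SemidirectProduct.inr u) =
      (SemidirectProduct.inr t : ExtArc A ℂ) := by
    rw [← mul_one (SemidirectProduct.inr u), ← map_one SemidirectProduct.inl, Coord.map_inr_inl,
      map_one, map_one, mul_one]
    congr 1
    ext
    exact (unitEv_T t 1).trans (by simp)
  rw [this]
  rfl

end Rotations

/-! ### Inflated forms are determined by finitely many values. -/

section Expansion

variable {A : Type} [CommRing A] [HopfAlgebra ℂ A] {M : Type*} [AddCommGroup M] [Module ℂ M]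

/-- Alternating forms inflated from the quotient of `z𝔤(𝒪)` by `z^{m+1}𝔤(𝒪)`. -/
def Inflated {n : ℕ} (m : ℕ) (ω : zgO A [⋀^Fin n]→ₗ[ℂ] M) : Prop :=
  ∀ v, (∃ i, ConvVanish m (v i : Conv A ℂ)) → ω v = 0

lemma Inflated.curryLeft {n m : ℕ} {ω : zgO A [⋀^Fin (n + 1)]→ₗ[ℂ] M} (h : Inflated m ω)
    (x : zgO A) : Inflated m (ω.curryLeft x) := fun v ⟨i, hi⟩ =>
  h _ ⟨i.succ, by simpa using hi⟩

lemma Inflated.mono {n m m' : ℕ} {ω : zgO A [⋀^Fin n]→ₗ[ℂ] M} (h : Inflated m ω) (hm : m ≤ m') :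
    Inflated m' ω := fun v ⟨i, hi⟩ => h v ⟨i, hi.mono hm⟩

variable (Φ : Frame A)

/-- The arguments are replaced by their truncations one at a time; each replacement changes an
argument by an element vanishing modulo zᵐ⁺¹. -/
lemma Inflated.apply_trunc {n m : ℕ} {ω : zgO A [⋀^Fin n]→ₗ[ℂ] M} (h : Inflated m ω)
    (v : Fin n → zgO A) : ω v = ω fun i => Φ.trunc m (v i) := by
  have key : ∀ s : Finset (Fin n), ω (s.piecewise (fun i => Φ.trunc m (v i)) v) = ω v := by
    intro s
    induction s using Finset.induction_on with
    | empty => simp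
    | insert i s hi ih =>
      rw [Finset.piecewise_insert, ← ih]
      have h1 : ω (Function.update (s.piecewise (fun i => Φ.trunc m (v i)) v) i
          (v i - Φ.trunc m (v i))) = 0 :=
        h _ ⟨i, by rw [Function.update_self]; exact Φ.convVanish_sub_trunc m (v i)⟩
      rw [AlternatingMap.map_update_sub, sub_eq_zero] at h1
      rw [← h1]
      congr 1
      rw [Function.update_eq_self_iff, Finset.piecewise_eq_of_notMem _ _ _ hi]
  rw [← key Finset.univ]
  simp

/-- An inflated form is determined by its values on the elements `z^{k+1} ξⱼ`. -/
lemma Inflated.apply_eq_sum {n m : ℕ} {ω : zgO A [⋀^Fin n]→ₗ[ℂ] M} (h : Inflated m ω)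
    (v : Fin n → zgO A) : ω v = ∑ t : Fin n → Fin m × Fin Φ.r,
      (∏ i, Φ.coord (t i).1 (t i).2 (v i)) • ω fun i => Φ.e (t i).1 (t i).2 := by
  have h1 : ∀ x, Φ.trunc m x = ∑ p : Fin m × Fin Φ.r, Φ.coord p.1 p.2 x • Φ.e p.1 p.2 :=
    fun x => by rw [Frame.trunc, Finset.sum_range, Fintype.sum_prod_type]
  rw [h.apply_trunc Φ]
  simp only [h1]
  have h2 := ω.toMultilinearMap.map_sum
    (fun i (p : Fin m × Fin Φ.r) => Φ.coord p.1 p.2 (v i) • Φ.e p.1 p.2)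
  refine h2.trans (Finset.sum_congr rfl fun t _ => ?_)
  exact ω.toMultilinearMap.map_smul_univ _ _

/-- All values are combinations of the finitely many values on frame elements, each of which has a
level; so the second condition in `IsLevel` comes for free after enlarging m. -/
lemma Inflated.exists_isLevel [Algebra.FiniteType ℂ A] {X : ExtArcRep.{v} A} {n m : ℕ}
    {ω : zgO A [⋀^Fin n]→ₗ[ℂ] X.V} (h : Inflated m ω) : ∃ m', IsLevel X m' ω := by
  have Φ : Frame A := Classical.arbitrary _
  choose l hl using fun t : Fin n → Fin m × Fin Φ.r =>
    X.exists_level (ω fun i => Φ.e (t i).1 (t i).2)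
  refine ⟨max m (Finset.univ.sup l), h.mono (le_max_left _ _), fun y hy v => ?_⟩
  rw [h.apply_eq_sum Φ, lie_sum]
  refine Finset.sum_eq_zero fun t _ => ?_
  rw [lie_smul, hl t y (hy.mono ((Finset.le_sup (Finset.mem_univ t)).trans (le_max_right _ _))),
    smul_zero]

end Expansion

/-! ### Continuous forms as algebraic representations. -/

section ContinuousForms

variable {A : Type} [CommRing A] [HopfAlgebra ℂ A] (X Y : ExtArcRep.{v} A)

/-- Forms of level `m`. -/
def levelForms (n m : ℕ) : Submodule ℂ (zgO A [⋀^Fin n]→ₗ[ℂ] X.V) where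
  carrier := {ω | IsLevel X m ω}
  zero_mem' := by simp [IsLevel]
  add_mem' h h' := h.add h'
  smul_mem' c _ h := h.smul c

/-- Continuous alternating forms on `z𝔤(𝒪)`. -/
def forms (n : ℕ) : Submodule ℂ (zgO A [⋀^Fin n]→ₗ[ℂ] X.V) where
  carrier := {ω | ∃ m, IsLevel X m ω}
  zero_mem' := ⟨0, by simp [IsLevel]⟩
  add_mem' := fun ⟨m, hm⟩ ⟨m', hm'⟩ =>
    ⟨max m m', (hm.mono (le_max_left _ _)).add (hm'.mono (le_max_right _ _))⟩
  smul_mem' := fun c _ ⟨m, hm⟩ => ⟨m, hm.smul c⟩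

/-- The action of the complex points of `G̃_𝒪` on continuous forms. -/
def formsRep (n : ℕ) : Representation ℂ (ExtArc A ℂ) (forms X n) where
  toFun h := (cochainRep X n h).restrict fun _ ⟨m, hm⟩ => ⟨m, hm.cochainRep h⟩
  map_one' := by ext ω : 2; simp
  map_mul' g h := by ext ω : 2; simp

/-- The Chevalley-Eilenberg differential on continuous forms. -/
def formsD (n : ℕ) : forms X n →ₗ[ℂ] forms X (n + 1) :=
  (ceD (zgO A) X.V n).restrict fun _ ⟨m, hm⟩ => ⟨m, hm.ceD⟩

lemma formsD_formsRep (n : ℕ) (h : ExtArc A ℂ) (ω : forms X n) :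
    formsD X n (formsRep X n h ω) = formsRep X (n + 1) h (formsD X n ω) :=
  Subtype.ext (ceD_cochainRep X n h ω)

variable {X Y}

lemma ExtArcRep.Hom.isLevel_comp (f : ExtArcRep.Hom X Y) {n m : ℕ}
    {ω : zgO A [⋀^Fin n]→ₗ[ℂ] X.V} (hω : IsLevel X m ω) :
    IsLevel Y m (f.lin.compAlternatingMap ω) :=
  ⟨fun v hv => by rw [LinearMap.compAlternatingMap_apply, hω.1 v hv, map_zero],
    fun y hy v => by
      rw [LinearMap.compAlternatingMap_apply, ← f.map_lie, hω.2 y hy v, map_zero]⟩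

lemma ExtArcRep.Hom.ceD_comp (f : ExtArcRep.Hom X Y) {n : ℕ} (ω : zgO A [⋀^Fin n]→ₗ[ℂ] X.V) :
    ceD (zgO A) Y.V n (f.lin.compAlternatingMap ω) =
      f.lin.compAlternatingMap (ceD (zgO A) X.V n ω) := by
  ext v
  simp only [LinearMap.compAlternatingMap_apply, ceD_apply, map_sum, map_zsmul, map_sub,
    f.map_lie]

lemma ExtArcRep.Hom.cochainRep_comp (f : ExtArcRep.Hom X Y) {n : ℕ} (h : ExtArc A ℂ)
    (ω : zgO A [⋀^Fin n]→ₗ[ℂ] X.V) :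
    cochainRep Y n h (f.lin.compAlternatingMap ω) =
      f.lin.compAlternatingMap (cochainRep X n h ω) := by
  ext v
  simp only [LinearMap.compAlternatingMap_apply, cochainRep_apply, f.map_pointRep]

/-- Functoriality of continuous forms in the coefficients. -/
def formsMap (f : ExtArcRep.Hom X Y) (n : ℕ) : forms X n →ₗ[ℂ] forms Y n where
  toFun ω := ⟨f.lin.compAlternatingMap ω, let ⟨m, hm⟩ := ω.2; ⟨m, f.isLevel_comp hm⟩⟩
  map_add' ω η := by ext v; simp
  map_smul' c ω := by ext v; simp

lemma formsMap_formsRep (f : ExtArcRep.Hom X Y) (n : ℕ) (h : ExtArc A ℂ) (ω : forms X n) :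
    formsMap f n (formsRep X n h ω) = formsRep Y n h (formsMap f n ω) :=
  Subtype.ext (f.cochainRep_comp h (ω : zgO A [⋀^Fin n]→ₗ[ℂ] X.V)).symm

/-- The representation on continuous forms is algebraic as soon as the representation on the
coefficients and the coordinates of the adjoint action are. -/
lemma isAlg_formsRep [Algebra.FiniteType ℂ A] {Γ B : Type*} [Group Γ] [CommRing B] [Algebra ℂ B]
    {ev : Γ → (B →ₐ[ℂ] ℂ)} {S : Set Γ} (hS : IsDense ev S) (φ : Γ →* ExtArc A ℂ)
    (h1 : IsAlg ev (X.pointRep.comp φ))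
    (h2 : ∀ x a k, IsReg ev fun g => PowerSeries.coeff k ((Ad A (φ g)⁻¹ x : Conv A ℂ) a)) (n : ℕ) :
    IsAlg ev ((formsRep X n).comp φ) := by
  have Φ : Frame A := Classical.arbitrary _
  rintro ⟨ω, m, hω⟩
  -- Evaluation on frame elements embeds forms of level m into a finite power of V, where regularity
  -- can be checked entry by entry.
  let E : levelForms X n m →ₗ[ℂ] ((Fin n → Fin m × Fin Φ.r) → X.V) :=
    { toFun := fun ω s => (ω : zgO A [⋀^Fin n]→ₗ[ℂ] X.V) fun i => Φ.e (s i).1 (s i).2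
      map_add' := fun ω η => rfl
      map_smul' := fun c ω => rfl }
  have hE : Function.Injective E := (injective_iff_map_eq_zero E).2 fun ω hω => by
    refine Subtype.ext (AlternatingMap.ext fun v => ?_)
    have h3 : Inflated m (ω : zgO A [⋀^Fin n]→ₗ[ℂ] X.V) := ω.2.1
    rw [h3.apply_eq_sum Φ]
    refine Finset.sum_eq_zero fun t _ => ?_
    rw [show (ω : zgO A [⋀^Fin n]→ₗ[ℂ] X.V) (fun i => Φ.e (t i).1 (t i).2) = 0 from
      congrFun hω t, smul_zero]
  let I : levelForms X n m →ₗ[ℂ] forms X n := Submodule.inclusion fun ω hω => ⟨m, hω⟩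
  have hreg : IsReg ev fun g => (⟨cochainRep X n (φ g) ω, hω.cochainRep (φ g)⟩ :
      levelForms X n m) := by
    refine IsReg.of_injective hS E hE (IsReg.pi fun s => ?_)
    -- Each entry is a finite sum of products of adjoint coordinates with orbit maps in V, both
    -- regular by hypothesis.
    have h3 : ∀ g, E ⟨cochainRep X n (φ g) ω, hω.cochainRep (φ g)⟩ s =
        ∑ t : Fin n → Fin m × Fin Φ.r,
          (∏ i, Φ.coord (t i).1 (t i).2 (Ad A (φ g)⁻¹ (Φ.e (s i).1 (s i).2))) •
            X.pointRep (φ g) (ω fun i => Φ.e (t i).1 (t i).2) := fun g => by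
      change cochainRep X n (φ g) ω _ = _
      have h4 : Inflated m ω := hω.1
      rw [cochainRep_apply, h4.apply_eq_sum Φ, map_sum]
      exact Finset.sum_congr rfl fun t _ => map_smul _ _ _
    simp only [h3]
    exact IsReg.sum _ fun t _ => (IsReg.prod _ fun i _ => h2 _ _ _).smul (h1 _)
  exact hreg.comp I

section AdjointCoordinates

variable {Γ B : Type*} [CommRing B] [Algebra ℂ B] {ev : Γ → (B →ₐ[ℂ] ℂ)}

lemma isReg_convMul {x y : Γ → Conv A ℂ} (hx : ∀ a k, IsReg ev fun g => PowerSeries.coeff k (x g a))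
    (hy : ∀ a k, IsReg ev fun g => PowerSeries.coeff k (y g a)) (a : A) (k : ℕ) :
    IsReg ev fun g => PowerSeries.coeff k ((x g * y g) a) := by
  have h : ∀ g, PowerSeries.coeff k ((x g * y g) a) = ∑ i ∈ (ℛ ℂ a).index,
      ∑ p ∈ Finset.HasAntidiagonal.antidiagonal k, PowerSeries.coeff p.1 (x g ((ℛ ℂ a).left i)) *
        PowerSeries.coeff p.2 (y g ((ℛ ℂ a).right i)) := fun g => by
    rw [(ℛ ℂ a).convMul_apply, map_sum]
    exact Finset.sum_congr rfl fun i _ => PowerSeries.coeff_mul _ _ _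
  simp only [h]
  exact IsReg.sum _ fun i _ => IsReg.sum _ fun p _ => (hx _ _).smul (hy _ _)

lemma isReg_ad_constArc (x : zgO A) (a : A) (k : ℕ) :
    IsReg (ptEv A) fun g => PowerSeries.coeff k ((Ad A (constArc A g)⁻¹ x : Conv A ℂ) a) := by
  have h0 : ∀ (p : Points A ℂ) (b : A) (n : ℕ), PowerSeries.coeff n
      (Points.map (Algebra.ofId ℂ (PowerSeries ℂ)) p b) = if n = 0 then p b else 0 :=
    fun p b n => PowerSeries.coeff_C _ _
  have h1 : ∀ g : Points A ℂ, (Ad A (constArc A g)⁻¹ x : Conv A ℂ) =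
      lin (Points.map (Algebra.ofId ℂ (PowerSeries ℂ)) g⁻¹) * x *
        lin (Points.map (Algebra.ofId ℂ (PowerSeries ℂ)) g) := fun g => by
    have h2 : convMap (rescaleHom (((1 : ℂˣ) : ℂ) ^ 2)) (x : Conv A ℂ) = x := by
      apply WithConv.ext; ext a n
      simp [convMap, rescaleHom]
    rw [← map_inv]
    change lin (Points.map (Algebra.ofId ℂ (PowerSeries ℂ)) g⁻¹) *
      convMap (rescaleHom (((1 : ℂˣ) : ℂ) ^ 2)) (x : Conv A ℂ) *
        lin (Points.map (Algebra.ofId ℂ (PowerSeries ℂ)) g⁻¹)⁻¹ = _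
    rw [h2, ← map_inv, inv_inv]
  simp only [h1]
  refine isReg_convMul (isReg_convMul (fun b n => ?_) fun b n => isReg_const _ _) (fun b n => ?_) a k
  · simp only [lin_apply, h0, points_inv_apply]
    split_ifs
    · exact isReg_of_eval (HopfAlgebra.antipode ℂ b) fun g => rfl
    · exact isReg_const _ _
  · simp only [lin_apply, h0]
    split_ifs
    · exact isReg_of_eval b fun g => rfl
    · exact isReg_const _ _

lemma isReg_ad_inr (x : zgO A) (a : A) (k : ℕ) : IsReg unitEv fun t : ℂˣ =>
    PowerSeries.coeff k ((Ad A (SemidirectProduct.inr t)⁻¹ x : Conv A ℂ) a) := by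
  have h1 : ∀ t : ℂˣ, PowerSeries.coeff k ((Ad A (SemidirectProduct.inr t)⁻¹ x : Conv A ℂ) a) =
      -- The inverse rotation scales zᵏ by t to the power -2k, the factor 2 coming from the double
      -- cover.
      unitEv t (LaurentPolynomial.T (-(2 * k))) • PowerSeries.coeff k ((x : Conv A ℂ) a) :=
    fun t => by
      rw [← map_inv, unitEv_T]
      change PowerSeries.coeff k ((lin 1 * convMap (rescaleHom (((t⁻¹ : ℂˣ) : ℂ) ^ 2))
        (x : Conv A ℂ) * lin 1⁻¹ : Conv A ℂ) a) = _
      rw [inv_one, map_one, one_mul, mul_one, convMap_apply]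
      simp [rescaleHom, zpow_mul, ← pow_mul]
  simp only [h1]
  exact (isReg_of_eval _ fun t => rfl).smul (isReg_const _ _)

end AdjointCoordinates

variable (X)

lemma isAlg_formsRep_constArc [Algebra.FiniteType ℂ A] {S : Set (Points A ℂ)}
    (hS : IsDense (ptEv A) S) (n : ℕ) : IsAlg (ptEv A) ((formsRep X n).comp (constArc A)) :=
  isAlg_formsRep hS (constArc A) (isAlg_constRep X) isReg_ad_constArc n

lemma isAlg_formsRep_inr [Algebra.FiniteType ℂ A] (n : ℕ) :
    IsAlg unitEv ((formsRep X n).comp SemidirectProduct.inr) :=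
  isAlg_formsRep unitEv_isDense SemidirectProduct.inr (isAlg_rotRep X) isReg_ad_inr n

end ContinuousForms

/-! ### The Reynolds operator. -/

section Averaging

variable {A : Type} [CommRing A] [HopfAlgebra ℂ A] [Algebra.FiniteType ℂ A]

/-- The Reynolds operator on continuous forms. -/
lemma exists_average (hG : IsReductive A) :
    ∃ P : ∀ (X : ExtArcRep.{v} A) (n : ℕ), forms X n →ₗ[ℂ] forms X n,
      (∀ X n ω, (P X n ω : zgO A [⋀^Fin n]→ₗ[ℂ] X.V) ∈ ceInv X n) ∧
      (∀ X n (ω : forms X n), (ω : zgO A [⋀^Fin n]→ₗ[ℂ] X.V) ∈ ceInv X n → P X n ω = ω) ∧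
      (∀ X n ω, P X (n + 1) (formsD X n ω) = formsD X n (P X n ω)) ∧
      ∀ (X Y : ExtArcRep.{v} A) (f : ExtArcRep.Hom X Y) n ω,
        P Y n (formsMap f n ω) = formsMap f n (P X n ω) := by
  obtain ⟨K, hK, l, hl1, hl⟩ := exists_invariant_integral hG
  refine ⟨fun X n => (isAlg_formsRep_constArc X hK n).transform hK l, fun X n ω => ⟨?_, fun g => ?_⟩,
    fun X n ω hω => ?_, fun X n ω => ?_, fun X Y f n ω => ?_⟩
  · exact ((isAlg_formsRep_constArc X hK n).transform hK l ω).2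
  -- Invariance of the integral gives invariance under K; Zariski density of K extends it to all of
  -- G.
  · refine congrArg Subtype.val (IsAlg.fixed_of_dense hK (isAlg_formsRep_constArc X hK n)
      (fun k hk => ?_) g)
    have := IsAlg.map_transform hK (isAlg_formsRep_constArc X hK n) l (k := k) (leftTr k)
      (fun g b => ptEv_leftTr k g b) 1 (fun b => by rw [hl k hk, one_mul]) ω
    rwa [one_smul] at this
  · rw [IsAlg.transform_of_fixed hK _ l (fun g => Subtype.ext (hω.2 g)), hl1, one_smul]
  · exact IsAlg.transform_map hK (isAlg_formsRep_constArc X hK n)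
      (isAlg_formsRep_constArc X hK (n + 1)) l (formsD X n)
      (fun g ω => formsD_formsRep X n (constArc A g) ω) ω
  · exact IsAlg.transform_map hK (isAlg_formsRep_constArc X hK n)
      (isAlg_formsRep_constArc Y hK n) l (formsMap f n)
      (fun g ω => formsMap_formsRep f n (constArc A g) ω) ω

end Averaging

/-! ### Exactness of invariant continuous forms in the coefficients. -/

section Exactness

variable {A : Type} [CommRing A] [HopfAlgebra ℂ A] {X Y Z : ExtArcRep.{v} A}

/-- Functoriality of invariant forms in the coefficients. -/
def ceInvMap (f : ExtArcRep.Hom X Y) (n : ℕ) : ceInv X n →ₗ[ℂ] ceInv Y n where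
  toFun ω := ⟨f.lin.compAlternatingMap ω, (formsMap f n ⟨ω, ω.2.1⟩).2, fun g => by
    rw [f.cochainRep_comp, ω.2.2]⟩
  map_add' ω η := by ext v; simp
  map_smul' c ω := by ext v; simp

lemma ceInvMap_injective (f : ExtArcRep.Hom X Y) (hf : Function.Injective f.lin) (n : ℕ) :
    Function.Injective (ceInvMap f n) := fun ω η h => by
  refine Subtype.ext (AlternatingMap.ext fun v => hf ?_)
  exact congrArg (fun ω : ceInv Y n => (ω : zgO A [⋀^Fin n]→ₗ[ℂ] Y.V) v) h

/-- A form with values in the image of `f` is pulled back by a linear retraction. The retraction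
need not be equivariant: invariance of the pulled back form can be tested after applying the
injective `f`. -/
lemma ceInvMap_exact [Algebra.FiniteType ℂ A] (f : ExtArcRep.Hom X Y) (g : ExtArcRep.Hom Y Z)
    (hf : Function.Injective f.lin) (hfg : Function.Exact f.lin g.lin) (n : ℕ) :
    Function.Exact (ceInvMap f n) (ceInvMap g n) := by
  refine fun ω => ⟨fun h => ?_, ?_⟩
  · obtain ⟨r, hr⟩ := LinearMap.exists_leftInverse_of_injective f.lin (LinearMap.ker_eq_bot.2 hf)
    have h1 : f.lin.compAlternatingMap (r.compAlternatingMap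
        (ω : zgO A [⋀^Fin n]→ₗ[ℂ] Y.V)) = ω := by
      ext v
      have h2 : g.lin ((ω : zgO A [⋀^Fin n]→ₗ[ℂ] Y.V) v) = 0 :=
        congrArg (fun ω : ceInv Z n => (ω : zgO A [⋀^Fin n]→ₗ[ℂ] Z.V) v) h
      obtain ⟨x, hx⟩ := (hfg _).1 h2
      simp only [LinearMap.compAlternatingMap_apply, ← hx]
      rw [← LinearMap.comp_apply r, hr, LinearMap.id_apply]
    obtain ⟨m, hm⟩ := ω.2.1
    have h3 : Inflated m (r.compAlternatingMap (ω : zgO A [⋀^Fin n]→ₗ[ℂ] Y.V)) := fun v hv => by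
      rw [LinearMap.compAlternatingMap_apply, hm.1 v hv, map_zero]
    refine ⟨⟨r.compAlternatingMap (ω : zgO A [⋀^Fin n]→ₗ[ℂ] Y.V), h3.exists_isLevel,
      fun k => ?_⟩, Subtype.ext h1⟩
    have h4 := f.cochainRep_comp (constArc A k) (r.compAlternatingMap
        (ω : zgO A [⋀^Fin n]→ₗ[ℂ] Y.V))
    rw [h1, ω.2.2] at h4
    exact AlternatingMap.ext fun v => hf
      (congrArg (fun η : zgO A [⋀^Fin n]→ₗ[ℂ] Y.V => η v) (h4.symm.trans h1.symm))
  · rintro ⟨η, rfl⟩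
    refine Subtype.ext (AlternatingMap.ext fun v => ?_)
    exact hfg.apply_apply_eq_zero _

/-- A linear section of `g` lifts the form, possibly losing invariance; averaging restores it, and
commutes with `g` while fixing the given invariant form. This is where reductivity enters exactness.
-/
lemma ceInvMap_surjective [Algebra.FiniteType ℂ A] (hG : IsReductive A) (g : ExtArcRep.Hom Y Z)
    (hg : Function.Surjective g.lin) (n : ℕ) : Function.Surjective (ceInvMap g n) := by
  rintro ⟨ω, hω⟩
  obtain ⟨s, hs⟩ := g.lin.exists_rightInverse_of_surjective (LinearMap.range_eq_top.2 hg)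
  obtain ⟨P, hP, hP', -, hPf⟩ := exists_average.{v} hG
  obtain ⟨m, hm⟩ := hω.1
  have h1 : Inflated m (s.compAlternatingMap ω) := fun v hv => by
    rw [LinearMap.compAlternatingMap_apply, hm.1 v hv, map_zero]
  refine ⟨⟨_, hP Y n ⟨s.compAlternatingMap ω, h1.exists_isLevel⟩⟩, Subtype.ext ?_⟩
  have h2 := hPf Y Z g n ⟨s.compAlternatingMap ω, h1.exists_isLevel⟩
  have h3 : formsMap g n ⟨s.compAlternatingMap ω, h1.exists_isLevel⟩ = ⟨ω, hω.1⟩ := by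
    refine Subtype.ext (AlternatingMap.ext fun v => ?_)
    exact congrArg (fun h : Z.V →ₗ[ℂ] Z.V => h (ω v)) hs
  rw [h3, hP' Z n ⟨ω, hω.1⟩ hω] at h2
  exact (congrArg Subtype.val h2).symm

end Exactness

/-! ### Rotation and z𝔤(𝒪) acting on cofree modules. -/

section Operators

variable {A : Type} [CommRing A] [HopfAlgebra ℂ A] {W : Type v} [AddCommGroup W] [Module ℂ W]

lemma lie_smul_coord (y : zgO A) (h : Coord A) (z : Coord A ⊗[ℂ] W) :
    ⁅y, h • z⁆ = Coord.vf y h • z + h • ⁅y, z⁆ := by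
  simp only [ExtArcRep.cofree_lie]
  induction z with
  | zero => simp
  | add a b ha hb => simp only [smul_add, map_add, ha, hb]; abel
  | tmul f w =>
    simp only [TensorProduct.smul_tmul', LinearMap.rTensor_tmul, Derivation.coeFn_coe,
      ← TensorProduct.add_tmul, smul_eq_mul, Derivation.leibniz]
    rw [add_comm, mul_comm f]

variable (A W) in
/-- The generator of loop rotations on `Coord A ⊗ W`. -/
def rotAct : Module.End ℂ (Coord A ⊗[ℂ] W) :=
  (Coord.rotGen (A := A) : Coord A →ₗ[ℂ] Coord A).rTensor W

lemma lie_rotAct (y : zgO A) (z : Coord A ⊗[ℂ] W) :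
    ⁅y, rotAct A W z⁆ = rotAct A W ⁅y, z⁆ + ⁅zgEuler A y, z⁆ := by
  simp only [ExtArcRep.cofree_lie, rotAct]
  induction z with
  | zero => simp
  | add a b ha hb => simp only [map_add, ha, hb]; abel
  | tmul f w =>
    simp only [LinearMap.rTensor_tmul, Derivation.coeFn_coe, Coord.vf_rotGen,
      TensorProduct.add_tmul]

lemma rotAct_eq_sum (Φ : Frame A) {m : ℕ} {z : Coord A ⊗[ℂ] W}
    (hz : ∀ y : zgO A, ConvVanish m (y : Conv A ℂ) → ⁅y, z⁆ = 0) :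
    rotAct A W z = ∑ k ∈ Finset.range m, ∑ j, Coord.rotCoord Φ k j • ⁅Φ.e k j, z⁆ := by
  simp only [ExtArcRep.cofree_lie, rotAct] at hz ⊢
  have h : ∀ (l : W →ₗ[ℂ] ℂ) (D : Coord A →ₗ[ℂ] Coord A) (z : Coord A ⊗[ℂ] W),
      TensorProduct.rid ℂ _ (l.lTensor _ (D.rTensor W z)) =
        D (TensorProduct.rid ℂ _ (l.lTensor _ z)) := fun l D z => by
    induction z with
    | zero => simp
    | add a b ha hb => simp only [map_add, ha, hb]
    | tmul f w => simp
  have h' : ∀ (l : W →ₗ[ℂ] ℂ) (c : Coord A) (z : Coord A ⊗[ℂ] W),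
      TensorProduct.rid ℂ _ (l.lTensor _ (c • z)) =
        c • (TensorProduct.rid ℂ _ (l.lTensor _ z)) := fun l c z => by
    induction z with
    | zero => simp
    | add a b ha hb => simp only [map_add, smul_add, ha, hb]
    | tmul f w => simp [TensorProduct.smul_tmul']
  refine sub_eq_zero.1 (tensor_eq_zero_of_dual _ fun l => ?_)
  simp only [map_sub, map_sum, h, h']
  rw [sub_eq_zero]
  refine Coord.rotGen_eq_sum Φ fun y hy => ?_
  have := h l (Coord.vf y) z
  rw [hz y hy, map_zero, map_zero] at this
  exact this.symm

/-- The transformation law of the coordinates of the generator of loop rotations. -/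
lemma vf_rotCoord (Φ : Frame A) (y : zgO A) {m k : ℕ} (hk : k < m) (j : Fin Φ.r) :
    Coord.vf y (Coord.rotCoord Φ k j) + ∑ k' ∈ Finset.range m, ∑ j',
      Coord.rotCoord Φ k' j' * algebraMap ℂ _ (Φ.coord k j ⁅y, Φ.e k' j'⁆) =
      algebraMap ℂ _ (Φ.coord k j (zgEuler A y)) := by
  let L : Conv A (Coord A) →ₗ[Coord A] Coord A :=
    { toFun := fun s => PowerSeries.coeff (k + 1) (s (Φ.α j))
      map_add' := fun s t => map_add _ _ _
      map_smul' := fun c s => PowerSeries.coeff_smul (k + 1) (s (Φ.α j)) c }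
  have hL : ∀ x : zgO A, L (convBase (Coord A) (x : Conv A ℂ)) =
      algebraMap ℂ _ (Φ.coord k j x) := fun x => coeff_psBase _ _ _
  have hv := Φ.convVanish_sub_sum m (Coord.rotField A) (logDer_leibniz _ _) (coeff_zero_logDer _)
  set s := ∑ k ∈ Finset.range m, ∑ j, PowerSeries.coeff (k + 1) (Coord.rotField A (Φ.α j)) •
    convBase (Coord A) (Φ.e k j : Conv A ℂ) with hs
  have h1 : L (convDer (psDer (Coord.vf y)) (Coord.rotField A)) =
      Coord.vf y (Coord.rotCoord Φ k j) :=
    coeff_psDer (Coord.vf y) (k + 1) (Coord.rotField A (Φ.α j))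
  -- Since k < m, the coefficient of zᵏ⁺¹ sees its argument only modulo zᵐ⁺¹, where Θ agrees with
  -- its finite expansion.
  have h2 : ∀ u : Conv A (Coord A), L (Coord.rotField A * u) = L (s * u) := fun u => by
    rw [← sub_eq_zero, ← map_sub, ← sub_mul]
    exact ConvVanish.mul (Or.inl hv) _ _ hk
  have h3 : ∀ u : Conv A (Coord A), L (u * Coord.rotField A) = L (u * s) := fun u => by
    rw [← sub_eq_zero, ← map_sub, ← mul_sub]
    exact ConvVanish.mul (Or.inr hv) _ _ hk
  rw [← h1, Coord.convDer_vf_rotField, map_add, map_sub, h2, h3, hL, ← map_sub, hs]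
  have h4 : ∀ x : zgO A, convBase (Coord A) (y : Conv A ℂ) * convBase (Coord A) (x : Conv A ℂ) -
      convBase (Coord A) (x : Conv A ℂ) * convBase (Coord A) (y : Conv A ℂ) =
      convBase (Coord A) ((⁅y, x⁆ : zgO A) : Conv A ℂ) := fun x => by
    rw [← map_mul, ← map_mul, ← map_sub]
    rfl
  simp only [Finset.sum_mul, Finset.mul_sum, smul_mul_assoc, mul_smul_comm,
    ← Finset.sum_sub_distrib, ← smul_sub]
  simp only [← neg_sub (convBase (Coord A) (y : Conv A ℂ) * _), h4, map_sum, map_smul, map_neg, hL]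
  rw [add_right_comm, ← Finset.sum_add_distrib]
  convert zero_add _
  refine Finset.sum_eq_zero fun k' _ => ?_
  rw [← Finset.sum_add_distrib]
  refine Finset.sum_eq_zero fun j' _ => ?_
  rw [smul_neg]
  exact neg_add_cancel _

end Operators

/-! ### Cartan's formula for contraction with a vector field with function coefficients. -/

section Homotopy

open AlternatingMap

variable {L M C : Type*} [LieRing L] [LieAlgebra ℂ L] [AddCommGroup M] [Module ℂ M]
  [CommRing C] [Algebra ℂ C] [Module C M] [IsScalarTower ℂ C M] {ι : Type*} (s : Finset ι) (h : ι → C) (e : ι → L)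

/-- Contraction with `∑ i, h i • e i`. -/
def contract {n : ℕ} (ω : L [⋀^Fin (n + 1)]→ₗ[ℂ] M) : L [⋀^Fin n]→ₗ[ℂ] M :=
  ∑ i ∈ s, h i • ω.curryLeft (e i)

lemma contract_apply {n : ℕ} (ω : L [⋀^Fin (n + 1)]→ₗ[ℂ] M) (v : Fin n → L) :
    contract s h e ω v = ∑ i ∈ s, h i • ω (Matrix.vecCons (e i) v) := by
  let E : (L [⋀^Fin n]→ₗ[ℂ] M) →+ M :=
    { toFun := fun ω => ω v, map_zero' := rfl, map_add' := fun _ _ => rfl }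
  change E _ = _
  simp only [contract, map_sum]
  rfl

lemma contract_curryLeft {n : ℕ} (ω : L [⋀^Fin (n + 2)]→ₗ[ℂ] M) (x : L) :
    (contract s h e ω).curryLeft x = -contract s h e (ω.curryLeft x) := by
  ext v
  rw [AlternatingMap.neg_apply, curryLeft_apply_apply, contract_apply, contract_apply,
    ← Finset.sum_neg_distrib]
  refine Finset.sum_congr rfl fun i _ => ?_
  rw [← smul_neg, curryLeft_apply_apply]
  congr 1
  have h := ω.map_swap (Matrix.vecCons x (Matrix.vecCons (e i) v))
    (show (0 : Fin (n + 2)) ≠ 1 by simp)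
  rw [← h]
  congr 1
  ext l : 1
  refine Fin.cases ?_ (fun l => Fin.cases ?_ (fun l => ?_) l) l
  · simp
  · simp
  · have h1 : l.succ.succ ≠ (1 : Fin (n + 2)) := fun h =>
      Fin.succ_ne_zero l (Fin.succ_injective _ (h.trans Fin.succ_zero_eq_one.symm))
    rw [Function.comp_apply, Equiv.swap_apply_of_ne_of_ne (Fin.succ_ne_zero _) h1]
    simp

lemma contract_sub {n : ℕ} (ω η : L [⋀^Fin (n + 1)]→ₗ[ℂ] M) :
    contract s h e (ω - η) = contract s h e ω - contract s h e η := by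
  ext v
  simp only [contract_apply, AlternatingMap.sub_apply, smul_sub, Finset.sum_sub_distrib]

/-- The Lie derivative along a vector field normalizing `L`, acting on the coefficients by `E` and
on `L` by `-θ`. -/
def extDer (E : Module.End ℂ M) (θ : Module.End ℂ L) (n : ℕ) :
    Module.End ℂ (L [⋀^Fin n]→ₗ[ℂ] M) where
  toFun ω := E.compAlternatingMap ω + altDer θ ω
  map_add' ω η := by
    ext v
    simp only [altDer_add, AlternatingMap.add_apply, LinearMap.compAlternatingMap_apply, map_add]
    abel
  map_smul' c ω := by
    ext v
    simp [altDer_apply, Finset.smul_sum]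

variable (E : Module.End ℂ M) (θ : Module.End ℂ L)

lemma extDer_apply {n : ℕ} (ω : L [⋀^Fin n]→ₗ[ℂ] M) (v : Fin n → L) :
    extDer E θ n ω v = E (ω v) + ∑ k, ω (Function.update v k (θ (v k))) := by
  rw [← altDer_apply]
  rfl

lemma extDer_curryLeft {n : ℕ} (ω : L [⋀^Fin (n + 1)]→ₗ[ℂ] M) (x : L) :
    (extDer E θ (n + 1) ω).curryLeft x =
      extDer E θ n (ω.curryLeft x) + ω.curryLeft (θ x) := by
  change E.compAlternatingMap (ω.curryLeft x) + (altDer θ ω).curryLeft x = _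
  rw [altDer_curryLeft, add_comm (ω.curryLeft _), ← add_assoc]
  rfl

variable [LieRingModule L M] [LieModule ℂ L M]

lemma lieDer_sum {n : ℕ} (x : L) (ω : ι → L [⋀^Fin n]→ₗ[ℂ] M) :
    lieDer x (∑ i ∈ s, ω i) = ∑ i ∈ s, lieDer x (ω i) :=
  map_sum (AddMonoidHom.mk' (lieDer x) fun ω η => by
    ext v
    simp only [lieDer, altDer_add, AlternatingMap.sub_apply, AlternatingMap.add_apply,
      valAct_apply, lie_add]
    abel) ω s

variable {h e E θ s} {D : L → C → C} {I : Set L} {c : ι → L → ℂ}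

-- With Θ = Σ hᵢ eᵢ, the left side is Λ applied to the derivative of Θ along y, by the product rule.
-- As Λ factors through L/I, it suffices to compare coordinates, and that is the hypothesis `hc`.
omit [LieRingModule L M] [LieModule ℂ L M] in
lemma sum_derivation_smul (hI : ∀ x, x - ∑ i ∈ s, c i x • e i ∈ I)
    (hc : ∀ y, ∀ i ∈ s, D y (h i) + ∑ i' ∈ s, h i' * algebraMap ℂ C (c i ⁅y, e i'⁆) =
      algebraMap ℂ C (c i (θ y)))
    (Λ : L →ₗ[ℂ] M) (hΛ : ∀ x ∈ I, Λ x = 0) (y : L) :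
    ∑ i ∈ s, D y (h i) • Λ (e i) + ∑ i ∈ s, h i • Λ ⁅y, e i⁆ = Λ (θ y) := by
  have h1 : ∀ x, Λ x = ∑ i ∈ s, algebraMap ℂ C (c i x) • Λ (e i) := fun x => by
    have := hΛ _ (hI x)
    rw [map_sub, sub_eq_zero] at this
    rw [this]
    simp only [map_sum, map_smul, algebraMap_smul]
  have h2 : ∑ i ∈ s, h i • Λ ⁅y, e i⁆ =
      ∑ i ∈ s, (∑ i' ∈ s, h i' * algebraMap ℂ C (c i ⁅y, e i'⁆)) • Λ (e i) := by
    have h3 : ∀ i', h i' • Λ ⁅y, e i'⁆ =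
        ∑ i ∈ s, (h i' * algebraMap ℂ C (c i ⁅y, e i'⁆)) • Λ (e i) := fun i' => by
      rw [h1 ⁅y, e i'⁆, Finset.smul_sum]
      simp only [mul_smul]
    simp only [h3, Finset.sum_smul]
    exact Finset.sum_comm
  rw [h1 (θ y), h2, ← Finset.sum_add_distrib]
  refine Finset.sum_congr rfl fun i hi => ?_
  rw [← add_smul, hc y i hi]

/-- The commutator of a Lie derivative with a contraction is contraction with the derivative of the
field, which is θ x by `sum_derivation_smul`. -/
lemma lieDer_contract (hD : ∀ (y : L) (c : C) (z : M), ⁅y, c • z⁆ = D y c • z + c • ⁅y, z⁆)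
    (hI : ∀ x, x - ∑ i ∈ s, c i x • e i ∈ I)
    (hc : ∀ y, ∀ i ∈ s, D y (h i) + ∑ i' ∈ s, h i' * algebraMap ℂ C (c i ⁅y, e i'⁆) =
      algebraMap ℂ C (c i (θ y)))
    {n : ℕ} {ω : L [⋀^Fin (n + 1)]→ₗ[ℂ] M} (hω : ∀ x ∈ I, ω.curryLeft x = 0) (x : L) :
    lieDer x (contract s h e ω) - contract s h e (lieDer x ω) = ω.curryLeft (θ x) := by
  have h1 : ∀ (c : C) (ω : L [⋀^Fin n]→ₗ[ℂ] M),
      lieDer x (c • ω) = D x c • ω + c • lieDer x ω := fun c ω => by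
    ext v
    simp only [lieDer, AlternatingMap.sub_apply, AlternatingMap.add_apply,
      AlternatingMap.smul_apply, valAct_apply, altDer_apply, hD, ← Finset.smul_sum, smul_sub]
    abel
  have : IsScalarTower ℂ C (L [⋀^Fin n]→ₗ[ℂ] M) :=
    ⟨fun a b ω => by ext v; exact smul_assoc a b (ω v)⟩
  rw [← sum_derivation_smul hI hc ω.curryLeft hω x]
  simp only [contract, lieDer_sum, h1, lieDer_curryLeft, smul_sub, Finset.sum_sub_distrib,
    Finset.sum_add_distrib]
  abel

/-- Cartan's formula, on invariant functions. -/
lemma contract_ceD_zero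
    (hE : ∀ z : M, (∀ y ∈ I, ⁅y, z⁆ = 0) → E z = ∑ i ∈ s, h i • ⁅e i, z⁆)
    {ω : L [⋀^Fin 0]→ₗ[ℂ] M} (hω : ∀ y ∈ I, ∀ v, ⁅y, ω v⁆ = 0) :
    contract s h e (ceD L M 0 ω) = extDer E θ 0 ω := by
  ext v
  rw [extDer_apply, Finset.univ_eq_empty, Finset.sum_empty, add_zero, hE _ fun y hy => hω y hy v,
    contract_apply]
  refine Finset.sum_congr rfl fun i _ => ?_
  rw [← curryLeft_apply_apply, ceD_zero_curryLeft, lieDer, AlternatingMap.sub_apply, altDer_apply,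
    Finset.univ_eq_empty, Finset.sum_empty, sub_zero, valAct_apply]

/-- Cartan's formula. -/
lemma ceD_contract (hD : ∀ (y : L) (c : C) (z : M), ⁅y, c • z⁆ = D y c • z + c • ⁅y, z⁆)
    (hI : ∀ x, x - ∑ i ∈ s, c i x • e i ∈ I)
    (hc : ∀ y, ∀ i ∈ s, D y (h i) + ∑ i' ∈ s, h i' * algebraMap ℂ C (c i ⁅y, e i'⁆) =
      algebraMap ℂ C (c i (θ y)))
    (hE : ∀ z : M, (∀ y ∈ I, ⁅y, z⁆ = 0) → E z = ∑ i ∈ s, h i • ⁅e i, z⁆)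
    {n : ℕ} {ω : L [⋀^Fin (n + 1)]→ₗ[ℂ] M} (hω : ∀ v, (∃ i, v i ∈ I) → ω v = 0)
    (hω' : ∀ y ∈ I, ∀ v, ⁅y, ω v⁆ = 0) :
    ceD L M n (contract s h e ω) + contract s h e (ceD L M (n + 1) ω) = extDer E θ (n + 1) ω := by
  have h0 : ∀ x ∈ I, ω.curryLeft x = 0 := fun x hx => by
    ext v
    exact hω _ ⟨0, by simpa using hx⟩
  induction n with
  | zero =>
    refine curryLeft_ext fun x => ?_
    change (ceD L M 0 (contract s h e ω)).curryLeft x +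
      (contract s h e (ceD L M 1 ω)).curryLeft x = _
    rw [extDer_curryLeft, ceD_zero_curryLeft, contract_curryLeft, ceD_curryLeft,
      contract_sub, contract_ceD_zero hE fun y hy v => ?_, ← lieDer_contract hD hI hc h0]
    · abel
    · exact hω' y hy _
  | succ n ih =>
    -- After inserting x, the identity in degree n + 2 becomes the one in degree n + 1 for the
    -- contracted form, plus the commutator of the Lie derivative of x with the contraction; that
    -- commutator supplies the term with θ x.
    refine curryLeft_ext fun x => ?_
    change (ceD L M (n + 1) (contract s h e ω)).curryLeft x +
      (contract s h e (ceD L M (n + 2) ω)).curryLeft x = _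
    rw [extDer_curryLeft, ceD_curryLeft, contract_curryLeft, contract_curryLeft,
      ceD_curryLeft, contract_sub, ← ih (ω := ω.curryLeft x)
        (fun v ⟨i, hi⟩ => hω _ ⟨i.succ, by simpa using hi⟩) (fun y hy v => hω' y hy _) (fun y hy => ?_),
      ← lieDer_contract hD hI hc h0, map_neg]
    · abel
    · ext v
      exact hω _ ⟨1, by simpa using hy⟩

end Homotopy

/-! ### Locally finite operators with spectrum bounded below. -/

section LocalFiniteness

variable {V V' : Type*} [AddCommGroup V] [Module ℂ V] [AddCommGroup V'] [Module ℂ V']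

lemma aeval_intertwine (f : V →ₗ[ℂ] V') {S : Module.End ℂ V} {T : Module.End ℂ V'}
    (h : ∀ v, f (S v) = T (f v)) (p : Polynomial ℂ) (v : V) :
    f (Polynomial.aeval S p v) = Polynomial.aeval T p (f v) := by
  induction p using Polynomial.induction_on' with
  | add p q hp hq => simp only [map_add, LinearMap.add_apply, hp, hq]
  | monomial n c =>
    have hn : ∀ v, f ((S ^ n) v) = (T ^ n) (f v) := by
      induction n with
      | zero => simp
      | succ n ih => intro v; rw [pow_succ, pow_succ, Module.End.mul_apply, ih, h]; rfl
    simp [Polynomial.aeval_monomial, hn]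

lemma aeval_mem (N : Submodule ℂ V) {S : Module.End ℂ V} (h : ∀ v ∈ N, S v ∈ N)
    (p : Polynomial ℂ) {v : V} (hv : v ∈ N) : Polynomial.aeval S p v ∈ N := by
  have := aeval_intertwine N.subtype (S := S.restrict h) (T := S) (fun _ => rfl) p ⟨v, hv⟩
  rw [Submodule.subtype_apply, Submodule.subtype_apply] at this
  rw [← this]
  exact Subtype.prop _

/-- `v` is annihilated by a polynomial in `T` whose roots have real part at least `c`. -/
def SpectrumGE (T : Module.End ℂ V) (c : ℝ) (v : V) : Prop :=
  ∃ p : Polynomial ℂ, (∀ r, p.eval r = 0 → c ≤ r.re) ∧ Polynomial.aeval T p v = 0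

lemma SpectrumGE.zero (T : Module.End ℂ V) (c : ℝ) : SpectrumGE T c 0 :=
  ⟨1, fun r h => by simp at h, map_zero _⟩

lemma SpectrumGE.add {T : Module.End ℂ V} {c : ℝ} {v w : V} (hv : SpectrumGE T c v)
    (hw : SpectrumGE T c w) : SpectrumGE T c (v + w) := by
  obtain ⟨p, hp, hpv⟩ := hv
  obtain ⟨q, hq, hqw⟩ := hw
  refine ⟨p * q, fun r hr => ?_, ?_⟩
  · rw [Polynomial.eval_mul, mul_eq_zero] at hr
    exact hr.elim (hp r) (hq r)
  · rw [map_add]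
    nth_rewrite 1 [mul_comm p q]
    rw [map_mul, map_mul, Module.End.mul_apply, Module.End.mul_apply, hpv, hqw, map_zero, map_zero,
      add_zero]

lemma SpectrumGE.of_injective (f : V →ₗ[ℂ] V') (hf : Function.Injective f) {S : Module.End ℂ V}
    {T : Module.End ℂ V'} (h : ∀ v, f (S v) = T (f v)) {c : ℝ} {v : V}
    (hv : SpectrumGE T c (f v)) : SpectrumGE S c v := by
  obtain ⟨p, hp, hpv⟩ := hv
  exact ⟨p, hp, hf (by rw [aeval_intertwine f h, hpv, map_zero])⟩

/-- A vector whose images under finitely many maps which intertwine `S` with shifts of `T` satisfy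
a spectral bound, and are jointly injective on the relevant subspace. -/
lemma SpectrumGE.of_shifts {ι : Type*} [Fintype ι] (f : ι → V →ₗ[ℂ] V') {S : Module.End ℂ V}
    {T : Module.End ℂ V'} (d : ι → ℝ) (hf : ∀ i v, f i (S v) = T (f i v) + (d i : ℂ) • f i v)
    (N : Submodule ℂ V) (hN : ∀ v ∈ N, S v ∈ N) (hinj : ∀ v ∈ N, (∀ i, f i v = 0) → v = 0)
    {b c : ℝ} (hd : ∀ i, b ≤ c + d i) {v : V} (hv : v ∈ N) (h : ∀ i, SpectrumGE T c (f i v)) :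
    SpectrumGE S b v := by
  choose q hq hqv using h
  -- As fᵢ carries S to T + dᵢ, the factor qᵢ(S - dᵢ) becomes qᵢ(T) under fᵢ and kills the i-th
  -- image; its roots are those of qᵢ moved by dᵢ.
  refine ⟨∏ i, (q i).comp (Polynomial.X - Polynomial.C (d i : ℂ)), fun r hr => ?_,
    hinj _ (aeval_mem N hN _ hv) fun i => ?_⟩
  · rw [Polynomial.eval_prod, Finset.prod_eq_zero_iff] at hr
    obtain ⟨i, -, hi⟩ := hr
    rw [Polynomial.eval_comp] at hi
    have h1 := hq i _ hi
    simp only [Polynomial.eval_sub, Polynomial.eval_X, Polynomial.eval_C, Complex.sub_re,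
      Complex.ofReal_re] at h1
    linarith [hd i]
  · classical
    have h1 : ∀ v, f i (S v) = (T + algebraMap ℂ (Module.End ℂ V') (d i)) (f i v) := fun v => by
      rw [hf]; rfl
    rw [aeval_intertwine (f i) h1, ← Finset.prod_erase_mul _ _ (Finset.mem_univ i), map_mul,
      Module.End.mul_apply, Polynomial.aeval_comp]
    simp [hqv]

/-- As c > 0, the annihilating polynomial p has p(0) ≠ 0, so an inverse of T on v is a polynomial in
T. For that reason the preimage stays in every T-stable subspace. -/
lemma SpectrumGE.exists_preimage {T : Module.End ℂ V} {c : ℝ} {v : V} (h : SpectrumGE T c v)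
    (hc : 0 < c) (N : Submodule ℂ V) (hN : ∀ v ∈ N, T v ∈ N) (hv : v ∈ N) : ∃ w ∈ N, T w = v := by
  obtain ⟨p, hp, hpv⟩ := h
  have h0 : p.coeff 0 ≠ 0 := fun h0 => by
    have h1 := hp 0 (by rw [← Polynomial.coeff_zero_eq_eval_zero, h0])
    rw [Complex.zero_re] at h1
    linarith
  refine ⟨(-(p.coeff 0)⁻¹) • Polynomial.aeval T p.divX v, N.smul_mem _ (aeval_mem N hN _ hv), ?_⟩
  rw [← Polynomial.divX_mul_X_add p, mul_comm, map_add, map_mul, Polynomial.aeval_X,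
    Polynomial.aeval_C, LinearMap.add_apply, Module.End.mul_apply,
    Module.algebraMap_end_apply] at hpv
  rw [map_smul, eq_neg_of_add_eq_zero_left hpv, smul_neg, neg_smul, neg_neg, smul_smul,
    inv_mul_cancel₀ h0, one_smul]

end LocalFiniteness

/-! ### Acyclicity of cofree representations. -/

section CofreeAcyclicity

variable {A : Type} [CommRing A] [HopfAlgebra ℂ A] {W : Type v} [AddCommGroup W] [Module ℂ W]

lemma spectrum_rotAct (z : Coord A ⊗[ℂ] W) : SpectrumGE (rotAct A W) 0 z := by
  induction z with
  | zero => exact SpectrumGE.zero _ _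
  | add a b ha hb => exact ha.add hb
  | tmul f w =>
    induction f using Coord.scale_induction with
    | h0 =>
      rw [TensorProduct.zero_tmul]
      exact SpectrumGE.zero _ _
    | hadd f g hf hg =>
      rw [TensorProduct.add_tmul]
      exact hf.add hg
    | hom j f hf =>
      refine ⟨Polynomial.X - Polynomial.C (j : ℂ), fun r hr => ?_, ?_⟩
      · rw [Polynomial.eval_sub, Polynomial.eval_X, Polynomial.eval_C, sub_eq_zero] at hr
        simp [hr]
      · simp only [map_sub, Polynomial.aeval_X, Polynomial.aeval_C, LinearMap.sub_apply, rotAct,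
          LinearMap.rTensor_tmul, Derivation.coeFn_coe, Coord.rotGen_of_scale hf]
        rw [Module.algebraMap_end_apply, TensorProduct.smul_tmul', sub_self]

lemma Inflated.extDer {M : Type*} [AddCommGroup M] [Module ℂ M] {n m : ℕ} (E : Module.End ℂ M)
    {ω : zgO A [⋀^Fin n]→ₗ[ℂ] M} (h : Inflated m ω) : Inflated m (extDer E (zgEuler A) n ω) := by
  rintro v ⟨i, hi⟩
  rw [extDer_apply, h v ⟨i, hi⟩, map_zero, zero_add]
  refine Finset.sum_eq_zero fun k _ => h _ ⟨i, ?_⟩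
  by_cases hk : i = k
  · subst hk
    rw [Function.update_self]
    exact convVanish_convDer hi
  · rwa [Function.update_of_ne hk]

/-- Inserting an element of the frame with factor zᵏ⁺¹ lowers the degree of the form by one and
shifts the operator by k + 1 ≥ 1. Induction from functions, where the weights are at least 0, gives
the bound n. -/
lemma spectrum_forms [Algebra.FiniteType ℂ A] {n m : ℕ}
    {ω : zgO A [⋀^Fin n]→ₗ[ℂ] Coord A ⊗[ℂ] W} (h : Inflated m ω) :
    SpectrumGE (extDer (rotAct A W) (zgEuler A) n) n ω := by
  have Φ : Frame A := Classical.arbitrary _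
  induction n with
  | zero =>
    let f : (zgO A [⋀^Fin 0]→ₗ[ℂ] Coord A ⊗[ℂ] W) →ₗ[ℂ] Coord A ⊗[ℂ] W :=
      { toFun := fun ω => ω ![], map_add' := fun _ _ => rfl, map_smul' := fun _ _ => rfl }
    refine SpectrumGE.of_injective f (fun ω η h => ?_) (T := rotAct A W) (fun ω => ?_) ?_
    · ext v
      rw [Subsingleton.elim v ![]]
      exact h
    · exact (extDer_apply _ _ ω ![]).trans (by simp [f])
    · rw [Nat.cast_zero]
      exact spectrum_rotAct _
  | succ n ih =>
    let f : Fin m × Fin Φ.r → (zgO A [⋀^Fin (n + 1)]→ₗ[ℂ] Coord A ⊗[ℂ] W) →ₗ[ℂ]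
        (zgO A [⋀^Fin n]→ₗ[ℂ] Coord A ⊗[ℂ] W) := fun p =>
      { toFun := fun ω => ω.curryLeft (Φ.e p.1 p.2)
        map_add' := fun _ _ => rfl
        map_smul' := fun _ _ => rfl }
    let N : Submodule ℂ (zgO A [⋀^Fin (n + 1)]→ₗ[ℂ] Coord A ⊗[ℂ] W) :=
      { carrier := {ω | Inflated m ω}
        zero_mem' := fun _ _ => rfl
        add_mem' := fun h h' v hv => by rw [AlternatingMap.add_apply, h v hv, h' v hv, add_zero]
        smul_mem' := fun c _ h v hv => by rw [AlternatingMap.smul_apply, h v hv, smul_zero] }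
    have hf : ∀ p ω, f p (extDer (rotAct A W) (zgEuler A) (n + 1) ω) =
        extDer (rotAct A W) (zgEuler A) n (f p ω) +
          (((p.1 : ℕ) + 1 : ℝ) : ℂ) • f p ω := fun p ω => by
      refine (extDer_curryLeft _ _ ω (Φ.e p.1 p.2)).trans (congrArg _ ?_)
      rw [Φ.zgEuler_e, map_smul]
      push_cast
      rfl
    have hinj : ∀ ω ∈ N, (∀ p, f p ω = 0) → ω = 0 := fun ω hω h0 => by
      ext v
      have h1 : Inflated m ω := hω
      rw [h1.apply_eq_sum Φ]
      refine Finset.sum_eq_zero fun t _ => ?_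
      have h2 := congrArg (fun η : zgO A [⋀^Fin n]→ₗ[ℂ] Coord A ⊗[ℂ] W =>
        η fun i => Φ.e (t i.succ).1 (t i.succ).2) (h0 (t 0))
      have h3 : (fun i => Φ.e (t i).1 (t i).2) =
          Matrix.vecCons (Φ.e (t 0).1 (t 0).2) fun i => Φ.e (t i.succ).1 (t i.succ).2 := by
        ext i : 1
        refine Fin.cases ?_ (fun i => ?_) i <;> simp
      rw [h3]
      exact (congrArg _ h2).trans (smul_zero _)
    have hd : ∀ p : Fin m × Fin Φ.r, ((n + 1 : ℕ) : ℝ) ≤ n + ((p.1 : ℕ) + 1) := fun p => by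
      push_cast
      have : (0 : ℝ) ≤ (p.1 : ℕ) := Nat.cast_nonneg _
      linarith
    have hN : ω ∈ N := h
    exact SpectrumGE.of_shifts f (fun p => ((p.1 : ℕ) + 1 : ℝ)) hf N
      (fun ω hω => Inflated.extDer _ hω) hinj hd hN fun p => ih (h.curryLeft _)

/-- The continuous cohomology of `z𝔤(𝒪)` with cofree coefficients vanishes in positive degrees. -/
lemma cofree_acyclic [Algebra.FiniteType ℂ A] {n m : ℕ}
    {ω : zgO A [⋀^Fin (n + 1)]→ₗ[ℂ] (cofree A W).V} (hω : IsLevel (cofree A W) m ω)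
    (hd : ceD (zgO A) (cofree A W).V (n + 1) ω = 0) :
    ∃ η : zgO A [⋀^Fin n]→ₗ[ℂ] (cofree A W).V, (∃ m, IsLevel (cofree A W) m η) ∧
      ceD (zgO A) (cofree A W).V n η = ω := by
  have Φ : Frame A := Classical.arbitrary _
  let s : Finset (ℕ × Fin Φ.r) := Finset.range m ×ˢ Finset.univ
  let h : ℕ × Fin Φ.r → Coord A := fun p => Coord.rotCoord Φ p.1 p.2
  let e : ℕ × Fin Φ.r → zgO A := fun p => Φ.e p.1 p.2
  let I : Set (zgO A) := {y | ConvVanish m (y : Conv A ℂ)}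
  let T := extDer (rotAct A W) (zgEuler A) (n + 1)
  have cartan : ∀ ω : zgO A [⋀^Fin (n + 1)]→ₗ[ℂ] Coord A ⊗[ℂ] W, IsLevel (cofree A W) m ω →
      ceD (zgO A) (Coord A ⊗[ℂ] W) (n + 1) ω = 0 →
      ceD (zgO A) (Coord A ⊗[ℂ] W) n (contract s h e ω) = T ω := fun ω hω hd => by
    have h1 := ceD_contract (s := s) (h := h) (e := e) (E := rotAct A W) (θ := zgEuler A)
      (D := fun y c => Coord.vf y c) (I := I) lie_smul_coord
      (c := fun p x => Φ.coord p.1 p.2 x)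
      (fun x => by
        simp only [s, Finset.sum_product]
        exact Φ.convVanish_sub_trunc m x)
      (fun y p hp => by
        simp only [s, Finset.sum_product]
        exact vf_rotCoord Φ y (Finset.mem_range.1 (Finset.mem_product.1 hp).1) p.2)
      (fun z hz => by
        simp only [s, Finset.sum_product]
        exact rotAct_eq_sum Φ hz) hω.1 hω.2
    have h2 : contract s h e (ceD (zgO A) (Coord A ⊗[ℂ] W) (n + 1) ω) = 0 := by
      rw [hd]
      ext v
      rw [contract_apply]
      exact Finset.sum_eq_zero fun _ _ => smul_zero _
    rwa [h2, add_zero] at h1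
  -- Cocycles of fixed level m. They are stable under T: rotation preserves levels, and on cocycles
  -- T is a composite ending in the differential.
  let N : Submodule ℂ (zgO A [⋀^Fin (n + 1)]→ₗ[ℂ] Coord A ⊗[ℂ] W) :=
    levelForms (cofree A W) (n + 1) m ⊓ LinearMap.ker (ceD (zgO A) (Coord A ⊗[ℂ] W) (n + 1))
  have hN : ∀ ω ∈ N, T ω ∈ N := fun ω hω => by
    have hi : Inflated m ω := hω.1.1
    refine ⟨⟨hi.extDer _, fun y hy v => ?_⟩, ?_⟩
    · change ⁅y, extDer (rotAct A W) (zgEuler A) (n + 1) ω v⁆ = 0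
      have h1 : ∀ v, ⁅y, ω v⁆ = 0 := hω.1.2 y hy
      have h2 : ∀ v, ⁅zgEuler A y, ω v⁆ = 0 := hω.1.2 _ (convVanish_convDer hy)
      rw [extDer_apply, lie_add, lie_rotAct, h1, h2, map_zero, lie_sum, Finset.sum_eq_zero]
      · simp
      · exact fun k _ => h1 _
    · refine LinearMap.mem_ker.2 ?_
      rw [← cartan ω hω.1 hω.2, ceD_ceD]
  have hi : Inflated m ω := hω.1
  have hωN : ω ∈ N := ⟨hω, hd⟩
  -- The bound n + 1 > 0 makes T invertible on ω within N. As η is again a cocycle of level m,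
  -- Cartan's formula turns T η = ω into d of the contraction of η.
  obtain ⟨η, hη, hTη⟩ := (spectrum_forms hi).exists_preimage (by positivity) N hN hωN
  have hci : Inflated (M := (cofree A W).V) m (contract s h e η) := fun v hv => by
    rw [contract_apply]
    refine Finset.sum_eq_zero fun i _ => ?_
    obtain ⟨k, hk⟩ := hv
    have : η (Matrix.vecCons (e i) v) = 0 := hη.1.1 _ ⟨k.succ, by simpa using hk⟩
    rw [this, smul_zero]
  exact ⟨contract s h e η, hci.exists_isLevel, (cartan η hη.1 hη.2).trans hTη⟩

end CofreeAcyclicity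

/-! ### Complete reducibility of algebraic representations of ℂ^*. -/

section CompleteReducibility

section

variable {Γ B : Type*} [Group Γ] [CommRing B] [Algebra ℂ B] {ev : Γ → (B →ₐ[ℂ] ℂ)}
  {M N : Type*} [AddCommGroup M] [Module ℂ M] [AddCommGroup N] [Module ℂ N]
  {ρ : Representation ℂ Γ M} {σ : Representation ℂ Γ N}

/-- Maschke's theorem for algebraic representations, by averaging a linear retraction. -/
lemma exists_equivariant_retraction {S : Set Γ} (hS : IsDense ev S) (ι : B →ₗ[ℂ] B)
    (hι : ∀ g b, ev g (ι b) = ev g⁻¹ b) (l : B →ₗ[ℂ] ℂ) (hl1 : l 1 = 1)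
    (hl : ∀ s : Γ, ∃ τ : B →ₗ[ℂ] B, (∀ g b, ev g (τ b) = ev (g * s) b) ∧ ∀ b, l (τ b) = l b)
    (hρ : IsAlg ev ρ) (hσ : IsAlg ev σ) (f : N →ₗ[ℂ] M) (hf : Function.Injective f)
    (hfρ : ∀ g n, f (σ g n) = ρ g (f n)) :
    ∃ r : M →ₗ[ℂ] N, (∀ g m, r (ρ g m) = σ g (r m)) ∧ ∀ n, r (f n) = n := by
  obtain ⟨r₀, hr₀⟩ := LinearMap.exists_leftInverse_of_injective f (LinearMap.ker_eq_bot.2 hf)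
  have hr₀' : ∀ n, r₀ (f n) = n := fun n => congrArg (fun h : N →ₗ[ℂ] N => h n) hr₀
  have hev : ∀ (g g' : Γ) (τ : B →ₗ[ℂ] B), (∀ b, ev g (τ b) = ev g' b) → ∀ T : B ⊗[ℂ] N,
      evT ev g (τ.rTensor N T) = evT ev g' T := fun g g' τ h T => by
    induction T with
    | zero => simp
    | add x y hx hy => simp only [map_add, hx, hy]
    | tmul x y => simp [h]
  let μ : B ⊗[ℂ] (B ⊗[ℂ] N) →ₗ[ℂ] B ⊗[ℂ] N :=
    TensorProduct.lift (Algebra.lsmul ℂ ℂ (B ⊗[ℂ] N)).toLinearMap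
  -- The tensor Ψ m represents g ↦ σ(g)⁻¹ r₀(ρ(g) m); applying `l` to it averages the linear
  -- retraction r₀ over the group.
  let Ψ : M →ₗ[ℂ] B ⊗[ℂ] N := μ ∘ₗ (ι.rTensor N ∘ₗ hσ.coact hS).lTensor B ∘ₗ r₀.lTensor B ∘ₗ
    hρ.coact hS
  have hΨ : ∀ g m, evT ev g (Ψ m) = σ g⁻¹ (r₀ (ρ g m)) := fun g m => by
    rw [← hρ.evT_coact hS g m]
    simp only [Ψ, LinearMap.comp_apply]
    generalize hρ.coact hS m = T
    induction T with
    | zero => simp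
    | add x y hx hy => simp only [map_add, hx, hy]
    | tmul b m =>
      simp only [LinearMap.lTensor_tmul, evT_tmul, map_smul]
      change evT ev g (b • ι.rTensor N (hσ.coact hS (r₀ m))) = _
      rw [evT_smul, hev g g⁻¹ ι (hι g), hσ.evT_coact]
  let J : B ⊗[ℂ] N →ₗ[ℂ] N := (TensorProduct.lid ℂ N).toLinearMap ∘ₗ l.rTensor N
  refine ⟨J ∘ₗ Ψ, fun s m => ?_, fun n => ?_⟩
  · obtain ⟨τ, hτ, hlτ⟩ := hl s
    have h1 : Ψ (ρ s m) = (σ s).lTensor B (τ.rTensor N (Ψ m)) := hS.evT_ext fun g _ => by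
      rw [evT_lTensor, hev g (g * s) τ (hτ g), hΨ, hΨ, ← Module.End.mul_apply, ← map_mul,
        ← Module.End.mul_apply, ← map_mul, mul_inv_rev, mul_inv_cancel_left]
    have h2 : ∀ T : B ⊗[ℂ] N, J ((σ s).lTensor B (τ.rTensor N T)) = σ s (J T) := fun T => by
      induction T with
      | zero => simp
      | add x y hx hy => simp only [map_add, hx, hy]
      | tmul x y => simp [J, hlτ]
    rw [LinearMap.comp_apply, h1, h2]
    rfl
  · have h1 : Ψ (f n) = 1 ⊗ₜ n := hS.evT_ext fun g _ => by
      rw [hΨ, ← hfρ, hr₀', ← Module.End.mul_apply, ← map_mul, inv_mul_cancel]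
      simp
    rw [LinearMap.comp_apply, h1]
    simp [J, hl1]

end

section

open LaurentPolynomial CategoryTheory

/-- The integral over the unit circle, written algebraically as the coefficient of T⁰. Translation
by s multiplies Tⁿ by sⁿ, so it fixes that coefficient. -/
lemma exists_rot_integral : ∃ l : ℂ[T;T⁻¹] →ₗ[ℂ] ℂ, l 1 = 1 ∧
    ∀ s : ℂˣ, ∃ τ : ℂ[T;T⁻¹] →ₗ[ℂ] ℂ[T;T⁻¹],
      (∀ t b, unitEv t (τ b) = unitEv (t * s) b) ∧ ∀ b, l (τ b) = l b := by
  let l : ℂ[T;T⁻¹] →ₗ[ℂ] ℂ :=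
    { toFun := fun p => p.coeff 0, map_add' := fun _ _ => rfl, map_smul' := fun _ _ => rfl }
  have hl : ∀ n : ℤ, l (T n) = if n = 0 then 1 else 0 := fun n => T_apply 0 n
  refine ⟨l, by rw [← T_zero, hl, if_pos rfl], fun s => ?_⟩
  obtain ⟨w, hw, hw'⟩ : ∃ w : (ℂ[T;T⁻¹])ˣ, (w : ℂ[T;T⁻¹]) = T 1 ∧ (↑w⁻¹ : ℂ[T;T⁻¹]) = T (-1) :=
    ⟨⟨T 1, T (-1), by rw [← T_add]; simp, by rw [← T_add]; simp⟩, rfl, rfl⟩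
  let u : (ℂ[T;T⁻¹])ˣ := Units.map (C : ℂ →+* ℂ[T;T⁻¹]) s * w
  let τ : ℂ[T;T⁻¹] →ₐ[ℂ] ℂ[T;T⁻¹] :=
    { eval₂ C u with
      commutes' := fun c => by
        simp [← C_eq_algebraMap] }
  have hu : ∀ n : ℤ, ((u ^ n : (ℂ[T;T⁻¹])ˣ) : ℂ[T;T⁻¹]) = ((s ^ n : ℂˣ) : ℂ) • T n := fun n => by
    have h1 : ∀ n : ℤ, ((w ^ n : (ℂ[T;T⁻¹])ˣ) : ℂ[T;T⁻¹]) = T n := fun n => by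
      induction n using Int.induction_on with
      | zero => simp
      | succ n ih => rw [zpow_add_one, Units.val_mul, ih, hw, T_add]
      | pred n ih => rw [zpow_sub_one, Units.val_mul, ih, hw', sub_eq_add_neg, T_add]
    rw [mul_zpow, Units.val_mul, h1, ← map_zpow, Algebra.smul_def]
    rfl
  have hτ : ∀ n : ℤ, τ (T n) = ((s ^ n : ℂˣ) : ℂ) • T n := fun n =>
    (eval₂_T _ _ n).trans (hu n)
  have hC : ∀ (n : ℤ) (a : ℂ), C a * T n = a • T n := fun n a => by
    rw [C_eq_algebraMap, Algebra.smul_def]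
  refine ⟨τ.toLinearMap, fun t b => ?_, fun b => ?_⟩
  · induction b using LaurentPolynomial.induction_on' with
    | add p q hp hq => simp only [map_add, hp, hq]
    | C_mul_T n a =>
      rw [hC, map_smul, map_smul, map_smul, AlgHom.toLinearMap_apply, hτ, map_smul, unitEv_T,
        unitEv_T, mul_zpow]
      simp [mul_comm]
  · induction b using LaurentPolynomial.induction_on' with
    | add p q hp hq => simp only [map_add, hp, hq]
    | C_mul_T n a =>
      rw [hC, map_smul, map_smul, map_smul, AlgHom.toLinearMap_apply, hτ, map_smul, hl]
      split_ifs with h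
      · simp [h]
      · simp

/-- Algebraic representations of `ℂ^*` are completely reducible. -/
lemma monosSplit_of_isAlg {V : Type v} [AddCommGroup V] [Module ℂ V]
    {ρ : Representation ℂ ℂˣ V} (hρ : IsAlg unitEv ρ) : MonosSplit (Rep.of ρ) := by
  intro N f hf
  have hinj : Function.Injective f.hom := (Rep.mono_iff_injective f).1 hf
  obtain ⟨l, hl1, hl⟩ := exists_rot_integral
  have hcomm : ∀ g n, f.hom.toLinearMap (N.ρ g n) = ρ g (f.hom.toLinearMap n) := fun g n =>
    congrArg (fun h : N.V →ₗ[ℂ] V => h n) (f.hom.isIntertwining' g)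
  obtain ⟨r, hr, hrf⟩ := exists_equivariant_retraction unitEv_isDense
    (LaurentPolynomial.invert (R := ℂ)).toLinearMap (fun t b => by
      rw [AlgEquiv.toLinearMap_apply]
      induction b using LaurentPolynomial.induction_on' with
      | add p q hp hq => simp only [map_add, hp, hq]
      | C_mul_T n a =>
        simp only [map_mul, invert_T, invert_C, unitEv_T, zpow_neg, inv_zpow]
        rw [C_eq_algebraMap, AlgHom.commutes, AlgHom.commutes]) l hl1 hl hρ (hρ.of_injective unitEv_isDense f.hom.toLinearMap hinj hcomm)
    f.hom.toLinearMap hinj hcomm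
  let R : Rep.of ρ ⟶ Rep.of N.ρ := Rep.ofHom
    { toLinearMap := r
      isIntertwining' := fun g => by
        ext m
        exact hr g m }
  refine ⟨⟨⟨R, ?_⟩⟩⟩
  ext n
  exact hrf n

end

end CompleteReducibility

/-! ### The terms of both complexes split. -/

section Terms

variable {A : Type} [CommRing A] [HopfAlgebra ℂ A] (X : ExtArcRep.{v} A)

lemma monosSplit_invRep : MonosSplit (Rep.of X.invRep) :=
  monosSplit_of_isAlg ((isAlg_rotRep X).of_injective unitEv_isDense X.inv.subtype
    Subtype.val_injective fun _ _ => rfl)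

lemma monosSplit_ceInvRep [Algebra.FiniteType ℂ A] (n : ℕ) :
    MonosSplit (Rep.of (ceInvRep X n)) :=
  monosSplit_of_isAlg ((isAlg_formsRep_inr X n).of_injective unitEv_isDense
    (Submodule.inclusion (fun _ hω => hω.1) : ceInv X n →ₗ[ℂ] forms X n)
    (Submodule.inclusion_injective _) fun _ _ => rfl)

end Terms

/-! ### Acyclicity of injective representations. -/

section InjectiveAcyclicity

variable {A : Type} [CommRing A] [HopfAlgebra ℂ A] [Algebra.FiniteType ℂ A]

/-- An injective J is a direct summand of a cofree representation: embed the cocycle there, take a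
primitive and project it back. The primitive need not be G-invariant, but its average is, and still
has differential ω. -/
lemma injective_acyclic (hG : IsReductive A) {J : ExtArcRep.{v} A} (hJ : J.IsInjective) {n : ℕ}
    {ω : zgO A [⋀^Fin (n + 1)]→ₗ[ℂ] J.V} (hω : ω ∈ ceInv J (n + 1))
    (hd : ceD (zgO A) J.V (n + 1) ω = 0) : ∃ η ∈ ceInv J n, ceD (zgO A) J.V n η = ω := by
  obtain ⟨r, hr⟩ := hJ J (cofree A J.V) (ExtArcRep.embed J) (ExtArcRep.embed_injective J)
    (ExtArcRep.Hom.id J)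
  obtain ⟨P, hP, hP', hPd, -⟩ := exists_average.{v} hG
  obtain ⟨m, hm⟩ := hω.1
  have h1 := (ExtArcRep.embed J).ceD_comp ω
  rw [hd] at h1
  obtain ⟨η, ⟨m', hη⟩, hdη⟩ := cofree_acyclic ((ExtArcRep.embed J).isLevel_comp hm)
    (h1.trans (by ext v; exact map_zero (ExtArcRep.embed J).lin))
  have h2 : ceD (zgO A) J.V n (r.lin.compAlternatingMap η) = ω := by
    rw [r.ceD_comp, hdη]
    ext v
    exact congrArg (fun h : J.V →ₗ[ℂ] J.V => h (ω v)) hr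
  let η' : forms J n := ⟨r.lin.compAlternatingMap η, m', r.isLevel_comp hη⟩
  have h3 : formsD J n η' = ⟨ω, hω.1⟩ := Subtype.ext h2
  have h4 := hPd J n η'
  rw [h3, hP' J (n + 1) ⟨ω, hω.1⟩ hω] at h4
  exact ⟨P J n η', hP J n η', (congrArg Subtype.val h4).symm⟩

end InjectiveAcyclicity

/-! ### Kernels of differentials as cycles. -/

section Cycles

open CategoryTheory CategoryTheory.Limits

universe u w

variable {C : Type u} [Category.{w} C] [Abelian C]

/-- A kernel of the differential is isomorphic to the cycles. -/
def cyclesIso (K : CochainComplex C ℕ) (i : ℕ) {M : C} (f : M ⟶ K.X i) (hf : Mono f)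
    (w : f ≫ K.d i (i + 1) = 0) (h : (ShortComplex.mk f _ w).Exact) : M ≅ K.cycles i :=
  h.fIsKernel.conePointUniqueUpToIso (K.cyclesIsKernel i (i + 1) (by simp))

lemma cyclesIso_hom_iCycles (K : CochainComplex C ℕ) (i : ℕ) {M : C} (f : M ⟶ K.X i) (hf : Mono f)
    (w : f ≫ K.d i (i + 1) = 0) (h : (ShortComplex.mk f _ w).Exact) :
    (cyclesIso K i f hf w h).hom ≫ K.iCycles i = f :=
  h.fIsKernel.conePointUniqueUpToIso_hom_comp
    (K.cyclesIsKernel i (i + 1) (by simp)) WalkingParallelPair.zero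

end Cycles

/-! ### Derived invariants in low degrees and dimension shift. -/

section Invariants

open CategoryTheory

variable {A : Type} [CommRing A] [HopfAlgebra ℂ A] {X Y Z : ExtArcRep.{v} A}

/-- The map on `G(𝒪)`-invariants. -/
def invMap (f : ExtArcRep.Hom X Y) : Rep.of X.invRep ⟶ Rep.of Y.invRep :=
  Rep.ofHom
    { toLinearMap := f.lin.restrict fun _ hv => f.map_inv hv
      isIntertwining' := fun t => by
        ext v : 2
        exact f.map_pointRep _ _ }

lemma mono_invMap (f : ExtArcRep.Hom X Y) (hf : Function.Injective f.lin) : Mono (invMap f) :=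
  (Rep.mono_iff_injective _).2 fun _ _ h => Subtype.ext (hf (congrArg Subtype.val h))

/-- Invariance is an equation in R ⊗ V for every R, and R ⊗ - keeps `f` injective by flatness over
the field. -/
lemma mem_inv_of_map (f : ExtArcRep.Hom X Y) (hf : Function.Injective f.lin) {v : X.V}
    (hv : f.lin v ∈ Y.inv) : v ∈ X.inv := by
  intro R _ _ g
  refine Module.Flat.lTensor_preserves_injective_linearMap (M := R) f.lin hf ?_
  rw [f.comm, LinearMap.lTensor_tmul, hv]

lemma invMap_exact (f : ExtArcRep.Hom X Y) (g : ExtArcRep.Hom Y Z)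
    (hf : Function.Injective f.lin) (hfg : Function.Exact f.lin g.lin) :
    Function.Exact (invMap f).hom (invMap g).hom := by
  rintro ⟨v, hv⟩
  constructor
  · intro h
    obtain ⟨x, rfl⟩ := (hfg v).1 (congrArg Subtype.val h)
    exact ⟨⟨x, mem_inv_of_map f hf hv⟩, rfl⟩
  · rintro ⟨x, hx⟩
    refine Subtype.ext ?_
    have h1 : f.lin (x : X.inv) = v := congrArg Subtype.val hx
    change g.lin v = 0
    rw [← h1, hfg.apply_apply_eq_zero]

namespace ExtArcRep.InjRes

lemma invComplex_d (P : X.InjRes) (n : ℕ) :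
    P.invComplex.d n (n + 1) = invMap (P.d n) :=
  CochainComplex.of_d (fun n => Rep.of (P.I n).invRep) (fun n => invMap (P.d n)) n

/-- The map from the first cosyzygy of an injective resolution. -/
def desc (P : X.InjRes) : Hom (quot P.ι) (P.I 1) :=
  quotDesc P.ι (P.d 0) P.exact_zero.apply_apply_eq_zero

lemma desc_comp (P : X.InjRes) :
    (P.desc.lin : _ → (P.I 1).V) ∘ (quotMap P.ι).lin = (P.d 0).lin :=
  funext fun y => quotDesc_quotMap P.ι (P.d 0) P.exact_zero.apply_apply_eq_zero y

/-- The injective resolution of the first cosyzygy. -/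
def tail (P : X.InjRes) : (quot P.ι).InjRes where
  I n := P.I (n + 1)
  injective n := P.injective (n + 1)
  ι := P.desc
  d n := P.d (n + 1)
  ι_injective := by
    rw [injective_iff_map_eq_zero]
    intro z hz
    obtain ⟨y, rfl⟩ := quotMap_surjective P.ι z
    have h1 : (P.d 0).lin y = 0 := (congrFun P.desc_comp y).symm.trans hz
    exact (quotMap_exact P.ι y).2 ((P.exact_zero y).1 h1)
  exact_zero := (Function.Surjective.comp_exact_iff_exact (quotMap_surjective P.ι)).1 (by
    have h := P.exact_succ 0
    rw [← P.desc_comp] at h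
    exact h)
  exact_succ n := P.exact_succ (n + 1)

/-- Dimension shift in the derived invariants. -/
def tailHomologyIso (P : X.InjRes) (n : ℕ) :
    P.tail.invComplex.homology (n + 1) ≅ P.invComplex.homology (n + 2) :=
  P.tail.invComplex.homologyIsoSc' n (n + 1) (n + 2) (by simp) (by simp) ≪≫
    ShortComplex.homologyMapIso (S₂ := P.invComplex.sc' (n + 1) (n + 2) (n + 3))
      (ShortComplex.isoMk (Iso.refl (P.invComplex.X (n + 1)))
      (Iso.refl (P.invComplex.X (n + 2))) (Iso.refl (P.invComplex.X (n + 3)))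
      (by
        change 𝟙 _ ≫ P.invComplex.d (n + 1) (n + 2) = P.tail.invComplex.d n (n + 1) ≫ 𝟙 _
        rw [Category.id_comp, invComplex_d, invComplex_d]
        rfl)
      (by
        change 𝟙 _ ≫ P.invComplex.d (n + 2) (n + 3) = P.tail.invComplex.d (n + 1) (n + 2) ≫ 𝟙 _
        rw [Category.id_comp, invComplex_d, invComplex_d]
        rfl)) ≪≫
    (P.invComplex.homologyIsoSc' (n + 1) (n + 2) (n + 3) (by simp) (by simp)).symm

/-- The cycles of degree zero are the invariants. -/
def zeroIso (P : X.InjRes) : Rep.of X.invRep ≅ P.invComplex.homology 0 :=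
  have h := invMap_exact P.ι (P.d 0) P.ι_injective P.exact_zero
  have w : invMap P.ι ≫ P.invComplex.d 0 1 = 0 := by
    rw [P.invComplex_d 0]
    ext v
    exact h.apply_apply_eq_zero v
  cyclesIso P.invComplex 0 (invMap P.ι) (mono_invMap P.ι P.ι_injective) w ((rep_exact_iff _).2 (by
    change Function.Exact (invMap P.ι).hom (P.invComplex.d 0 1).hom
    rw [P.invComplex_d 0]
    exact h)) ≪≫ P.invComplex.isoHomologyπ₀

lemma invMap_desc (P : X.InjRes) : invMap (quotMap P.ι) ≫ invMap P.desc = invMap (P.d 0) := by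
  ext v : 3
  exact Subtype.ext (congrFun P.desc_comp (Subtype.val v))

lemma invMap_desc_exact (P : X.InjRes) :
    Function.Exact (invMap P.desc).hom (invMap (P.d 1)).hom :=
  invMap_exact P.desc (P.d 1) P.tail.ι_injective P.tail.exact_zero

lemma invMap_desc_comp_d (P : X.InjRes) : invMap P.desc ≫ P.invComplex.d 1 2 = 0 := by
  rw [P.invComplex_d 1]
  ext v
  exact P.invMap_desc_exact.apply_apply_eq_zero v

/-- The cycles of degree one are the invariants of the first cosyzygy. -/
def descCyclesIso (P : X.InjRes) : Rep.of (quot P.ι).invRep ≅ P.invComplex.cycles 1 :=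
  cyclesIso P.invComplex 1 (invMap P.desc) (mono_invMap P.desc P.tail.ι_injective)
    P.invMap_desc_comp_d ((rep_exact_iff _).2 (by
      change Function.Exact (invMap P.desc).hom (P.invComplex.d 1 2).hom
      rw [P.invComplex_d 1]
      exact P.invMap_desc_exact))

lemma descCyclesIso_hom_iCycles (P : X.InjRes) :
    P.descCyclesIso.hom ≫ P.invComplex.iCycles 1 = invMap P.desc :=
  cyclesIso_hom_iCycles _ _ _ _ _ _

lemma toCycles_eq (P : X.InjRes) :
    P.invComplex.toCycles 0 1 = invMap (quotMap P.ι) ≫ P.descCyclesIso.hom := by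
  have h1 := P.invComplex.toCycles_i 0 1
  rw [P.invComplex_d 0, ← P.invMap_desc, ← P.descCyclesIso_hom_iCycles] at h1
  exact (cancel_mono (P.invComplex.iCycles 1)).1 (h1.trans (Category.assoc _ _ _).symm)

end ExtArcRep.InjRes

end Invariants

/-! ### Chevalley–Eilenberg cohomology against derived invariants. -/

section Comparison

open CategoryTheory CategoryTheory.Limits

variable {A : Type} [CommRing A] [HopfAlgebra ℂ A] {X Y Z : ExtArcRep.{v} A}

/-- The Chevalley-Eilenberg differential on invariant cochains, as a map of representations. -/
def ceInvD (X : ExtArcRep.{v} A) (n : ℕ) :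
    Rep.of (ceInvRep X n) ⟶ Rep.of (ceInvRep X (n + 1)) :=
  Rep.ofHom
    { toLinearMap := (ceD (zgO A) X.V n).restrict fun _ hω => ceInv_ceD X n hω
      isIntertwining' := fun t => by
        ext ω : 2
        exact ceD_cochainRep X n _ _ }

lemma ceComplex_d (X : ExtArcRep.{v} A) (n : ℕ) : (ceComplex X).d n (n + 1) = ceInvD X n :=
  CochainComplex.of_d (fun n => Rep.of (ceInvRep X n)) (ceInvD X) n

/-- The map on invariant cochains, as a map of representations. -/
def ceRepMap (f : ExtArcRep.Hom X Y) (n : ℕ) :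
    Rep.of (ceInvRep X n) ⟶ Rep.of (ceInvRep Y n) :=
  Rep.ofHom
    { toLinearMap := ceInvMap f n
      isIntertwining' := fun t => by
        ext ω : 2
        exact (f.cochainRep_comp _ _).symm }

/-- The map on complexes of invariant cochains. -/
def ceMap (f : ExtArcRep.Hom X Y) : ceComplex X ⟶ ceComplex Y :=
  CochainComplex.ofHom (ceRepMap f) fun n => by
    rw [ceComplex_d, ceComplex_d]
    ext ω : 3
    exact Subtype.ext (f.ceD_comp _)

/-- A short exact sequence of representations yields one of complexes of invariant cochains. -/
lemma ceMap_shortExact [Algebra.FiniteType ℂ A] (hG : IsReductive A) (f : ExtArcRep.Hom X Y)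
    (g : ExtArcRep.Hom Y Z) (hf : Function.Injective f.lin) (hg : Function.Surjective g.lin)
    (hfg : Function.Exact f.lin g.lin) (w : ceMap f ≫ ceMap g = 0) :
    (ShortComplex.mk (ceMap f) (ceMap g) w).ShortExact :=
  HomologicalComplex.shortExact_of_degreewise_shortExact _ fun n =>
    rep_shortExact (S := ShortComplex.mk (ceRepMap f n) (ceRepMap g n)
      (congrArg (fun h : ceComplex X ⟶ ceComplex Z => h.f n) w)) (ceInvMap_injective f hf n) (ceInvMap_exact f g hf hfg n)
      (ceInvMap_surjective hG g hg n)

lemma ceMap_comp_eq_zero (f : ExtArcRep.Hom X Y) (g : ExtArcRep.Hom Y Z)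
    (hfg : ∀ x, g.lin (f.lin x) = 0) : ceMap f ≫ ceMap g = 0 := by
  refine HomologicalComplex.hom_ext _ _ fun n => ?_
  change ceRepMap f n ≫ ceRepMap g n = 0
  ext ω : 3
  exact Subtype.ext (AlternatingMap.ext fun v =>
    hfg ((ω : zgO A [⋀^Fin n]→ₗ[ℂ] X.V) v))

variable [Algebra.FiniteType ℂ A]

lemma isZero_homology_of_isInjective (hG : IsReductive A) {J : ExtArcRep.{v} A}
    (hJ : J.IsInjective) (n : ℕ) : IsZero ((ceComplex J).homology (n + 1)) := by
  rw [← HomologicalComplex.exactAt_iff_isZero_homology,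
    HomologicalComplex.exactAt_iff' _ n (n + 1) (n + 2) (by simp) (by simp), rep_exact_iff]
  change Function.Exact ((ceComplex J).d n (n + 1)).hom ((ceComplex J).d (n + 1) (n + 2)).hom
  rw [ceComplex_d, ceComplex_d J (n + 1)]
  rintro ⟨ω, hω⟩
  constructor
  · intro h
    obtain ⟨η, hη, hd⟩ := injective_acyclic hG hJ hω (congrArg Subtype.val h)
    exact ⟨⟨η, hη⟩, Subtype.ext hd⟩
  · rintro ⟨⟨η, hη⟩, h⟩
    refine Subtype.ext ?_
    have h1 : ceD (zgO A) J.V n η = ω := congrArg Subtype.val h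
    change ceD (zgO A) J.V (n + 1) ω = 0
    rw [← h1, ceD_ceD]

lemma const_mem_ceInv (hG : IsReductive A) {v : X.V} (hv : v ∈ X.inv) :
    AlternatingMap.constOfIsEmpty ℂ (zgO A) (Fin 0) v ∈ ceInv X 0 := by
  obtain ⟨K, hK, -⟩ := exists_invariant_integral hG
  obtain ⟨h1, h2⟩ := (X.mem_inv_iff hK).1 hv
  exact ⟨⟨0, fun v ⟨i, _⟩ => i.elim0, fun y _ _ => h1 y⟩, fun g => AlternatingMap.ext fun _ => h2 g⟩

/-- An invariant vector as a cochain of degree zero. -/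
def invToCe (hG : IsReductive A) (X : ExtArcRep.{v} A) :
    Rep.of X.invRep ⟶ Rep.of (ceInvRep X 0) :=
  Rep.ofHom
    { toLinearMap :=
        { toFun := fun v => ⟨AlternatingMap.constOfIsEmpty ℂ (zgO A) (Fin 0) (v : X.V),
            const_mem_ceInv hG v.2⟩
          map_add' := fun _ _ => rfl
          map_smul' := fun _ _ => rfl }
      isIntertwining' := fun _ => rfl }

lemma mono_invToCe (hG : IsReductive A) (X : ExtArcRep.{v} A) : Mono (invToCe hG X) :=
  (Rep.mono_iff_injective _).2 fun _ _ h => Subtype.ext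
    (congrArg (fun ω : ceInv X 0 => (ω : zgO A [⋀^Fin 0]→ₗ[ℂ] X.V) ![]) h)

/-- A G-invariant cochain of degree zero is a G-fixed vector, and its differential is y ↦ y·v; so
the cocycles are the invariants by `mem_inv_iff`. -/
lemma invToCe_exact (hG : IsReductive A) (X : ExtArcRep.{v} A) :
    Function.Exact (invToCe hG X).hom (ceInvD X 0).hom := by
  obtain ⟨K, hK, -⟩ := exists_invariant_integral hG
  rintro ⟨ω, hω⟩
  have hd : ∀ (ω : zgO A [⋀^Fin 0]→ₗ[ℂ] X.V) (y : zgO A),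
      ceD (zgO A) X.V 0 ω ![y] = ⁅y, ω ![]⁆ := fun ω y => by
    rw [ceD_eq_ceAux, ceAux_zero_apply]
    rfl
  have hv : ∀ v : Fin 0 → zgO A, v = ![] := fun v => Subsingleton.elim _ _
  constructor
  · intro h
    have h1 : ceD (zgO A) X.V 0 ω = 0 := congrArg Subtype.val h
    refine ⟨⟨ω ![], (X.mem_inv_iff hK).2 ⟨fun y => ?_, fun g => ?_⟩⟩,
      Subtype.ext (AlternatingMap.ext fun v => ?_)⟩
    · rw [← hd, h1]
      rfl
    · have h2 := congrArg (fun ω : zgO A [⋀^Fin 0]→ₗ[ℂ] X.V => ω ![]) (hω.2 g)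
      simp only [cochainRep_apply] at h2
      rwa [hv fun i => _] at h2
    · rw [hv v]
      rfl
  · rintro ⟨⟨x, hx⟩, h⟩
    have h1 : AlternatingMap.constOfIsEmpty ℂ (zgO A) (Fin 0) x = ω := congrArg Subtype.val h
    refine Subtype.ext ?_
    change ceD (zgO A) X.V 0 ω = 0
    rw [← h1]
    refine AlternatingMap.ext fun v => ?_
    rw [ceD_eq_ceAux, ceAux_zero_apply]
    exact ((X.mem_inv_iff hK).1 hx).1 _

lemma invToCe_comp_d (hG : IsReductive A) (X : ExtArcRep.{v} A) :
    invToCe hG X ≫ (ceComplex X).d 0 1 = 0 := by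
  rw [ceComplex_d X 0]
  ext v
  exact (invToCe_exact hG X).apply_apply_eq_zero v

/-- The zero cycles of the Chevalley-Eilenberg complex are the invariants. -/
def ceCyclesIso (hG : IsReductive A) (X : ExtArcRep.{v} A) :
    Rep.of X.invRep ≅ (ceComplex X).cycles 0 :=
  cyclesIso (ceComplex X) 0 (invToCe hG X) (mono_invToCe hG X) (invToCe_comp_d hG X)
    ((rep_exact_iff _).2 (by
      change Function.Exact (invToCe hG X).hom ((ceComplex X).d 0 1).hom
      rw [ceComplex_d X 0]
      exact invToCe_exact hG X))

lemma ceCyclesIso_hom_iCycles (hG : IsReductive A) (X : ExtArcRep.{v} A) :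
    (ceCyclesIso hG X).hom ≫ (ceComplex X).iCycles 0 = invToCe hG X :=
  cyclesIso_hom_iCycles _ _ _ _ _ _

/-- The cohomology of degree zero of the Chevalley-Eilenberg complex. -/
def ceZeroIso (hG : IsReductive A) (X : ExtArcRep.{v} A) :
    Rep.of X.invRep ≅ (ceComplex X).homology 0 :=
  ceCyclesIso hG X ≪≫ (ceComplex X).isoHomologyπ₀

lemma ceZeroIso_naturality (hG : IsReductive A) (f : ExtArcRep.Hom X Y) :
    (ceZeroIso hG X).hom ≫ HomologicalComplex.homologyMap (ceMap f) 0 =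
      invMap f ≫ (ceZeroIso hG Y).hom := by
  have h : (ceCyclesIso hG X).hom ≫ HomologicalComplex.cyclesMap (ceMap f) 0 =
      invMap f ≫ (ceCyclesIso hG Y).hom := by
    rw [← cancel_mono ((ceComplex Y).iCycles 0), Category.assoc, Category.assoc,
      HomologicalComplex.cyclesMap_i, ceCyclesIso_hom_iCycles, ← Category.assoc,
      ceCyclesIso_hom_iCycles]
    rfl
  simp only [ceZeroIso, Iso.trans_hom, Category.assoc, CochainComplex.isoHomologyπ₀,
    HomologicalComplex.isoHomologyπ_hom]
  rw [HomologicalComplex.homologyπ_naturality, ← Category.assoc, h, Category.assoc]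

/-- The Chevalley-Eilenberg complex computes the derived invariants. -/
lemma nonempty_homology_iso (hG : IsReductive A) (n : ℕ) : ∀ (X : ExtArcRep.{v} A) (P : X.InjRes),
    Nonempty ((ceComplex X).homology n ≅ P.invComplex.homology n) := by
  have hS : ∀ (X : ExtArcRep.{v} A) (P : X.InjRes), (ShortComplex.mk (ceMap P.ι)
      (ceMap (ExtArcRep.quotMap P.ι)) (ceMap_comp_eq_zero _ _
        (ExtArcRep.quotMap_exact P.ι).apply_apply_eq_zero)).ShortExact := fun X P =>
    ceMap_shortExact hG _ _ P.ι_injective (ExtArcRep.quotMap_surjective _)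
      (ExtArcRep.quotMap_exact _) _
  induction n with
  | zero => exact fun X P => ⟨(ceZeroIso hG X).symm ≪≫ P.zeroIso⟩
  | succ n ih =>
    intro X P
    cases n with
    | zero =>
      -- In degree one both sides are cokernels of the map from the invariants of I⁰ to the
      -- invariants of I⁰/X.
      refine homology_one_iso (hS X P) (isZero_homology_of_isInjective hG (P.injective 0) 0)
        (ceZeroIso hG (P.I 0)) (P.descCyclesIso.symm ≪≫ ceZeroIso hG (ExtArcRep.quot P.ι)) ?_
      refine Eq.trans ?_ (ceZeroIso_naturality hG (ExtArcRep.quotMap P.ι)).symm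
      rw [Iso.trans_hom, ← Category.assoc]
      congr 1
      exact (Iso.comp_inv_eq _).2 P.toCycles_eq
    | succ n =>
      -- From degree two on, acyclicity of I⁰ in two neighbouring degrees makes the connecting map
      -- an isomorphism; induction applies to I⁰/X with the tail of the resolution.
      exact ⟨((hS X P).δIso (n + 1) (n + 2) rfl
        (isZero_homology_of_isInjective hG (P.injective 0) n)
        (isZero_homology_of_isInjective hG (P.injective 0) (n + 1))).symm ≪≫
        (ih _ P.tail).some ≪≫ P.tailHomologyIso n⟩

end Comparison

end ArcRep
end

theorem proposition4p6 {A : Type} [CommRing A] [HopfAlgebra ℂ A] [Algebra.FiniteType ℂ A]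
    (hG : ArcRep.IsReductive A) (X : ArcRep.ExtArcRep.{v} A) :
    Nonempty X.InjRes ∧
      ∀ P : X.InjRes, ∃ φ : ArcRep.ceComplex X ⟶ P.invComplex, QuasiIso φ := by
  refine ⟨⟨X.cofreeRes⟩, fun P => ?_⟩
  exact ArcRep.exists_quasiIso_of_homology_iso _ _ (ArcRep.monosSplit_ceInvRep X)
    (fun n => ArcRep.monosSplit_invRep (P.I n)) fun n => ArcRep.nonempty_homology_iso hG n X P
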